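/- Let $g\ge 0$ and $k\ge 1$ be integers. Let $L\to\mathbb T^{2g}=\mathbb R^{2g}/\mathbb Z^{2g}$ be the prequantum line bundle: smooth sections of $L^n$ are the smooth functions $s$ on $\mathbb R^{2g}$ with $s(u+\lambda)=\big(\alpha(\lambda)e^{-\pi i\omega(u,\lambda)}\big)^n s(u)$ for $\lambda\in\mathbb Z^{2g}$, where $\omega(u,v)=\sum_j(u_{g+j}v_j-u_jv_{g+j})$ and $\alpha(\lambda)=(-1)^{\sum_j\lambda_j\lambda_{g+j}}$. Let $\Gamma^{-\infty}(L^k)$ be the dual of $\Gamma^\infty(L^{-k})$ (weak topology). For $l\in\{0,\dots,k-1\}^g$ and $s\in\Gamma^\infty(L^k)$ let $$(s)_l(y)=\int_{[0,1]^g}s\big(x,y+\tfrac lk\big)e^{k\pi i\,{}^tx(y+\frac lk)}e^{-2\pi i\,{}^tlx}\,d^gx .$$ There is a unique topological isomorphism $W:\Gamma^{-\infty}(L^k)\to\prod_l\mathcal S'(\mathbb R^g)$, $\sigma\mapsto((\sigma)_l)_l$ (the Weil–Brezin isomorphism), with $\sigma(\varphi)=\sum_l(\sigma)_l\big(\overline{(\bar\varphi)_l}\big)$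 for all $\varphi\in\Gamma^\infty(L^{-k})$. For real $g\times g$ matrices $P,L,Q$ with $P,Q$ symmetric and $L$ invertible, and $m\in\mathbb Z$ with $(i^m)^2=\operatorname{sign}\det L$, let $$S(P,L,Q)_mf(u)=i^{-\frac g2+m}k^{\frac g2}\sqrt{|\det L|}\int_{\mathbb R^g}e^{k\pi i({}^tuPu-2\,{}^tu\,{}^tLv+{}^tvQv)}f(v)\,d^gv,\qquad i^\phi:=e^{\pi i\phi/2}.$$ Let $Mp(2g,\mathbb R)$ be the group generated by these operators (unitary on $L^2(\mathbb R^g)$, automorphisms of $\mathcal S(\mathbb R^g)$, extended to $\mathcal S'(\mathbb R^g)$). There is a unique surjective homomorphism $Mp(2g,\mathbb R)\to Sp(2g,\mathbb R)$ with kernel of order $2$ that maps $S(P,L,Q)_m$ to $\begin{bmatrix}PL^{-1}&PL^{-1}Q-{}^tL\\L^{-1}&L^{-1}Q\end{bmatrix}$. The group $Mp(2g,\mathbb R)$ acts on $\Gamma^{-\infty}(L^k)$ by $(A\sigma)_l=A(\sigma)_l$. Let $\mathbb D_g$ be the closed Siegel disc of symmetric complex matrices $\tau$ with $1-\tau^*\tau\ge0$.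 The group $Sp(2g,\mathbb R)$ acts on it by extending the action $\Omega\mapsto(A\Omega+B)(C\Omega+D)^{-1}$ on the Siegel upper half-space $\mathbb H_g$, embedded by $\Omega\mapsto\tau(\Omega)=(i-\Omega)(i+\Omega)^{-1}$. Let $\delta\to\mathbb D_g$ be the half-form line bundle with trivializing section $\sqrt{d^g(x,y)_\tau}$, whose square is the $g$-form $d^g(x,y)_\tau=\bigwedge^g[(1+\tau)dx-i(1-\tau)dy]$, and for $\Omega\in\mathbb H_g$, $\tau=\tau(\Omega)$, let $\sqrt{d^gz_\Omega}=\det(1+\tau)^{-1/2}\sqrt{d^g(x,y)_\tau}$ (branch $1$ at $\tau=0$). There is a unique action of $Mp(2g,\mathbb R)$ on $\delta$, each element acting continuously and linearly on fibres, that lifts the action of $Sp(2g,\mathbb R)$ on $\mathbb D_g$, whose square is the action $(M^*)^{-1}$ on $g$-forms, and that satisfies $$S(P,L,Q)_m\sqrt{d^gz_\Omega}=i^{-m}|\det L|^{-\frac12}\sqrt{\det(\Omega+Q)}\,\sqrt{d^gz_{\Omega'}},\qquad \Omega\in\mathbb H_g,\quad \Omega'=M(\Omega),$$ where $M$ is the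 image of $S(P,L,Q)_m$ and $\sqrt{\det(\Omega+Q)}=i^{g/2}\big(\int_{\mathbb R^g}e^{\pi i\,{}^t\xi(\Omega+Q)\xi}d^g\xi\big)^{-1}$. **Proposition.** The product action $\sigma\otimes\nu\mapsto A\sigma\otimes A\nu$ of $Mp(2g,\mathbb R)$ on the bundle $\Gamma^{-\infty}(L^k)\otimes\sqrt{d^g(x,y)_\tau}\to\mathbb D_g$ descends to $Sp(2g,\mathbb R)$: there is a unique action of $Sp(2g,\mathbb R)$ on the total space of this bundle for which the image in $Sp(2g,\mathbb R)$ of each $A\in Mp(2g,\mathbb R)$ acts by $\sigma\otimes\nu\mapsto A\sigma\otimes A\nu$. Each element acts by a continuous map that is a linear isomorphism on fibres, and the action lifts the symplectic action on $\mathbb D_g$. -/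

import Mathlib

open scoped SchwartzMap FourierTransform Matrix ContDiff ComplexOrder
open MeasureTheory

namespace WeilTorus

noncomputable section

/-- The space `ℝ^g` with its Euclidean structure and Lebesgue measure. -/
abbrev Euc (g : ℕ) : Type := EuclideanSpace ℝ (Fin g)

/-- The quadratic form `ᵗu P u`. -/
def quad {g : ℕ} (P : Matrix (Fin g) (Fin g) ℝ) (u : Euc g) : ℝ :=
  u.ofLp ⬝ᵥ (P *ᵥ u.ofLp)

/-- The function `u ↦ exp (k π i ᵗu P u)`. -/
def chirp {g : ℕ} (k : ℕ) (P : Matrix (Fin g) (Fin g) ℝ) (u : Euc g) : ℂ :=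
  Complex.exp ((k * Real.pi * quad P u : ℝ) * Complex.I)

lemma expI_hasTemperateGrowth :
    (fun t : ℝ => Complex.exp (t * Complex.I)).HasTemperateGrowth := by
  have hd : ∀ n : ℕ, iteratedDeriv n (fun t : ℝ => Complex.exp (t * Complex.I)) =
      fun t : ℝ => Complex.I ^ n * Complex.exp (t * Complex.I) := by
    intro n
    induction n with
    | zero => simp
    | succ n ih =>
      rw [iteratedDeriv_succ, ih]
      funext t
      have h1 : HasDerivAt (fun t : ℝ => (t : ℂ) * Complex.I) (1 * Complex.I) t :=
        (Complex.ofRealCLM.hasDerivAt).mul_const _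
      have h2 := (h1.cexp).const_mul (Complex.I ^ n)
      rw [h2.deriv]
      ring
  refine ⟨(Complex.ofRealCLM.contDiff.mul contDiff_const).cexp, fun n => ⟨0, 1, fun x => ?_⟩⟩
  rw [norm_iteratedFDeriv_eq_norm_iteratedDeriv, hd]
  simp [Complex.norm_exp_ofReal_mul_I]

lemma quad_hasTemperateGrowth {g : ℕ} (P : Matrix (Fin g) (Fin g) ℝ) :
    (quad P).HasTemperateGrowth := by
  have hc : ∀ i : Fin g, (fun u : Euc g => u i).HasTemperateGrowth := fun i =>
    (EuclideanSpace.proj (𝕜 := ℝ) i).hasTemperateGrowth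
  have : quad P = fun u : Euc g => ∑ i, ∑ j, u i * (P i j * u j) := by
    funext u
    simp [quad, dotProduct, Matrix.mulVec, Finset.mul_sum]
  rw [this]
  refine Function.HasTemperateGrowth.sum fun i _ => Function.HasTemperateGrowth.sum fun j _ => ?_
  exact (hc i).mul ((Function.HasTemperateGrowth.const _).mul (hc j))

lemma chirp_hasTemperateGrowth {g : ℕ} (k : ℕ) (P : Matrix (Fin g) (Fin g) ℝ) :
    (chirp k P).HasTemperateGrowth :=
  expI_hasTemperateGrowth.comp
    ((Function.HasTemperateGrowth.const ((k : ℝ) * Real.pi)).mul (quad_hasTemperateGrowth P))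

lemma chirp_mul_chirp_neg {g : ℕ} (k : ℕ) (P : Matrix (Fin g) (Fin g) ℝ) (u : Euc g) :
    chirp k P u * chirp k (-P) u = 1 := by
  simp [chirp, quad, Matrix.neg_mulVec, ← Complex.exp_add]

/-- Multiplication by `exp (k π i ᵗu P u)` as an automorphism of the Schwartz space. -/
def chirpCLE {g : ℕ} (k : ℕ) (P : Matrix (Fin g) (Fin g) ℝ) :
    𝓢(Euc g, ℂ) ≃L[ℂ] 𝓢(Euc g, ℂ) :=
  ContinuousLinearEquiv.equivOfInverse
    (SchwartzMap.smulLeftCLM ℂ (chirp k P)) (SchwartzMap.smulLeftCLM ℂ (chirp k (-P)))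
    (fun f => by
      ext u
      rw [SchwartzMap.smulLeftCLM_apply_apply (chirp_hasTemperateGrowth k _),
        SchwartzMap.smulLeftCLM_apply_apply (chirp_hasTemperateGrowth k _),
        smul_smul, mul_comm, chirp_mul_chirp_neg, one_smul])
    (fun f => by
      ext u
      rw [SchwartzMap.smulLeftCLM_apply_apply (chirp_hasTemperateGrowth k _),
        SchwartzMap.smulLeftCLM_apply_apply (chirp_hasTemperateGrowth k _),
        smul_smul, chirp_mul_chirp_neg, one_smul])

@[simp] lemma chirpCLE_apply {g : ℕ} (k : ℕ) (P : Matrix (Fin g) (Fin g) ℝ)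
    (f : 𝓢(Euc g, ℂ)) (u : Euc g) : chirpCLE k P f u = chirp k P u * f u := by
  change SchwartzMap.smulLeftCLM ℂ (chirp k P) f u = _
  rw [SchwartzMap.smulLeftCLM_apply_apply (chirp_hasTemperateGrowth k _), smul_eq_mul]

/-- The linear automorphism `u ↦ A u` of `ℝ^g` for an invertible matrix `A`. -/
def matCLE {g : ℕ} (A : Matrix (Fin g) (Fin g) ℝ) (hA : IsUnit A.det) : Euc g ≃L[ℝ] Euc g :=
  ContinuousLinearEquiv.equivOfInverse
    (Matrix.toEuclideanCLM (𝕜 := ℝ) A) (Matrix.toEuclideanCLM (𝕜 := ℝ) A⁻¹)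
    (fun u => by
      rw [← mul_apply_eq_comp, ← map_mul, Matrix.nonsing_inv_mul _ hA, map_one]; rfl)
    (fun u => by
      rw [← mul_apply_eq_comp, ← map_mul, Matrix.mul_nonsing_inv _ hA, map_one]; rfl)

lemma matCLE_apply {g : ℕ} (A : Matrix (Fin g) (Fin g) ℝ) (hA : IsUnit A.det) (u : Euc g) :
    matCLE A hA u = WithLp.toLp 2 (A *ᵥ u.ofLp) := rfl

/-- The substitution `f ↦ f ∘ e` as an automorphism of the Schwartz space. -/
def substCLE {g : ℕ} (e : Euc g ≃L[ℝ] Euc g) : 𝓢(Euc g, ℂ) ≃L[ℂ] 𝓢(Euc g, ℂ) :=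
  ContinuousLinearEquiv.equivOfInverse
    (SchwartzMap.compCLMOfContinuousLinearEquiv ℂ e)
    (SchwartzMap.compCLMOfContinuousLinearEquiv ℂ e.symm)
    (fun f => by ext u; simp) (fun f => by ext u; simp)

@[simp] lemma substCLE_apply {g : ℕ} (e : Euc g ≃L[ℝ] Euc g) (f : 𝓢(Euc g, ℂ)) (u : Euc g) :
    substCLE e f u = f (e u) := rfl

/-- Complex conjugation `f ↦ conj f` on the Schwartz space. -/
def conjS {g : ℕ} : 𝓢(Euc g, ℂ) →L[ℝ] 𝓢(Euc g, ℂ) :=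
  SchwartzMap.postcompCLM (𝕜 := ℝ) (Complex.conjCLE : ℂ →L[ℝ] ℂ)

@[simp] lemma conjS_apply {g : ℕ} (f : 𝓢(Euc g, ℂ)) (u : Euc g) :
    conjS f u = star (f u) := rfl

/-- The data `(P, L, Q)_m`: real `g × g` matrices with `P`, `Q` symmetric and `L` invertible,
and an integer `m` such that `i ^ m` is a square root of `sign (det L)`. -/
structure GenData (g : ℕ) where
  P : Matrix (Fin g) (Fin g) ℝ
  L : Matrix (Fin g) (Fin g) ℝ
  Q : Matrix (Fin g) (Fin g) ℝ
  m : ℤ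
  symm_P : P.IsSymm
  symm_Q : Q.IsSymm
  isUnit_L : IsUnit L.det
  sq_m : (Complex.I ^ m) ^ 2 = ((SignType.sign L.det : ℝ) : ℂ)

/-- `i ^ φ = exp (π i φ / 2)` for real `φ`. -/
def iPow (φ : ℝ) : ℂ := Complex.exp (Real.pi * Complex.I / 2 * φ)

lemma isUnit_smul_det {g : ℕ} (k : ℕ) [NeZero k] {L : Matrix (Fin g) (Fin g) ℝ}
    (hL : IsUnit L.det) : IsUnit ((k : ℝ) • L).det := by
  rw [Matrix.det_smul]
  exact (IsUnit.mk0 _ (pow_ne_zero _ (Nat.cast_ne_zero.mpr (NeZero.ne k)))).mul hL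

/-- The constant `i^(-g/2 + m) k^(g/2) √|det L|` in front of the integral operator. -/
def genConst {g : ℕ} (k : ℕ) (D : GenData g) : ℂ :=
  iPow (-(g : ℝ) / 2 + D.m) * (((k : ℝ) ^ ((g : ℝ) / 2) * √|D.L.det| : ℝ) : ℂ)

lemma genConst_ne_zero {g : ℕ} (k : ℕ) [NeZero k] (D : GenData g) : genConst k D ≠ 0 := by
  have hk : (0 : ℝ) < k := Nat.cast_pos.mpr (NeZero.pos k)
  have hL : 0 < |D.L.det| := abs_pos.mpr D.isUnit_L.ne_zero
  have : 0 < (k : ℝ) ^ ((g : ℝ) / 2) * √|D.L.det| :=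
    mul_pos (Real.rpow_pos_of_pos hk _) (Real.sqrt_pos.mpr hL)
  exact mul_ne_zero (Complex.exp_ne_zero _) (Complex.ofReal_ne_zero.mpr this.ne')

/-- The generator `S(P, L, Q)_m` of the metaplectic group, as an automorphism of the Schwartz
space: multiplication by `exp (k π i ᵗv Q v)`, Fourier transform, evaluation at `k L u`,
multiplication by `exp (k π i ᵗu P u)`, and a constant; see `genS_apply` for the integral. -/
def genS {g : ℕ} (k : ℕ) [NeZero k] (D : GenData g) : 𝓢(Euc g, ℂ) ≃L[ℂ] 𝓢(Euc g, ℂ) :=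
  ((((chirpCLE k D.Q).trans (FourierTransform.fourierCLE ℂ 𝓢(Euc g, ℂ))).trans
    (substCLE (matCLE ((k : ℝ) • D.L) (isUnit_smul_det k D.isUnit_L)))).trans
      (chirpCLE k D.P)).trans
        (ContinuousLinearEquiv.smulLeft (Units.mk0 (genConst k D) (genConst_ne_zero k D)))

lemma genS_apply_fourier {g : ℕ} (k : ℕ) [NeZero k] (D : GenData g)
    (f : 𝓢(Euc g, ℂ)) (u : Euc g) :
    genS k D f u = genConst k D * (chirp k D.P u *
      (𝓕 (chirpCLE k D.Q f)) (WithLp.toLp 2 (((k : ℝ) • D.L) *ᵥ u.ofLp))) := by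
  change genConst k D • (chirpCLE k D.P _) u = _
  rw [chirpCLE_apply]
  rfl

/-- The integral formula for `S(P, L, Q)_m`. -/
theorem genS_apply {g : ℕ} (k : ℕ) [NeZero k] (D : GenData g)
    (f : 𝓢(Euc g, ℂ)) (u : Euc g) :
    genS k D f u =
      iPow (-(g : ℝ) / 2 + D.m) * (((k : ℝ) ^ ((g : ℝ) / 2) * √|D.L.det| : ℝ) : ℂ) *
        ∫ v : Euc g, Complex.exp (k * Real.pi * Complex.I *
          ((u.ofLp ⬝ᵥ (D.P *ᵥ u.ofLp) - 2 * (u.ofLp ⬝ᵥ (D.Lᵀ *ᵥ v.ofLp))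
            + v.ofLp ⬝ᵥ (D.Q *ᵥ v.ofLp) : ℝ) : ℂ)) * f v := by
  rw [genS_apply_fourier, SchwartzMap.fourier_coe, Real.fourier_eq']
  unfold genConst
  congr 1
  rw [← integral_const_mul]
  congr 1
  funext v
  rw [chirpCLE_apply, smul_eq_mul, chirp, chirp, ← mul_assoc, ← mul_assoc, ← Complex.exp_add,
    ← Complex.exp_add]
  congr 2
  have : inner ℝ v (WithLp.toLp 2 (((k : ℝ) • D.L) *ᵥ u.ofLp)) =
      k * (u.ofLp ⬝ᵥ (D.Lᵀ *ᵥ v.ofLp)) := by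
    rw [Matrix.mulVec_transpose, dotProduct_comm, ← Matrix.dotProduct_mulVec, Matrix.smul_mulVec]
    simp [PiLp.inner_apply, dotProduct, Finset.mul_sum, mul_assoc, mul_comm, mul_left_comm]
  rw [this]
  simp only [quad]
  push_cast
  ring

/-- The metaplectic group `Mp(2g, ℝ)`: the group generated by the operators `S(P, L, Q)_m`.
Its elements are recorded by their action on the Schwartz space, which they preserve; by
`Mp_isometry` they preserve the `L²` inner product, so they extend uniquely from this dense
subspace to unitary operators of `L²(ℝ^g)`. -/
def Mp (g k : ℕ) [NeZero k] : Subgroup (𝓢(Euc g, ℂ) ≃L[ℂ] 𝓢(Euc g, ℂ)) :=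
  Subgroup.closure (Set.range (genS (g := g) k))

/-- The generator `S(P, L, Q)_m` as an element of the metaplectic group. -/
def mpGen {g : ℕ} (k : ℕ) [NeZero k] (D : GenData g) : Mp g k :=
  ⟨genS k D, Subgroup.subset_closure ⟨D, rfl⟩⟩

lemma norm_genConst_sq {g : ℕ} (k : ℕ) [NeZero k] (D : GenData g) :
    star (genConst k D) * genConst k D = ((|((k : ℝ) • D.L).det| : ℝ) : ℂ) := by
  have hk : (0 : ℝ) ≤ k := Nat.cast_nonneg k
  rw [Complex.star_def, ← Complex.normSq_eq_conj_mul_self]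
  congr 1
  rw [Complex.normSq_eq_norm_sq, genConst, norm_mul, iPow]
  have : ‖Complex.exp (Real.pi * Complex.I / 2 * ((-(g : ℝ) / 2 + D.m : ℝ) : ℂ))‖ = 1 := by
    rw [show (Real.pi * Complex.I / 2 * ((-(g : ℝ) / 2 + D.m : ℝ) : ℂ)) =
      ((Real.pi / 2 * (-(g : ℝ) / 2 + D.m) : ℝ) : ℂ) * Complex.I by push_cast; ring]
    exact Complex.norm_exp_ofReal_mul_I _
  rw [this, one_mul, Complex.norm_real, Real.norm_eq_abs, sq_abs, mul_pow,
    Real.sq_sqrt (abs_nonneg _), Matrix.det_smul, Fintype.card_fin, abs_mul,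
    abs_of_nonneg (pow_nonneg hk g), ← Real.rpow_natCast ((k : ℝ) ^ ((g : ℝ) / 2)) 2,
    ← Real.rpow_mul hk]
  congr 1
  rw [← Real.rpow_natCast]
  congr 1
  push_cast
  ring

lemma star_chirp_mul {g : ℕ} (k : ℕ) (P : Matrix (Fin g) (Fin g) ℝ) (u : Euc g) :
    star (chirp k P u) * chirp k P u = 1 := by
  rw [Complex.star_def, ← Complex.normSq_eq_conj_mul_self, Complex.normSq_eq_norm_sq, chirp,
    Complex.norm_exp_ofReal_mul_I]
  simp

lemma genS_isometry {g : ℕ} (k : ℕ) [NeZero k] (D : GenData g) (f h : 𝓢(Euc g, ℂ)) :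
    ∫ u, star (genS k D f u) * genS k D h u = ∫ u, star (f u) * h u := by
  have hp := SchwartzMap.integral_inner_fourier_fourier (chirpCLE k D.Q f) (chirpCLE k D.Q h)
  simp only [RCLike.inner_apply', chirpCLE_apply] at hp
  have h2 : ∀ u, star (f u) * h u =
      star (chirp k D.Q u * f u) * (chirp k D.Q u * h u) := by
    intro u
    have := star_chirp_mul k D.Q u
    rw [star_mul']
    linear_combination (-(star (f u) * h u)) * this
  simp only [h2]
  refine Eq.trans ?_ hp
  set e := matCLE ((k : ℝ) • D.L) (isUnit_smul_det k D.isUnit_L) with he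
  set F : Euc g → ℂ := fun w =>
    star ((𝓕 (chirpCLE k D.Q f)) w) * (𝓕 (chirpCLE k D.Q h)) w with hF
  have h3 : ∀ u, star (genS k D f u) * genS k D h u =
      ((|((k : ℝ) • D.L).det| : ℝ) : ℂ) * F (e u) := by
    intro u
    rw [genS_apply_fourier, genS_apply_fourier, hF, he, matCLE_apply, ← norm_genConst_sq]
    simp only [star_mul']
    have := star_chirp_mul k D.P u
    linear_combination (star (genConst k D) * genConst k D *
      (star ((𝓕 (chirpCLE k D.Q f)) (WithLp.toLp 2 (((k : ℝ) • D.L) *ᵥ u.ofLp))) *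
        (𝓕 (chirpCLE k D.Q h)) (WithLp.toLp 2 (((k : ℝ) • D.L) *ᵥ u.ofLp)))) * this
  simp only [h3]
  rw [integral_const_mul]
  have hdet : LinearMap.det (e.toLinearEquiv : Euc g →ₗ[ℝ] Euc g) = ((k : ℝ) • D.L).det := by
    have : (e.toLinearEquiv : Euc g →ₗ[ℝ] Euc g) =
      Matrix.toLpLin 2 2 ((k : ℝ) • D.L) := rfl
    rw [this, Matrix.toLpLin_eq_toLin, LinearMap.det_toLin]
  have hne : ((k : ℝ) • D.L).det ≠ 0 := (isUnit_smul_det k D.isUnit_L).ne_zero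
  have hmap := MeasureTheory.Measure.map_linearMap_addHaar_eq_smul_addHaar
    (volume : Measure (Euc g)) (f := (e.toLinearEquiv : Euc g →ₗ[ℝ] Euc g)) (by rwa [hdet])
  have h4 : ∫ u, F (e u) = |(((k : ℝ) • D.L).det)⁻¹| • ∫ w, F w := by
    have h5 : ∫ w, F w ∂(Measure.map e volume) = ∫ u, F (e u) :=
      e.toHomeomorph.measurableEmbedding.integral_map F
    rw [← h5]
    change ∫ w, F w ∂(Measure.map (e.toLinearEquiv : Euc g →ₗ[ℝ] Euc g) volume) = _
    rw [hmap, hdet, integral_smul_measure, ENNReal.toReal_ofReal (abs_nonneg _)]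
  rw [h4, Complex.real_smul, ← mul_assoc, ← Complex.ofReal_mul, ← abs_mul,
    mul_inv_cancel₀ hne]
  simp [hF]

/-- The elements of the metaplectic group preserve the `L²` inner product. -/
theorem Mp_isometry {g k : ℕ} [NeZero k] (A : Mp g k) (f h : 𝓢(Euc g, ℂ)) :
    ∫ u, star (A.1 f u) * A.1 h u = ∫ u, star (f u) * h u := by
  obtain ⟨A, hA⟩ := A
  change ∫ u, star (A f u) * A h u = _
  induction hA using Subgroup.closure_induction generalizing f h with
  | mem x hx => obtain ⟨D, rfl⟩ := hx; exact genS_isometry k D f h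
  | one => rfl
  | mul x y _ _ hx hy => exact (hx (y f) (y h)).trans (hy f h)
  | inv x _ hx =>
    have h1 := hx (x⁻¹ f) (x⁻¹ h)
    have h2 : ∀ w, x (x⁻¹ w) = w := fun w => x.apply_symm_apply w
    rw [h2, h2] at h1
    exact h1.symm

/-- The transpose `f ↦ conj (A⁻¹ (conj f))` of a unitary operator `A`, with respect to the
bilinear pairing `∫ f h`; see `integral_mp_mul`. -/
def transposeCLM {g : ℕ} (A : 𝓢(Euc g, ℂ) ≃L[ℂ] 𝓢(Euc g, ℂ)) : 𝓢(Euc g, ℂ) →L[ℂ] 𝓢(Euc g, ℂ) where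
  toFun f := conjS (A.symm (conjS f))
  map_add' f h := by simp
  map_smul' c f := by
    have h1 : conjS (c • f) = (star c) • conjS f := by ext u; simp
    have h2 : ∀ w : 𝓢(Euc g, ℂ), conjS ((star c) • w) = c • conjS w := by intro w; ext u; simp
    rw [h1, map_smul, h2]; rfl
  cont := conjS.continuous.comp (A.symm.continuous.comp conjS.continuous)

lemma integral_mp_mul {g k : ℕ} [NeZero k] (A : Mp g k) (f h : 𝓢(Euc g, ℂ)) :
    ∫ u, A.1 f u * h u = ∫ u, f u * transposeCLM A.1 h u := by
  have h1 := Mp_isometry A (A.1.symm (conjS h)) f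
  rw [A.1.apply_symm_apply] at h1
  have e1 : ∀ u, A.1 f u * h u = star (conjS h u) * A.1 f u := by
    intro u; simp [mul_comm]
  have e2 : ∀ u, f u * transposeCLM A.1 h u = star (A.1.symm (conjS h) u) * f u := by
    intro u; exact mul_comm _ _
  simp only [e1, e2]
  exact h1

/-- The operator on tempered distributions that extends an element of the metaplectic group;
see `mpTempered_toTempered`. -/
def mpTempered {g k : ℕ} [NeZero k] (A : Mp g k) : 𝓢'(Euc g, ℂ) →L[ℂ] 𝓢'(Euc g, ℂ) :=
  PointwiseConvergenceCLM.precomp ℂ (transposeCLM A.1)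

theorem mpTempered_toTempered {g k : ℕ} [NeZero k] (A : Mp g k) (f : 𝓢(Euc g, ℂ)) :
    mpTempered A (f : 𝓢'(Euc g, ℂ)) = (A.1 f : 𝓢(Euc g, ℂ)) := by
  ext h
  change (f : 𝓢'(Euc g, ℂ)) (transposeCLM A.1 h) = _
  rw [SchwartzMap.coe_apply, SchwartzMap.coe_apply]
  have := integral_mp_mul A f h
  simp only [smul_eq_mul, mul_comm] at this ⊢
  exact this.symm

/-- The universal cover `ℝ^{2g}` of the torus, with points `u = (x, y)`. -/
abbrev Cover (g : ℕ) : Type := Euc g × Euc g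

/-- The lattice point `λ ∈ ℤ^{2g}`, as a point of `ℝ^{2g}`. -/
def latt {g : ℕ} (l : (Fin g → ℤ) × (Fin g → ℤ)) : Cover g :=
  (WithLp.toLp 2 fun j => (l.1 j : ℝ), WithLp.toLp 2 fun j => (l.2 j : ℝ))

/-- The symplectic form `ω(u, v) = ∑ j, (u_{g+j} v_j - u_j v_{g+j})`. -/
def omega {g : ℕ} (u v : Cover g) : ℝ := ∑ j, (u.2 j * v.1 j - u.1 j * v.2 j)

/-- The factor `α(λ) exp (-π i ω(u, λ))`, with `α(λ) = (-1) ^ ∑ j, λ_j λ_{g+j}`, by which the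
lattice acts on the line bundle `L`. -/
def autFactor {g : ℕ} (l : (Fin g → ℤ) × (Fin g → ℤ)) (u : Cover g) : ℂ :=
  (-1 : ℂ) ^ (∑ j, l.1 j * l.2 j) * Complex.exp (-(Real.pi * Complex.I * omega u (latt l)))

/-- Smooth sections of `L ^ n` over the torus, as quasi-periodic functions on `ℝ^{2g}`. -/
def smoothSections (g : ℕ) (n : ℤ) : Submodule ℂ (Cover g → ℂ) where
  carrier := {s | ContDiff ℝ ∞ s ∧ ∀ l u, s (u + latt l) = autFactor l u ^ n * s u}
  zero_mem' := ⟨contDiff_const, fun l u => by simp⟩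
  add_mem' := fun {s t} hs ht =>
    ⟨hs.1.add ht.1, fun l u => by simp [hs.2 l u, ht.2 l u, mul_add]⟩
  smul_mem' := fun c s hs =>
    ⟨contDiff_const.smul hs.1, fun l u => by simp [hs.2 l u, mul_left_comm]⟩

/-- The space `Γ^∞(L ^ n)` of smooth sections, with the `C^∞` topology (below). -/
def SmoothSection (g : ℕ) (n : ℤ) : Type := smoothSections g n

instance (g : ℕ) (n : ℤ) : AddCommGroup (SmoothSection g n) :=
  inferInstanceAs (AddCommGroup (smoothSections g n))

instance (g : ℕ) (n : ℤ) : Module ℂ (SmoothSection g n) :=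
  inferInstanceAs (Module ℂ (smoothSections g n))

instance (g : ℕ) (n : ℤ) : CoeFun (SmoothSection g n) (fun _ => Cover g → ℂ) := ⟨Subtype.val⟩

lemma SmoothSection.contDiff {g : ℕ} {n : ℤ} (s : SmoothSection g n) : ContDiff ℝ ∞ s := s.2.1

/-- The unit cube `[0, 1]^g`. -/
def unitCube (g : ℕ) : Set (Euc g) := {x | ∀ j, x j ∈ Set.Icc (0 : ℝ) 1}

lemma isCompact_unitCube (g : ℕ) : IsCompact (unitCube g) := by
  have h : IsCompact (Set.univ.pi fun _ : Fin g => Set.Icc (0 : ℝ) 1) :=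
    isCompact_univ_pi fun _ => isCompact_Icc
  have := (EuclideanSpace.equiv (Fin g) ℝ).toHomeomorph.isCompact_preimage.mpr h
  convert this using 1
  ext x
  simp only [unitCube, Set.mem_preimage, Set.mem_pi, Set.mem_univ, true_imp_iff]
  rfl

lemma bddAbove_iteratedFDeriv {g : ℕ} {n : ℤ} (r : ℕ) (s : SmoothSection g n) :
    BddAbove (Set.range fun u : (unitCube g ×ˢ unitCube g : Set (Cover g)) =>
      ‖iteratedFDeriv ℝ r s u‖) := by
  have hc : Continuous fun u => ‖iteratedFDeriv ℝ r s u‖ :=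
    (s.contDiff.continuous_iteratedFDeriv (m := r) (by exact_mod_cast le_top)).norm
  have := ((isCompact_unitCube g).prod (isCompact_unitCube g)).bddAbove_image hc.continuousOn
  rwa [Set.image_eq_range] at this

/-- The seminorm `sup ‖D^r s‖`, the supremum being over a fundamental domain of the torus. -/
def sectionSeminorm (g : ℕ) (n : ℤ) (r : ℕ) : Seminorm ℂ (SmoothSection g n) :=
  Seminorm.ofSMulLE
    (fun s => ⨆ u : (unitCube g ×ˢ unitCube g : Set (Cover g)), ‖iteratedFDeriv ℝ r s u‖)
    (by
      have h : ∀ u : Cover g, ‖iteratedFDeriv ℝ r (0 : SmoothSection g n) u‖ = 0 := fun u => by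
        change ‖iteratedFDeriv ℝ r (fun _ : Cover g => (0 : ℂ)) u‖ = 0
        rw [iteratedFDeriv_fun_zero]
        simp
      simp [h])
    (fun s t => by
      refine Real.iSup_le (fun u => ?_)
        (add_nonneg (Real.iSup_nonneg fun _ => norm_nonneg _)
          (Real.iSup_nonneg fun _ => norm_nonneg _))
      have h : iteratedFDeriv ℝ r (s + t : SmoothSection g n) u =
          iteratedFDeriv ℝ r s u + iteratedFDeriv ℝ r t u :=
        iteratedFDeriv_add_apply (s.contDiff.of_le (by exact_mod_cast le_top)).contDiffAt
          (t.contDiff.of_le (by exact_mod_cast le_top)).contDiffAt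
      rw [h]
      exact (norm_add_le _ _).trans (add_le_add (le_ciSup (bddAbove_iteratedFDeriv r s) u)
        (le_ciSup (bddAbove_iteratedFDeriv r t) u)))
    (fun c s => by
      refine Real.iSup_le (fun u => ?_)
        (mul_nonneg (norm_nonneg _) (Real.iSup_nonneg fun _ => norm_nonneg _))
      have h : iteratedFDeriv ℝ r (c • s : SmoothSection g n) u = c • iteratedFDeriv ℝ r s u :=
        iteratedFDeriv_const_smul_apply (s.contDiff.of_le (by exact_mod_cast le_top)).contDiffAt
      rw [h, norm_smul]
      exact mul_le_mul_of_nonneg_left (le_ciSup (bddAbove_iteratedFDeriv r s) u) (norm_nonneg _))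

instance (g : ℕ) (n : ℤ) : TopologicalSpace (SmoothSection g n) :=
  SeminormFamily.moduleFilterBasis (sectionSeminorm g n) |>.topology

lemma withSeminorms_section (g : ℕ) (n : ℤ) : WithSeminorms (sectionSeminorm g n) := ⟨rfl⟩

instance (g : ℕ) (n : ℤ) : IsTopologicalAddGroup (SmoothSection g n) :=
  (withSeminorms_section g n).topologicalAddGroup

instance (g : ℕ) (n : ℤ) : ContinuousSMul ℂ (SmoothSection g n) :=
  (withSeminorms_section g n).continuousSMul

/-- The space `Γ^{-∞}(L ^ k)` of distributional sections: the dual of the space of smooth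
sections of `L ^ (-k)`, with its weak topology. -/
abbrev DistSection (g k : ℕ) : Type := SmoothSection g (-(k : ℤ)) →Lₚₜ[ℂ] ℂ

/-- The index set `(ℤ/kℤ)^g`, through the representatives `0 ≤ l_j < k`. -/
abbrev Idx (g k : ℕ) : Type := Fin g → Fin k

/-- The Weil–Brezin coefficient of a section `s` of `L ^ k`,
`(s)_l(y) = ∫_{[0,1]^g} s(x, y + l/k) exp (k π i ᵗx (y + l/k)) exp (-2 π i ᵗl x) dx`. -/
def wbCoeff {g k : ℕ} (s : Cover g → ℂ) (l : Idx g k) (y : Euc g) : ℂ :=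
  ∫ x in unitCube g,
    s (x, y + WithLp.toLp 2 fun j => ((l j : ℕ) : ℝ) / k) *
      Complex.exp (k * Real.pi * Complex.I * ((∑ j, x j * (y j + ((l j : ℕ) : ℝ) / k) : ℝ) : ℂ)) *
      Complex.exp (-(2 * Real.pi * Complex.I * ((∑ j, ((l j : ℕ) : ℝ) * x j : ℝ) : ℂ)))

/-- `W` is the Weil–Brezin isomorphism `σ ↦ ((σ)_l)_l` from distributional sections of `L ^ k` to
families of tempered distributions. It is dual to the Weil–Brezin expansion of smooth sections.
For smooth `s ∈ Γ^∞(L ^ k)` and `φ ∈ Γ^∞(L ^ (-k))`, unitarity of the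
expansion says that the integral of `s φ` over the torus is `∑ l, ∫ (s)_l φ_l`, where `φ_l` is the
conjugate of the coefficient `(conj φ)_l` of the section `conj φ` of `L ^ k`; for distributions it
reads `σ(φ) = ∑ l, (σ)_l(φ_l)`. -/
def IsWeilBrezin {g k : ℕ} (W : DistSection g k ≃L[ℂ] (Idx g k → 𝓢'(Euc g, ℂ))) : Prop :=
  ∀ (σ : DistSection g k) (φ : SmoothSection g (-(k : ℤ))) (f : Idx g k → 𝓢(Euc g, ℂ)),
    (∀ l y, f l y = star (wbCoeff (fun u => star (φ u)) l y)) → σ φ = ∑ l, W σ l (f l)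

/-- The real symplectic group `Sp(2g, ℝ)`. -/
abbrev Sp (g : ℕ) : Type := Matrix.symplecticGroup (Fin g) ℝ

/-- A real matrix regarded as a complex matrix. -/
abbrev toC {m n : Type*} (A : Matrix m n ℝ) : Matrix m n ℂ := A.map Complex.ofReal

/-- The upper left block of `M = [A, B; C, D]`, as a complex matrix. -/
def blkA {g : ℕ} (M : Sp g) : Matrix (Fin g) (Fin g) ℂ := toC M.1.toBlocks₁₁
/-- The upper right block of `M`, as a complex matrix. -/
def blkB {g : ℕ} (M : Sp g) : Matrix (Fin g) (Fin g) ℂ := toC M.1.toBlocks₁₂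
/-- The lower left block of `M`, as a complex matrix. -/
def blkC {g : ℕ} (M : Sp g) : Matrix (Fin g) (Fin g) ℂ := toC M.1.toBlocks₂₁
/-- The lower right block of `M`, as a complex matrix. -/
def blkD {g : ℕ} (M : Sp g) : Matrix (Fin g) (Fin g) ℂ := toC M.1.toBlocks₂₂

/-- The closed Siegel disc: symmetric complex matrices `τ` with `1 - τ* τ ≥ 0`. -/
abbrev SiegelDisc (g : ℕ) : Type :=
  {τ : Matrix (Fin g) (Fin g) ℂ // τ.IsSymm ∧ (1 - τᴴ * τ).PosSemidef}

/-- The Siegel upper half-space: symmetric complex matrices with positive definite imaginary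
part. -/
abbrev SiegelUpper (g : ℕ) : Type :=
  {Ω : Matrix (Fin g) (Fin g) ℂ // Ω.IsSymm ∧ (Ω.map Complex.im).PosDef}

/-- The numerator `U(M, τ)` of the action on the disc. -/
def discNum {g : ℕ} (M : Sp g) (τ : Matrix (Fin g) (Fin g) ℂ) : Matrix (Fin g) (Fin g) ℂ :=
  (blkA M + Complex.I • blkB M - Complex.I • blkC M + blkD M) * τ -
    (blkA M - Complex.I • blkB M - Complex.I • blkC M - blkD M)

/-- The denominator `V(M, τ)` of the action on the disc. -/
def discDen {g : ℕ} (M : Sp g) (τ : Matrix (Fin g) (Fin g) ℂ) : Matrix (Fin g) (Fin g) ℂ :=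
  (blkA M - Complex.I • blkB M + Complex.I • blkC M + blkD M) -
    (blkA M + Complex.I • blkB M + Complex.I • blkC M - blkD M) * τ

/-- The Cayley matrix `[-1, i; 1, i]`. -/
def cay (g : ℕ) : Matrix (Fin g ⊕ Fin g) (Fin g ⊕ Fin g) ℂ :=
  Matrix.fromBlocks (-1) (Complex.I • 1) 1 (Complex.I • 1)

/-- The signature matrix `diag (-1, 1)`. -/
def sigH (g : ℕ) : Matrix (Fin g ⊕ Fin g) (Fin g ⊕ Fin g) ℂ := Matrix.fromBlocks (-1) 0 0 1

/-- Twice the inverse of the Cayley matrix. -/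
def cayInv (g : ℕ) : Matrix (Fin g ⊕ Fin g) (Fin g ⊕ Fin g) ℂ :=
  Matrix.fromBlocks (-1) 1 (-(Complex.I • 1)) (-(Complex.I • 1))

/-- Twice the conjugate of `M` by the Cayley matrix. -/
def discMat {g : ℕ} (M : Sp g) : Matrix (Fin g ⊕ Fin g) (Fin g ⊕ Fin g) ℂ :=
  cay g * toC M.1 * cayInv g

lemma toC_eq_blocks {g : ℕ} (M : Sp g) :
    toC M.1 = Matrix.fromBlocks (blkA M) (blkB M) (blkC M) (blkD M) := by
  conv_lhs => rw [← Matrix.fromBlocks_toBlocks M.1]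
  rw [toC, Matrix.fromBlocks_map]; rfl

lemma cayInv_mul_cay (g : ℕ) : cayInv g * cay g = (2 : ℂ) • 1 := by
  rw [cay, cayInv, Matrix.fromBlocks_multiply, ← Matrix.fromBlocks_one, Matrix.fromBlocks_smul]
  congr 1 <;> simp [smul_smul] <;> module

/-- The `2g × g` matrix with blocks `τ` and `1`. -/
def frame {g : ℕ} (τ : Matrix (Fin g) (Fin g) ℂ) : Matrix (Fin g ⊕ Fin g) (Fin g) ℂ :=
  Matrix.fromRows τ 1

lemma discMat_mul_frame {g : ℕ} (M : Sp g) (τ : Matrix (Fin g) (Fin g) ℂ) :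
    discMat M * frame τ = Matrix.fromRows (discNum M τ) (discDen M τ) := by
  rw [frame, discMat, toC_eq_blocks, cay, cayInv, Matrix.fromBlocks_multiply, Matrix.fromBlocks_multiply,
    Matrix.fromBlocks_mul_fromRows]
  congr 1
  · simp [discNum, add_mul, sub_mul, smul_smul]
    abel
  · simp [discDen, add_mul, sub_mul, smul_smul]
    abel

lemma discMat_mul {g : ℕ} (M N : Sp g) : discMat M * discMat N = (2 : ℂ) • discMat (M * N) := by
  have h : toC (M * N).1 = toC M.1 * toC N.1 := (Matrix.map_mul (f := Complex.ofRealHom))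
  rw [discMat, discMat, discMat, h]
  calc _ = cay g * toC M.1 * (cayInv g * cay g) * toC N.1 * cayInv g := by
        simp only [Matrix.mul_assoc]
    _ = _ := by rw [cayInv_mul_cay]; simp [Matrix.mul_assoc]

lemma discMat_one {g : ℕ} : discMat (1 : Sp g) = (2 : ℂ) • 1 := by
  have h : toC (1 : Sp g).1 = 1 := Matrix.map_one Complex.ofReal (by simp) (by simp)
  rw [discMat, h, Matrix.mul_one, cay, cayInv, Matrix.fromBlocks_multiply, ← Matrix.fromBlocks_one,
    Matrix.fromBlocks_smul]
  congr 1 <;> simp [smul_smul] <;> module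

lemma cay_conjTranspose {g : ℕ} : (cay g)ᴴ * sigH g * cay g =
    (-2 * Complex.I) • Matrix.J (Fin g) ℂ := by
  rw [cay, sigH, Matrix.fromBlocks_conjTranspose, Matrix.fromBlocks_multiply, Matrix.fromBlocks_multiply,
    Matrix.J, Matrix.fromBlocks_smul]
  congr 1 <;> simp <;> module

lemma cayInv_conjTranspose {g : ℕ} : (cayInv g)ᴴ * Matrix.J (Fin g) ℂ * cayInv g =
    (2 * Complex.I) • sigH g := by
  rw [cayInv, sigH, Matrix.fromBlocks_conjTranspose, Matrix.J, Matrix.fromBlocks_multiply,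
    Matrix.fromBlocks_multiply, Matrix.fromBlocks_smul]
  congr 1 <;> simp <;> module

lemma cay_transpose {g : ℕ} : (cay g)ᵀ * Matrix.J (Fin g) ℂ * cay g =
    (-2 * Complex.I) • Matrix.J (Fin g) ℂ := by
  rw [cay, Matrix.fromBlocks_transpose, Matrix.J, Matrix.fromBlocks_multiply,
    Matrix.fromBlocks_multiply, Matrix.fromBlocks_smul]
  congr 1 <;> simp <;> module

lemma cayInv_transpose {g : ℕ} : (cayInv g)ᵀ * Matrix.J (Fin g) ℂ * cayInv g =
    (2 * Complex.I) • Matrix.J (Fin g) ℂ := by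
  rw [cayInv, Matrix.fromBlocks_transpose, Matrix.J, Matrix.fromBlocks_multiply,
    Matrix.fromBlocks_multiply, Matrix.fromBlocks_smul]
  congr 1 <;> simp <;> module

lemma toC_transpose_J {g : ℕ} (M : Sp g) :
    (toC M.1)ᵀ * Matrix.J (Fin g) ℂ * toC M.1 = Matrix.J (Fin g) ℂ :=
  SymplecticGroup.mem_iff'.mp (SymplecticGroup.map_mem M.2 Complex.ofRealHom)

lemma toC_conjTranspose {g : ℕ} (M : Sp g) : (toC M.1)ᴴ = (toC M.1)ᵀ := by
  ext i j; simp

lemma discMat_conjTranspose {g : ℕ} (M : Sp g) :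
    (discMat M)ᴴ * sigH g * discMat M =
      (4 : ℂ) • sigH g := by
  have : (discMat M)ᴴ * sigH g * discMat M =
      (cayInv g)ᴴ * ((toC M.1)ᵀ * ((cay g)ᴴ * sigH g * cay g) * toC M.1) *
        cayInv g := by
    simp only [discMat, Matrix.conjTranspose_mul, toC_conjTranspose, Matrix.mul_assoc]
  rw [this, cay_conjTranspose, Matrix.mul_smul, Matrix.smul_mul, toC_transpose_J, Matrix.mul_smul,
    Matrix.smul_mul, cayInv_conjTranspose, smul_smul]
  congr 1
  linear_combination (-4 : ℂ) * Complex.I_mul_I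

lemma discMat_transpose {g : ℕ} (M : Sp g) :
    (discMat M)ᵀ * Matrix.J (Fin g) ℂ * discMat M = (4 : ℂ) • Matrix.J (Fin g) ℂ := by
  have : (discMat M)ᵀ * Matrix.J (Fin g) ℂ * discMat M =
      (cayInv g)ᵀ * ((toC M.1)ᵀ * ((cay g)ᵀ * Matrix.J (Fin g) ℂ * cay g) * toC M.1) *
        cayInv g := by
    simp only [discMat, Matrix.transpose_mul, Matrix.mul_assoc]
  rw [this, cay_transpose, Matrix.mul_smul, Matrix.smul_mul, toC_transpose_J, Matrix.mul_smul,
    Matrix.smul_mul, cayInv_transpose, smul_smul]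
  congr 1
  linear_combination (-4 : ℂ) * Complex.I_mul_I

lemma disc_hermitian {g : ℕ} (M : Sp g) (τ : Matrix (Fin g) (Fin g) ℂ) :
    (discDen M τ)ᴴ * discDen M τ - (discNum M τ)ᴴ * discNum M τ = (4 : ℂ) • (1 - τᴴ * τ) := by
  have h := congrArg (fun X => (frame τ)ᴴ * X * frame τ)
    (discMat_conjTranspose M)
  have h1 : (frame τ)ᴴ *
      ((discMat M)ᴴ * sigH g * discMat M) * frame τ =
      (discMat M * frame τ)ᴴ * sigH g *
        (discMat M * frame τ) := by
    simp only [Matrix.conjTranspose_mul, Matrix.mul_assoc]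
  simp only [h1, discMat_mul_frame] at h
  simp only [frame, sigH, Matrix.conjTranspose_fromRows_eq_fromCols_conjTranspose, Matrix.mul_smul,
    Matrix.smul_mul, Matrix.fromCols_mul_fromBlocks, Matrix.fromCols_mul_fromRows] at h
  simp only [Matrix.mul_neg, Matrix.mul_one, Matrix.mul_zero, add_zero, zero_add,
    Matrix.conjTranspose_one, Matrix.neg_mul] at h
  rw [sub_eq_neg_add, h]
  congr 1
  abel

lemma disc_symm {g : ℕ} (M : Sp g) {τ : Matrix (Fin g) (Fin g) ℂ} (hτ : τ.IsSymm) :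
    (discDen M τ)ᵀ * discNum M τ = (discNum M τ)ᵀ * discDen M τ := by
  have h := congrArg (fun X => (frame τ)ᵀ * X * frame τ)
    (discMat_transpose M)
  have h1 : (frame τ)ᵀ *
      ((discMat M)ᵀ * Matrix.J (Fin g) ℂ * discMat M) * frame τ =
      (discMat M * frame τ)ᵀ * Matrix.J (Fin g) ℂ *
        (discMat M * frame τ) := by
    simp only [Matrix.transpose_mul, Matrix.mul_assoc]
  simp only [h1, discMat_mul_frame] at h
  simp only [frame, Matrix.transpose_fromRows, Matrix.J, Matrix.mul_smul,
    Matrix.smul_mul, Matrix.fromCols_mul_fromBlocks, Matrix.fromCols_mul_fromRows] at h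
  simp only [Matrix.mul_neg, Matrix.mul_one, Matrix.mul_zero, add_zero, zero_add,
    Matrix.transpose_one, Matrix.neg_mul, hτ.eq, Matrix.one_mul, add_neg_cancel, smul_zero] at h
  exact eq_of_sub_eq_zero (by rw [sub_eq_add_neg]; exact h)

lemma discDen_isUnit {g : ℕ} (M : Sp g) (τ : SiegelDisc g) : IsUnit (discDen M τ.1).det := by
  rw [isUnit_iff_ne_zero]
  intro h0
  obtain ⟨v, hv, hv0⟩ := Matrix.exists_mulVec_eq_zero_iff.mpr h0
  apply hv
  have hpos := τ.2.2.dotProduct_mulVec_nonneg v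
  have hq : ∀ X : Matrix (Fin g) (Fin g) ℂ,
      star v ⬝ᵥ ((Xᴴ * X) *ᵥ v) = star (X *ᵥ v) ⬝ᵥ (X *ᵥ v) := fun X => by
    rw [← Matrix.mulVec_mulVec, Matrix.dotProduct_mulVec, Matrix.star_mulVec]
  have hH := congrArg (fun X => star v ⬝ᵥ (X *ᵥ v)) (disc_hermitian M τ.1)
  simp only [Matrix.sub_mulVec _ _ v, dotProduct_sub, Matrix.smul_mulVec, dotProduct_smul, hq,
    hv0, dotProduct_zero, zero_sub, smul_eq_mul] at hH
  have hnum : discNum M τ.1 *ᵥ v = 0 := by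
    have h1 : 0 ≤ star (discNum M τ.1 *ᵥ v) ⬝ᵥ (discNum M τ.1 *ᵥ v) :=
      dotProduct_star_self_nonneg _
    have h2 : star (discNum M τ.1 *ᵥ v) ⬝ᵥ (discNum M τ.1 *ᵥ v) ≤ 0 := by
      rw [← neg_nonneg, hH]
      rw [Matrix.sub_mulVec, dotProduct_sub, hq] at hpos
      exact mul_nonneg (by norm_num) hpos
    exact dotProduct_star_self_eq_zero.mp (le_antisymm h2 h1)
  have hf : discMat M *ᵥ (frame τ.1 *ᵥ v) = 0 := by
    rw [Matrix.mulVec_mulVec, discMat_mul_frame, Matrix.fromRows_mulVec, hnum, hv0]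
    ext (i | i) <;> rfl
  have hf2 := congrArg (fun w => discMat M⁻¹ *ᵥ w) hf
  simp only [Matrix.mulVec_zero] at hf2
  rw [Matrix.mulVec_mulVec, discMat_mul, inv_mul_cancel, discMat_one, smul_smul,
    Matrix.smul_mulVec, Matrix.one_mulVec, frame, Matrix.fromRows_mulVec, Matrix.one_mulVec] at hf2
  ext i
  have := congrFun hf2 (Sum.inr i)
  simpa using this

lemma discNum_symm_mul_inv {g : ℕ} (M : Sp g) (τ : SiegelDisc g) :
    (discNum M τ.1 * (discDen M τ.1)⁻¹).IsSymm := by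
  have hV := discDen_isUnit M τ
  have hVt : IsUnit (discDen M τ.1)ᵀ.det := by rwa [Matrix.det_transpose]
  have h := disc_symm M τ.2.1
  rw [Matrix.IsSymm, Matrix.transpose_mul, Matrix.transpose_nonsing_inv]
  calc ((discDen M τ.1)ᵀ)⁻¹ * (discNum M τ.1)ᵀ
      = ((discDen M τ.1)ᵀ)⁻¹ * ((discNum M τ.1)ᵀ * discDen M τ.1) * (discDen M τ.1)⁻¹ := by
        rw [Matrix.mul_assoc, Matrix.mul_assoc, Matrix.mul_nonsing_inv _ hV, Matrix.mul_one]
    _ = _ := by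
        rw [← h, ← Matrix.mul_assoc, Matrix.nonsing_inv_mul _ hVt, Matrix.one_mul]

lemma disc_posSemidef {g : ℕ} (M : Sp g) (τ : SiegelDisc g) :
    (1 - (discNum M τ.1 * (discDen M τ.1)⁻¹)ᴴ *
      (discNum M τ.1 * (discDen M τ.1)⁻¹)).PosSemidef := by
  have hV := discDen_isUnit M τ
  have h := disc_hermitian M τ.1
  have h4 : ((4 : ℂ) • (1 - τ.1ᴴ * τ.1)).PosSemidef := τ.2.2.smul (by norm_num)
  have h5 := h4.conjTranspose_mul_mul_same (discDen M τ.1)⁻¹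
  rw [← h] at h5
  convert h5 using 1
  have h6 : ((discDen M τ.1)⁻¹)ᴴ * (discDen M τ.1)ᴴ = 1 := by
    rw [← Matrix.conjTranspose_mul, Matrix.mul_nonsing_inv _ hV, Matrix.conjTranspose_one]
  rw [Matrix.mul_sub, Matrix.sub_mul, Matrix.conjTranspose_mul]
  congr 1
  · rw [← Matrix.mul_assoc, h6, Matrix.one_mul, Matrix.mul_nonsing_inv _ hV]
  · simp only [Matrix.mul_assoc]

/-- The symplectic action on the closed Siegel disc, `τ' = U(M, τ) V(M, τ)⁻¹`. -/
instance (g : ℕ) : SMul (Sp g) (SiegelDisc g) where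
  smul M τ := ⟨discNum M τ.1 * (discDen M τ.1)⁻¹, discNum_symm_mul_inv M τ, disc_posSemidef M τ⟩

lemma coe_smul_disc {g : ℕ} (M : Sp g) (τ : SiegelDisc g) :
    ((M • τ : SiegelDisc g) : Matrix (Fin g) (Fin g) ℂ) =
      discNum M τ.1 * (discDen M τ.1)⁻¹ := rfl

lemma frame_smul {g : ℕ} (M : Sp g) (τ : SiegelDisc g) :
    discMat M * frame τ.1 = frame (M • τ).1 * discDen M τ.1 := by
  rw [discMat_mul_frame, frame, Matrix.fromRows_mul, coe_smul_disc, Matrix.mul_assoc,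
    Matrix.nonsing_inv_mul _ (discDen_isUnit M τ), Matrix.mul_one, Matrix.one_mul]

lemma disc_ext_of_frame {g : ℕ} {τ τ' : SiegelDisc g} {X Y : Matrix (Fin g) (Fin g) ℂ}
    (hX : IsUnit X.det) (h : frame τ.1 * X = frame τ'.1 * Y) : τ = τ' := by
  rw [frame, frame, Matrix.fromRows_mul, Matrix.fromRows_mul, Matrix.one_mul, Matrix.one_mul,
    Matrix.fromRows_ext_iff] at h
  obtain ⟨h1, h2⟩ := h
  subst h2
  refine Subtype.ext ?_
  have := congrArg (fun Z => Z * X⁻¹) h1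
  simpa only [Matrix.mul_assoc, Matrix.mul_nonsing_inv _ hX, Matrix.mul_one] using this

/-- The symplectic action on the closed Siegel disc. -/
instance (g : ℕ) : MulAction (Sp g) (SiegelDisc g) where
  one_smul τ := by
    have h := frame_smul 1 τ
    rw [discMat_one, Matrix.smul_mul, Matrix.one_mul] at h
    refine (disc_ext_of_frame (X := (2 : ℂ) • 1) (Y := discDen 1 τ.1) ?_ ?_).symm
    · simp
    · rw [Matrix.mul_smul, Matrix.mul_one, h]
  mul_smul M N τ := by
    have h : (2 : ℂ) • (frame ((M * N) • τ).1 * discDen (M * N) τ.1) =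
        frame (M • N • τ).1 * (discDen M (N • τ).1 * discDen N τ.1) := by
      rw [← frame_smul, ← Matrix.smul_mul, ← discMat_mul, Matrix.mul_assoc, frame_smul,
        ← Matrix.mul_assoc, frame_smul, Matrix.mul_assoc]
    refine disc_ext_of_frame (X := (2 : ℂ) • discDen (M * N) τ.1)
      (Y := discDen M (N • τ).1 * discDen N τ.1) ?_ ?_
    · rw [Matrix.det_smul]
      exact (IsUnit.mk0 _ (pow_ne_zero _ two_ne_zero)).mul (discDen_isUnit _ _)
    · rw [Matrix.mul_smul, h]

/-- The equation that characterizes `τ' = M(τ)`. -/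
theorem smul_disc_eq {g : ℕ} (M : Sp g) (τ : SiegelDisc g) :
    (((M • τ).1 + 1) * (blkA M + Complex.I • blkB M) +
        ((M • τ).1 - 1) * (Complex.I • blkC M - blkD M)) * τ.1 =
      ((M • τ).1 + 1) * (blkA M - Complex.I • blkB M) +
        ((M • τ).1 - 1) * (Complex.I • blkC M + blkD M) := by
  have h : (M • τ).1 * discDen M τ.1 = discNum M τ.1 := by
    rw [coe_smul_disc, Matrix.mul_assoc, Matrix.nonsing_inv_mul _ (discDen_isUnit M τ),
      Matrix.mul_one]
  rw [discDen, discNum] at h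
  rw [← sub_eq_zero] at h ⊢
  rw [← neg_eq_zero, ← h]
  simp only [add_mul, mul_add, sub_mul, mul_sub, Matrix.smul_mul, Matrix.mul_smul, Matrix.one_mul,
    Matrix.mul_assoc]
  abel

lemma toC_posDef {g : ℕ} {S : Matrix (Fin g) (Fin g) ℝ} (hS : S.PosDef) : (toC S).PosDef := by
  have hsym : Sᵀ = S := by simpa using hS.isHermitian.eq
  refine Matrix.PosDef.of_dotProduct_mulVec_pos ?_ fun v hv => ?_
  · ext i j
    have := congrFun (congrFun hsym i) j
    simpa using this
  set a : Fin g → ℝ := fun i => (v i).re with ha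
  set b : Fin g → ℝ := fun i => (v i).im with hb
  have hv2 : v = (Complex.ofReal ∘ a) + Complex.I • (Complex.ofReal ∘ b) := by
    ext i
    simp [ha, hb, mul_comm Complex.I, Complex.re_add_im]
  have hvs : star v = (Complex.ofReal ∘ a) - Complex.I • (Complex.ofReal ∘ b) := by
    ext i
    apply Complex.ext <;> simp [ha, hb]
  have hm : ∀ x : Fin g → ℝ, toC S *ᵥ (Complex.ofReal ∘ x) = Complex.ofReal ∘ (S *ᵥ x) := fun x => by
    ext i
    simp [Matrix.mulVec, dotProduct]
  have hd : ∀ x y : Fin g → ℝ, (Complex.ofReal ∘ x) ⬝ᵥ (Complex.ofReal ∘ y) = ((x ⬝ᵥ y : ℝ) : ℂ) :=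
    fun x y => by simp [dotProduct]
  have hab : b ⬝ᵥ (S *ᵥ a) = a ⬝ᵥ (S *ᵥ b) := by
    rw [Matrix.dotProduct_mulVec, ← Matrix.mulVec_transpose, hsym, dotProduct_comm]
  have key : star v ⬝ᵥ (toC S *ᵥ v) = ((a ⬝ᵥ (S *ᵥ a) + b ⬝ᵥ (S *ᵥ b) : ℝ) : ℂ) := by
    rw [hvs]
    conv_lhs => rw [hv2]
    rw [Matrix.mulVec_add, Matrix.mulVec_smul, hm, hm, sub_dotProduct, dotProduct_add,
      dotProduct_add, smul_dotProduct, smul_dotProduct, dotProduct_smul, dotProduct_smul, hd, hd,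
      hd, hd, hab]
    simp only [smul_eq_mul]
    push_cast
    linear_combination (-((b ⬝ᵥ (S *ᵥ b) : ℝ) : ℂ)) * Complex.I_mul_I
  rw [key]
  have hp : ∀ x : Fin g → ℝ, 0 ≤ x ⬝ᵥ (S *ᵥ x) := fun x => by
    simpa using hS.posSemidef.dotProduct_mulVec_nonneg x
  have hp2 : ∀ x : Fin g → ℝ, x ≠ 0 → 0 < x ⬝ᵥ (S *ᵥ x) := fun x hx => by
    simpa using hS.dotProduct_mulVec_pos hx
  refine Complex.zero_lt_real.mpr ?_
  by_cases h0 : a = 0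
  · have hb0 : b ≠ 0 := by
      rintro hb0
      apply hv
      rw [hv2, h0, hb0]
      ext i
      simp
    exact add_pos_of_nonneg_of_pos (hp a) (hp2 b hb0)
  · exact add_pos_of_pos_of_nonneg (hp2 a h0) (hp b)

lemma upper_hermitian {g : ℕ} (Ω : SiegelUpper g) :
    (Complex.I • 1 + Ω.1)ᴴ * (Complex.I • 1 + Ω.1) -
      (Complex.I • 1 - Ω.1)ᴴ * (Complex.I • 1 - Ω.1) =
      (4 : ℂ) • toC (Ω.1.map Complex.im) := by
  have h1 : (Complex.I • 1 + Ω.1)ᴴ * (Complex.I • 1 + Ω.1) -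
      (Complex.I • 1 - Ω.1)ᴴ * (Complex.I • 1 - Ω.1) =
      (2 * Complex.I) • (Ω.1ᴴ - Ω.1) := by
    simp only [Matrix.conjTranspose_add, Matrix.conjTranspose_sub, Matrix.conjTranspose_smul,
      Matrix.conjTranspose_one, Complex.star_def, Complex.conj_I, add_mul, mul_add, sub_mul,
      mul_sub, Matrix.smul_mul, Matrix.mul_smul, Matrix.one_mul, Matrix.mul_one]
    module
  rw [h1]
  ext i j
  have h2 : Ω.1 j i = Ω.1 i j := Ω.2.1.apply i j
  simp only [Matrix.smul_apply, Matrix.sub_apply, Matrix.conjTranspose_apply, h2, Matrix.map_apply,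
    smul_eq_mul, Complex.star_def]
  apply Complex.ext
  · simp
    ring
  · simp

lemma upper_isUnit {g : ℕ} (Ω : SiegelUpper g) : IsUnit (Complex.I • 1 + Ω.1).det := by
  have h1 : ((Complex.I • 1 + Ω.1)ᴴ * (Complex.I • 1 + Ω.1)).PosDef := by
    rw [sub_eq_iff_eq_add.mp (upper_hermitian Ω)]
    exact ((toC_posDef Ω.2.2).smul (by norm_num)).add_posSemidef
      (Matrix.posSemidef_conjTranspose_mul_self _)
  have h2 := (Matrix.isUnit_iff_isUnit_det _).mp h1.isUnit
  rw [Matrix.det_mul] at h2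
  exact isUnit_of_mul_isUnit_right h2

/-- The Cayley transform `Ω ↦ τ = (i - Ω) (i + Ω)⁻¹`. -/
def cayley {g : ℕ} (Ω : SiegelUpper g) : SiegelDisc g :=
  ⟨(Complex.I • 1 - Ω.1) * (Complex.I • 1 + Ω.1)⁻¹, by
    have hV := upper_isUnit Ω
    have hs : (Complex.I • 1 + Ω.1)ᵀ = Complex.I • 1 + Ω.1 := by simp [Ω.2.1.eq]
    have hs2 : (Complex.I • 1 - Ω.1)ᵀ = Complex.I • 1 - Ω.1 := by simp [Ω.2.1.eq]
    rw [Matrix.IsSymm, Matrix.transpose_mul, Matrix.transpose_nonsing_inv, hs, hs2]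
    have hc : (Complex.I • 1 - Ω.1) * (Complex.I • 1 + Ω.1) =
        (Complex.I • 1 + Ω.1) * (Complex.I • 1 - Ω.1) := by
      simp only [mul_add, mul_sub, add_mul, sub_mul, Matrix.smul_mul, Matrix.mul_smul,
        Matrix.one_mul, Matrix.mul_one]
      module
    calc (Complex.I • 1 + Ω.1)⁻¹ * (Complex.I • 1 - Ω.1)
        = (Complex.I • 1 + Ω.1)⁻¹ * ((Complex.I • 1 - Ω.1) * (Complex.I • 1 + Ω.1)) *
            (Complex.I • 1 + Ω.1)⁻¹ := by
          rw [Matrix.mul_assoc, Matrix.mul_assoc, Matrix.mul_nonsing_inv _ hV, Matrix.mul_one]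
      _ = _ := by rw [hc, ← Matrix.mul_assoc, Matrix.nonsing_inv_mul _ hV, Matrix.one_mul], by
    have hV := upper_isUnit Ω
    have h5 := ((toC_posDef Ω.2.2).posSemidef.smul (by norm_num : (0 : ℂ) ≤ 4)).conjTranspose_mul_mul_same
      (Complex.I • 1 + Ω.1)⁻¹
    rw [← upper_hermitian] at h5
    convert h5 using 1
    have h6 : ((Complex.I • 1 + Ω.1)⁻¹)ᴴ * (Complex.I • 1 + Ω.1)ᴴ = 1 := by
      rw [← Matrix.conjTranspose_mul, Matrix.mul_nonsing_inv _ hV, Matrix.conjTranspose_one]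
    rw [Matrix.conjTranspose_mul, Matrix.mul_sub ((Complex.I • 1 + Ω.1)⁻¹)ᴴ, Matrix.sub_mul (_ * _)]
    congr 1
    · rw [← Matrix.mul_assoc, h6, Matrix.one_mul, Matrix.mul_nonsing_inv _ hV]
    · simp only [Matrix.mul_assoc]⟩

/-- The fractional linear transformation `(A Ω + B) (C Ω + D)⁻¹`. -/
def moebius {g : ℕ} (M : Sp g) (Ω : Matrix (Fin g) (Fin g) ℂ) : Matrix (Fin g) (Fin g) ℂ :=
  (blkA M * Ω + blkB M) * (blkC M * Ω + blkD M)⁻¹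

/-- The total space of the half-form bundle over the closed Siegel disc, trivialized by the
section `√(d^g(x,y)_τ)`: the pair `(τ, a)` is the half-form `a √(d^g(x,y)_τ)`. -/
abbrev HalfForm (g : ℕ) : Type := SiegelDisc g × ℂ

/-- The `g`-form `d^g(x,y)_τ` on `ℂ^{2g}`, the wedge product of the `g` components of
`(1 + τ) dx - i (1 - τ) dy`; it generates the fibre over `τ` of the canonical bundle. -/
def canForm {g : ℕ} (τ : SiegelDisc g) : (Fin g ⊕ Fin g → ℂ) [⋀^Fin g]→ₗ[ℂ] ℂ :=
  Matrix.detRowAlternating.compLinearMap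
    (Matrix.mulVecLin (Matrix.fromCols (1 + τ.1) (-(Complex.I • (1 - τ.1)))))

/-- The square of a half-form, an element of the canonical bundle. -/
def halfFormSq {g : ℕ} (ν : HalfForm g) : (Fin g ⊕ Fin g → ℂ) [⋀^Fin g]→ₗ[ℂ] ℂ :=
  ν.2 ^ 2 • canForm ν.1

/-- The natural action `(M*)⁻¹` of a symplectic matrix on `g`-forms, by pull-back. -/
def pushForm {g : ℕ} (M : Sp g) (η : (Fin g ⊕ Fin g → ℂ) [⋀^Fin g]→ₗ[ℂ] ℂ) :
    (Fin g ⊕ Fin g → ℂ) [⋀^Fin g]→ₗ[ℂ] ℂ :=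
  η.compLinearMap (Matrix.mulVecLin (toC (M⁻¹ : Sp g).1))

/-- For a complex symmetric matrix `Z` with positive definite real part, the square root of
`det Z` determined by the Gaussian integral
`(det Z)^(-1/2) = ∫ exp (-π ᵗξ Z ξ) dξ`; it is continuous in `Z`, and equals `1` at `Z = 1`. -/
def sqrtDet {g : ℕ} (Z : Matrix (Fin g) (Fin g) ℂ) : ℂ :=
  (∫ ξ : Euc g, Complex.exp
    (-(Real.pi * ((fun j => (ξ j : ℂ)) ⬝ᵥ (Z *ᵥ fun j => (ξ j : ℂ))))))⁻¹

/-- The half-form `√(d^g z_Ω) = (det (1 + τ))^(-1/2) √(d^g(x,y)_τ)`, where `τ` is the Cayley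
transform of `Ω` and the branch of the square root is `1` at `τ = 0`. -/
def sqrtDz {g : ℕ} (Ω : SiegelUpper g) : HalfForm g :=
  (cayley Ω, (sqrtDet (1 + (cayley Ω).1))⁻¹)

/-- The square root of `det (Ω + Q)` that evaluates the Gaussian integral in
`S(P, L, Q)_m (exp (k π i ᵗv Ω v))`, namely `i^(g/2) (det (-i (Ω + Q)))^(1/2)`. -/
def sqrtDetAdd {g : ℕ} (Ω : SiegelUpper g) (Q : Matrix (Fin g) (Fin g) ℝ) : ℂ :=
  iPow ((g : ℝ) / 2) * sqrtDet (-(Complex.I • (Ω.1 + toC Q)))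

/-- `cov` is the two-fold covering `Mp(2g, ℝ) → Sp(2g, ℝ)`, which maps `S(P, L, Q)_m` to the
symplectic matrix `[P L⁻¹, P L⁻¹ Q - ᵗL; L⁻¹, L⁻¹ Q]`. -/
structure IsMetaplecticCovering {g k : ℕ} [NeZero k] (cov : Mp g k →* Sp g) : Prop where
  map_gen : ∀ D : GenData g, (cov (mpGen k D)).1 =
    Matrix.fromBlocks (D.P * D.L⁻¹) (D.P * D.L⁻¹ * D.Q - D.Lᵀ) D.L⁻¹ (D.L⁻¹ * D.Q)
  surjective : Function.Surjective cov
  card_ker : Nat.card cov.ker = 2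

/-- `h` is the natural action of the metaplectic group on the half-form bundle: it lifts the
symplectic action on the disc, is linear on fibres and continuous, lifts the action by pull-back
on the canonical bundle, and on the generators it is given over the upper half-space by
`S(P, L, Q)_m √(d^g z_Ω) = i^(-m) |det L|^(-1/2) √(det (Ω + Q)) √(d^g z_Ω')`, `Ω' = M(Ω)`. -/
structure IsHalfFormAction {g k : ℕ} [NeZero k] (cov : Mp g k →* Sp g)
    (h : Mp g k →* Equiv.Perm (HalfForm g)) : Prop where
  linear : ∀ A τ, ∃ c : ℂ, ∀ a, h A (τ, a) = (cov A • τ, c * a)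
  continuous : ∀ A, Continuous (h A)
  square : ∀ A ν, halfFormSq (h A ν) = pushForm (cov A) (halfFormSq ν)
  gen : ∀ (D : GenData g) (Ω Ω' : SiegelUpper g), Ω'.1 = moebius (cov (mpGen k D)) Ω.1 →
    h (mpGen k D) (sqrtDz Ω) =
      ((sqrtDz Ω').1, Complex.I ^ (-D.m) * ((|D.L.det| ^ (-(1 / 2 : ℝ)) : ℝ) : ℂ) *
        sqrtDetAdd Ω D.Q * (sqrtDz Ω').2)

/-- The action of the metaplectic group on distributional sections, diagonal in the Weil–Brezin
coefficients: `(A σ)_l = A (σ)_l` for every `l`. -/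
def mpDist {g k : ℕ} [NeZero k] (W : DistSection g k ≃L[ℂ] (Idx g k → 𝓢'(Euc g, ℂ)))
    (A : Mp g k) (σ : DistSection g k) : DistSection g k :=
  W.symm fun l => mpTempered A (W σ l)

/-- The total space of the bundle of half-form corrected distributional sections over the closed
Siegel disc: the pair `(τ, σ)` is `σ ⊗ √(d^g(x,y)_τ)`. -/
abbrev CorrectedSection (g k : ℕ) : Type := SiegelDisc g × DistSection g k

/-- The product `σ ⊗ ν` of a distributional section and a half-form `ν = a √(d^g(x,y)_τ)`. -/
def tensor {g k : ℕ} (σ : DistSection g k) (ν : HalfForm g) : CorrectedSection g k :=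
  (ν.1, ν.2 • σ)

end

end WeilTorus

open WeilTorus

/-! The descent rests on one cancellation. The kernel of the covering consists of the operators `1`
and `-1`. The operator `-1` acts by `-1` on distributional sections and also by `-1` on half-forms,
so it acts trivially on the tensor product (`prodOp_congr`). Hence the action of a symplectic matrix
may be computed with any metaplectic lift. Uniqueness is immediate, because the covering is onto and
every vector of the bundle is of the form `σ ⊗ √(d^g(x,y)_τ)`. The substance lies in constructing
the three ingredients.

Weil–Brezin isomorphism. A section of `L ^ (-k)` times `exp (-k π i ᵗx y)` is periodic in `x`, and
quasi-periodicity in `y` identifies Fourier coefficients whose indices agree modulo `k`, up to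
translation. Under the coefficient map the covariant derivatives in `x` become multiplication by `2
π i k y_j` and those in `y` become `∂_j`. This gives the Schwartz bounds, and in the other direction
it gives smoothness of the theta-like series with Schwartz coefficients. The two maps are mutually
inverse by Fourier inversion and orthogonality of characters; `wbEquiv` is dualized to `wbDist`.

Covering. Each generator conjugates the Weyl operator of `z ∈ ℝ^{2g}` into the Weyl operator of `M
z` (`genS_weylZ`). Weyl operators determine their labels, so `M` is a well defined homomorphic
image. Matrices with invertible lower left block are images of generators, and every symplectic
matrix acquires such a block after multiplication by the inverse of a suitable generator. An
operator over the identity commutes with all Weyl operators and is therefore a scalar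
(`exists_scalar_of_cov_eq_one`).

Half-forms. Metaplectic operators permute the Gaussians `exp (k π i ᵗv Ω v)` up to scalars
(`genS_gaussUp`, `mp_gaussUp`). The reciprocal scalar `jFac` is automatically a cocycle, its square
is `det (C Ω + D)`, and on generators it is the prescribed factor. In particular scalars in the
kernel have square `1`. In the trivialization over the disc the factor is a square root of `2^(-g)
det V(M, τ)`, which is continuous and nonzero on the closed disc. The closed disc is star-shaped, so
a continuous root exists there (`exists_halfFac`), and density of the open disc transports the
cocycle law and uniqueness to the boundary. -/

namespace WeilTorus

noncomputable section

/-! ### Families closed under differentiation: smoothness and seminorm bounds -/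

/-- A family of functions that is closed under differentiation, up to a multiplier. -/
lemma contDiff_of_hasFDerivAt_family {E X ι : Type*} [NormedAddCommGroup X] [NormedSpace ℝ X]
    [Fintype ι] {Θ : E → X → ℂ} {D : ι → E → E} {ℓ : ι → X →L[ℝ] ℝ} {A : X → X →L[ℝ] ℂ}
    (hA : ContDiff ℝ ∞ A)
    (hΘ : ∀ e x, HasFDerivAt (Θ e) (∑ i, (ℓ i).smulRight (Θ (D i e) x) + Θ e x • A x) x) (e : E) :
    ContDiff ℝ ∞ (Θ e) := by
  rw [contDiff_infty]
  intro n
  induction n generalizing e with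
  | zero =>
    exact contDiff_zero.mpr (continuous_iff_continuousAt.mpr fun x => (hΘ e x).continuousAt)
  | succ n ih =>
    have h1 : ((n + 1 : ℕ) : ℕ∞ω) = (n : ℕ∞ω) + 1 := by norm_cast
    rw [h1, contDiff_succ_iff_fderiv]
    refine ⟨fun x => (hΘ e x).differentiableAt, by simp, ?_⟩
    have h2 : fderiv ℝ (Θ e) = fun x => ∑ i, (ℓ i).smulRight (Θ (D i e) x) + Θ e x • A x :=
      funext fun x => (hΘ e x).fderiv
    rw [h2]
    refine (ContDiff.sum fun i _ => ?_).add ((ih e).smul (hA.of_le (by exact_mod_cast le_top)))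
    exact (ContinuousLinearMap.smulRightL ℝ X ℂ (ℓ i)).contDiff.comp (ih (D i e))

section SeminormBounds

variable {E : Type*} [AddCommGroup E] [Module ℂ E] [TopologicalSpace E]

/-- The family of functions `F · x` is bounded, uniformly in `x`, by a continuous seminorm. -/
def SeminormBdd {κ : Type*} (F : E → κ → ℝ) : Prop :=
  ∃ q : Seminorm ℂ E, Continuous q ∧ ∀ e x, F e x ≤ q e

namespace SeminormBdd

variable {κ : Type*} {F G : E → κ → ℝ}

lemma of_le (hF : SeminormBdd F) (h : ∀ e x, G e x ≤ F e x) : SeminormBdd G := by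
  obtain ⟨q, hq, hb⟩ := hF
  exact ⟨q, hq, fun e x => (h e x).trans (hb e x)⟩

lemma zero : SeminormBdd (fun (_ : E) (_ : κ) => (0 : ℝ)) :=
  ⟨0, continuous_const, fun _ _ => le_rfl⟩

lemma add (hF : SeminormBdd F) (hG : SeminormBdd G) :
    SeminormBdd (fun e x => F e x + G e x) := by
  obtain ⟨q, hq, hb⟩ := hF
  obtain ⟨q', hq', hb'⟩ := hG
  exact ⟨q + q', hq.add hq', fun e x => add_le_add (hb e x) (hb' e x)⟩

lemma const_mul (hF : SeminormBdd F) {c : ℝ} (hc : 0 ≤ c) :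
    SeminormBdd (fun e x => c * F e x) := by
  obtain ⟨q, hq, hb⟩ := hF
  lift c to NNReal using hc
  refine ⟨c • q, ?_, fun e x => ?_⟩
  · exact hq.const_smul c
  · exact mul_le_mul_of_nonneg_left (hb e x) c.2

lemma sum {ι : Type*} (s : Finset ι) {F : ι → E → κ → ℝ} (h : ∀ i ∈ s, SeminormBdd (F i)) :
    SeminormBdd (fun e x => ∑ i ∈ s, F i e x) := by
  classical
  induction s using Finset.induction_on with
  | empty => simpa using zero
  | insert i s his ih =>
    simp only [Finset.sum_insert his]
    exact (h i (by simp)).add (ih fun j hj => h j (by simp [hj]))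

lemma comp (hF : SeminormBdd F) {E' : Type*} [AddCommGroup E'] [Module ℂ E']
    [TopologicalSpace E'] (D : E' →L[ℂ] E) : SeminormBdd (fun e x => F (D e) x) := by
  obtain ⟨q, hq, hb⟩ := hF
  exact ⟨q.comp (D : E' →ₗ[ℂ] E), hq.comp D.continuous, fun e x => hb (D e) x⟩

lemma reindex (hF : SeminormBdd F) {κ' : Type*} (φ : κ' → κ) :
    SeminormBdd (fun e x => F e (φ x)) := by
  obtain ⟨q, hq, hb⟩ := hF
  exact ⟨q, hq, fun e x => hb e (φ x)⟩

end SeminormBdd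

variable {X : Type*} [NormedAddCommGroup X] [NormedSpace ℝ X]
  {ι : Type*} [Fintype ι] {Θ : E → X → ℂ} {ℓ : ι → X →L[ℝ] ℝ}
  {A : X → X →L[ℝ] ℂ}

/-- A derivative of a member of the family is again a combination of members, plus a multiple of
`A`. Bounds of order zero, uniform in the parameter `e`, therefore propagate to all orders. The
weight `ρ` lets one statement serve both for suprema over a compact square and for Schwartz decay.
-/
lemma seminormBdd_iteratedFDeriv {D : ι → E →L[ℂ] E} {K : Set X} {ρ : X → ℝ} (hρ : ∀ x, 0 ≤ ρ x)
    (hA : ContDiff ℝ ∞ A) (hAK : ∀ r, ∃ C, ∀ x ∈ K, ‖iteratedFDeriv ℝ r A x‖ ≤ C)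
    (hΘ : ∀ e x, HasFDerivAt (Θ e) (∑ i, (ℓ i).smulRight (Θ (D i e) x) + Θ e x • A x) x)
    (hb : SeminormBdd (fun e (x : K) => ρ x * ‖Θ e x‖)) (r : ℕ) :
    SeminormBdd (fun e (x : K) => ρ x * ‖iteratedFDeriv ℝ r (Θ e) x‖) := by
  have hs : ∀ e, ContDiff ℝ ∞ (Θ e) := contDiff_of_hasFDerivAt_family (D := fun i => D i) hA hΘ
  -- The Leibniz rule for the product with `A` involves all lower orders, hence strong induction.
  induction r using Nat.strong_induction_on with
  | _ r ih =>
  rcases r with _ | r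
  · simpa [norm_iteratedFDeriv_zero] using hb
  choose C hC using hAK
  -- Absolute values are needed because `C` may be negative when `K` is empty.
  have h1 := (SeminormBdd.sum Finset.univ fun i (_ : i ∈ Finset.univ) =>
      ((ih r (Nat.lt_succ_self r)).comp (D i)).const_mul
        (norm_nonneg (ContinuousLinearMap.smulRightL ℝ X ℂ (ℓ i)))).add
    (SeminormBdd.sum (Finset.range (r + 1)) fun j hj =>
      (ih j (by simpa using hj)).const_mul (c := (r.choose j : ℝ) * |C (r - j)|) (by positivity))
  refine h1.of_le fun e x => ?_
  have h2 : fderiv ℝ (Θ e) = fun x => ∑ i, (ℓ i).smulRight (Θ (D i e) x) + Θ e x • A x :=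
    funext fun x => (hΘ e x).fderiv
  have hle : ∀ n : ℕ, ((n : ℕ) : ℕ∞ω) ≤ ∞ := fun n => by exact_mod_cast le_top
  have hc1 : ∀ i, ContDiff ℝ ∞ fun x => (ℓ i).smulRight (Θ (D i e) x) := fun i =>
    (ContinuousLinearMap.smulRightL ℝ X ℂ (ℓ i)).contDiff.comp (hs (D i e))
  have h3 : ‖iteratedFDeriv ℝ (r + 1) (Θ e) x‖ ≤
      ∑ i, ‖ContinuousLinearMap.smulRightL ℝ X ℂ (ℓ i)‖ * ‖iteratedFDeriv ℝ r (Θ (D i e)) x‖ +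
      ∑ j ∈ Finset.range (r + 1), (r.choose j : ℝ) * ‖iteratedFDeriv ℝ j (Θ e) x‖ *
        ‖iteratedFDeriv ℝ (r - j) A x‖ := by
    rw [← norm_iteratedFDeriv_fderiv, h2]
    have hsum : ContDiff ℝ ∞ fun x => ∑ i, (ℓ i).smulRight (Θ (D i e) x) :=
      ContDiff.sum fun i _ => hc1 i
    have h4 := iteratedFDeriv_add_apply (i := r) (x := (x : X))
      (hsum.of_le (hle r)).contDiffAt (((hs e).smul hA).of_le (hle r)).contDiffAt
    have h5 : iteratedFDeriv ℝ r (fun x => ∑ i, (ℓ i).smulRight (Θ (D i e) x) + Θ e x • A x) x =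
      iteratedFDeriv ℝ r ((fun x => ∑ i, (ℓ i).smulRight (Θ (D i e) x)) +
        fun x => Θ e x • A x) x := rfl
    rw [h5]
    refine (h4 ▸ norm_add_le _ _).trans (add_le_add ?_ ?_)
    · rw [iteratedFDeriv_fun_sum_apply (fun i _ => ((hc1 i).of_le (hle r)).contDiffAt)]
      refine (norm_sum_le _ _).trans (Finset.sum_le_sum fun i _ => ?_)
      exact ContinuousLinearMap.norm_iteratedFDeriv_comp_left
        (ContinuousLinearMap.smulRightL ℝ X ℂ (ℓ i)) ((hs (D i e)).of_le (hle r)).contDiffAt le_rfl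
    · exact norm_iteratedFDeriv_smul_le (hs e) hA x (hle r)
  refine (mul_le_mul_of_nonneg_left h3 (hρ x)).trans ?_
  rw [mul_add, Finset.mul_sum, Finset.mul_sum]
  refine add_le_add (Finset.sum_le_sum fun i _ => le_of_eq (by ring))
    (Finset.sum_le_sum fun j _ => ?_)
  have h6 := (hC (r - j) x x.2).trans (le_abs_self _)
  calc ρ x * ((r.choose j : ℝ) * ‖iteratedFDeriv ℝ j (Θ e) x‖ * ‖iteratedFDeriv ℝ (r - j) A x‖)
      ≤ ρ x * ((r.choose j : ℝ) * ‖iteratedFDeriv ℝ j (Θ e) x‖ * |C (r - j)|) :=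
        mul_le_mul_of_nonneg_left (mul_le_mul_of_nonneg_left h6 (by positivity)) (hρ x)
    _ = _ := by ring

end SeminormBounds

/-! ### Covariant derivatives on sections of `L ^ (-k)` -/

section CovariantDerivative

variable {g : ℕ}

/-- The symplectic form as a continuous bilinear map. -/
def omegaL (g : ℕ) : Cover g →L[ℝ] Cover g →L[ℝ] ℝ :=
  (innerSL ℝ).bilinearComp (ContinuousLinearMap.snd ℝ (Euc g) (Euc g))
      (ContinuousLinearMap.fst ℝ (Euc g) (Euc g)) -
    (innerSL ℝ).bilinearComp (ContinuousLinearMap.fst ℝ (Euc g) (Euc g))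
      (ContinuousLinearMap.snd ℝ (Euc g) (Euc g))

lemma omegaL_apply (u v : Cover g) : omegaL g u v = omega u v := by
  change inner ℝ u.2 v.1 - inner ℝ u.1 v.2 = _
  simp [omega, PiLp.inner_apply, mul_comm]

lemma omega_add_left (u u' v : Cover g) : omega (u + u') v = omega u v + omega u' v := by
  simp [← omegaL_apply]

lemma omega_swap (u v : Cover g) : omega u v = -omega v u := by
  simp only [omega, ← Finset.sum_neg_distrib]
  exact Finset.sum_congr rfl fun j _ => by ring

lemma autFactor_zpow_neg (k : ℕ) (l : (Fin g → ℤ) × (Fin g → ℤ)) (u : Cover g) :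
    autFactor l u ^ (-(k : ℤ)) = (((-1 : ℂ) ^ (∑ j, l.1 j * l.2 j)) ^ (-(k : ℤ))) *
      Complex.exp (((k * Real.pi * omega u (latt l) : ℝ) : ℂ) * Complex.I) := by
  rw [autFactor, mul_zpow, ← Complex.exp_int_mul]
  congr 2
  push_cast
  ring

lemma norm_autFactor_zpow (k : ℕ) (l : (Fin g → ℤ) × (Fin g → ℤ)) (u : Cover g) :
    ‖autFactor l u ^ (-(k : ℤ))‖ = 1 := by
  rw [autFactor_zpow_neg, norm_mul, Complex.norm_exp_ofReal_mul_I]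
  simp

lemma SmoothSection.apply_add_latt {n : ℤ} (φ : SmoothSection g n)
    (l : (Fin g → ℤ) × (Fin g → ℤ)) (u : Cover g) :
    φ (u + latt l) = autFactor l u ^ n * φ u := φ.2.2 l u

@[simp] lemma SmoothSection.coe_add {n : ℤ} (φ ψ : SmoothSection g n) (u : Cover g) :
    (φ + ψ) u = φ u + ψ u := rfl

@[simp] lemma SmoothSection.coe_smul {n : ℤ} (c : ℂ) (φ : SmoothSection g n) (u : Cover g) :
    (c • φ) u = c * φ u := rfl

lemma SmoothSection.differentiable {n : ℤ} (φ : SmoothSection g n) : Differentiable ℝ φ :=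
  φ.contDiff.differentiable (by simp)

/-- The covariant derivative `∂_w φ + k π i ω(·, w) φ` of a section of `L ^ (-k)`. -/
def nablaFun (k : ℕ) (w : Cover g) (φ : Cover g → ℂ) (u : Cover g) : ℂ :=
  fderiv ℝ φ u w + ((k * Real.pi * omega u w : ℝ) : ℂ) * Complex.I * φ u

lemma contDiff_omega_mul (c : ℝ) (w : Cover g) :
    ContDiff ℝ ∞ fun u : Cover g => ((c * omega u w : ℝ) : ℂ) * Complex.I := by
  simp only [← omegaL_apply]
  have h : ContDiff ℝ ∞ fun u : Cover g => omegaL g u w :=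
    ((omegaL g).flip w).contDiff
  exact (Complex.ofRealCLM.contDiff.comp (contDiff_const.mul h)).mul contDiff_const

lemma contDiff_fderiv_apply {X : Type*} [NormedAddCommGroup X] [NormedSpace ℝ X] {φ : X → ℂ}
    (hφ : ContDiff ℝ ∞ φ) (w : X) : ContDiff ℝ ∞ fun u => fderiv ℝ φ u w :=
  (hφ.fderiv_right (m := ∞) (by simp)).clm_apply contDiff_const

/-- Differentiating the multiplier `exp (k π i ω(u, λ))` along `w` produces `k π i ω(w, λ)`, while
the connection term changes by `k π i ω(λ, w)` under translation by `λ`. The two cancel by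
antisymmetry. -/
lemma nablaFun_mem {k : ℕ} (w : Cover g) (φ : SmoothSection g (-(k : ℤ))) :
    nablaFun k w φ ∈ smoothSections g (-(k : ℤ)) := by
  refine ⟨(contDiff_fderiv_apply φ.contDiff w).add ((contDiff_omega_mul _ w).mul φ.contDiff),
    fun l u => ?_⟩
  have h1 : HasFDerivAt (fun u => φ (u + latt l)) (fderiv ℝ φ (u + latt l)) u :=
    (hasFDerivAt_comp_add_right (latt l)).mpr (φ.differentiable _).hasFDerivAt
  set ε := ((-1 : ℂ) ^ (∑ j, l.1 j * l.2 j)) ^ (-(k : ℤ)) with hε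
  have h2 : (fun u => φ (u + latt l)) = fun u => ε *
      Complex.exp (((k * Real.pi * omega u (latt l) : ℝ) : ℂ) * Complex.I) * φ u := by
    funext u
    rw [φ.apply_add_latt, autFactor_zpow_neg]
  have h3 : HasFDerivAt (fun u : Cover g => ((k * Real.pi * omega u (latt l) : ℝ) : ℂ) * Complex.I)
      (((Complex.ofRealCLM.comp ((k * Real.pi) • (omegaL g).flip (latt l)))).smulRight
        Complex.I) u := by
    have := (ContinuousLinearMap.smulRight (Complex.ofRealCLM.comp
      ((k * Real.pi) • (omegaL g).flip (latt l))) Complex.I).hasFDerivAt (x := u)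
    refine this.congr_of_eventuallyEq (Filter.Eventually.of_forall fun v => ?_)
    simp [omegaL_apply]
  have h4 := ((h3.cexp).const_mul ε).mul (φ.differentiable u).hasFDerivAt
  rw [h2] at h1
  -- Both sides of the quasi-periodicity relation are differentiated; uniqueness of the derivative
  -- gives the relation between the values at `u + λ` and at `u`.
  have h5 := congrArg (fun T : Cover g →L[ℝ] ℂ => T w) (h1.unique h4)
  simp only [nablaFun, φ.apply_add_latt, autFactor_zpow_neg, ← hε, omega_add_left] at h5 ⊢
  rw [h5, omega_swap (latt l) w]
  simp [omegaL_apply]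
  ring

/-- The covariant derivative as an operator on smooth sections of `L ^ (-k)`. -/
def nablaLM {k : ℕ} (w : Cover g) :
    SmoothSection g (-(k : ℤ)) →ₗ[ℂ] SmoothSection g (-(k : ℤ)) where
  toFun φ := ⟨nablaFun k w φ, nablaFun_mem w φ⟩
  map_add' φ ψ := by
    refine Subtype.ext (funext fun u => ?_)
    change nablaFun k w (fun u => φ u + ψ u) u = nablaFun k w φ u + nablaFun k w ψ u
    simp only [nablaFun]
    rw [fderiv_fun_add (φ.differentiable u) (ψ.differentiable u), _root_.add_apply]
    ring
  map_smul' c φ := by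
    refine Subtype.ext (funext fun u => ?_)
    change nablaFun k w (fun u => c * φ u) u = c * nablaFun k w φ u
    simp only [nablaFun]
    rw [fderiv_const_mul (φ.differentiable u), _root_.smul_apply, smul_eq_mul]
    ring

lemma isCompact_unitSquare (g : ℕ) : IsCompact (unitCube g ×ˢ unitCube g) :=
  (isCompact_unitCube g).prod (isCompact_unitCube g)

lemma seminormBdd_section (n : ℤ) (r : ℕ) :
    SeminormBdd (fun (φ : SmoothSection g n) (u : (unitCube g ×ˢ unitCube g : Set (Cover g))) =>
      ‖iteratedFDeriv ℝ r φ u‖) :=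
  ⟨sectionSeminorm g n r, (withSeminorms_section g n).continuous_seminorm r,
    fun φ u => le_ciSup (bddAbove_iteratedFDeriv r φ) u⟩

lemma continuous_to_section {n : ℤ} {E : Type*} [AddCommGroup E] [Module ℂ E] [TopologicalSpace E]
    [IsTopologicalAddGroup E] (T : E →ₗ[ℂ] SmoothSection g n)
    (h : ∀ r, SeminormBdd (fun (e : E) (u : (unitCube g ×ˢ unitCube g : Set (Cover g))) =>
      ‖iteratedFDeriv ℝ r (T e) u‖)) : Continuous T := by
  refine WithSeminorms.continuous_of_continuous_comp (withSeminorms_section g n) T fun r => ?_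
  obtain ⟨q, hq, hb⟩ := h r
  exact Seminorm.continuous_of_le hq fun e => Real.iSup_le (fun u => hb e u) (apply_nonneg q e)

lemma continuous_to_schwartz {V E : Type*} [NormedAddCommGroup V] [NormedSpace ℝ V]
    [AddCommGroup E] [Module ℂ E] [TopologicalSpace E]
    [IsTopologicalAddGroup E] (T : E →ₗ[ℂ] 𝓢(V, ℂ))
    (h : ∀ m r, SeminormBdd (fun (e : E) (y : V) => ‖y‖ ^ m * ‖iteratedFDeriv ℝ r (T e) y‖)) :
    Continuous T := by
  refine WithSeminorms.continuous_of_continuous_comp (schwartz_withSeminorms ℂ V ℂ) T fun r => ?_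
  obtain ⟨q, hq, hb⟩ := h r.1 r.2
  exact Seminorm.continuous_of_le hq fun e =>
    SchwartzMap.seminorm_le_bound ℂ r.1 r.2 (T e) (apply_nonneg q e) fun y => hb e y

lemma exists_norm_iteratedFDeriv_le {X F : Type*} [NormedAddCommGroup X] [NormedSpace ℝ X]
    [NormedAddCommGroup F] [NormedSpace ℝ F] {K : Set X} (hK : IsCompact K)
    {A : X → F} (hA : ContDiff ℝ ∞ A) (r : ℕ) :
    ∃ C, ∀ x ∈ K, ‖iteratedFDeriv ℝ r A x‖ ≤ C :=
  hK.exists_bound_of_continuousOn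
    (hA.continuous_iteratedFDeriv (m := r) (by exact_mod_cast le_top)).continuousOn

lemma continuous_nablaLM {k : ℕ} (w : Cover g) : Continuous (nablaLM (k := k) w) := by
  refine continuous_to_section _ fun r => ?_
  choose C hC using exists_norm_iteratedFDeriv_le (isCompact_unitSquare g)
    (contDiff_omega_mul (k * Real.pi) w)
  have h1 := ((seminormBdd_section (g := g) (-(k : ℤ)) (r + 1)).const_mul (norm_nonneg w)).add
    (SeminormBdd.sum (Finset.range (r + 1)) fun j _ =>
      (seminormBdd_section (g := g) (-(k : ℤ)) (r - j)).const_mul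
        (c := (r.choose j : ℝ) * |C j|) (by positivity))
  refine h1.of_le fun φ u => ?_
  have hle : ((r : ℕ) : ℕ∞ω) ≤ ∞ := by exact_mod_cast le_top
  have hd := contDiff_fderiv_apply φ.contDiff w
  have h2 : iteratedFDeriv ℝ r (nablaLM w φ) u = _ :=
    iteratedFDeriv_add_apply (hd.of_le hle).contDiffAt
      (((contDiff_omega_mul (k * Real.pi) w).mul φ.contDiff).of_le hle).contDiffAt
  rw [h2]
  refine (norm_add_le _ _).trans (add_le_add ?_ ?_)
  · rw [← norm_iteratedFDeriv_fderiv]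
    exact norm_iteratedFDeriv_clm_apply_const
      ((φ.contDiff.fderiv_right (m := ∞) (by simp)).of_le hle).contDiffAt le_rfl
  · refine (norm_iteratedFDeriv_mul_le (contDiff_omega_mul (k * Real.pi) w) φ.contDiff _
      hle).trans (Finset.sum_le_sum fun j _ => ?_)
    have := (hC j u u.2).trans (le_abs_self _)
    gcongr

/-- The covariant derivative as a continuous operator on smooth sections of `L ^ (-k)`. -/
def nabla {k : ℕ} (w : Cover g) :
    SmoothSection g (-(k : ℤ)) →L[ℂ] SmoothSection g (-(k : ℤ)) :=
  ⟨nablaLM w, continuous_nablaLM w⟩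

lemma nabla_apply {k : ℕ} (w : Cover g) (φ : SmoothSection g (-(k : ℤ))) (u : Cover g) :
    nabla w φ u = fderiv ℝ φ u w + ((k * Real.pi * omega u w : ℝ) : ℂ) * Complex.I * φ u := rfl

lemma exists_add_latt_mem_unitCube (u : Cover g) :
    ∃ l, u + latt l ∈ unitCube g ×ˢ unitCube g := by
  refine ⟨(fun j => -⌊u.1 j⌋, fun j => -⌊u.2 j⌋), ?_, ?_⟩ <;> intro j <;>
    simp only [latt, Prod.fst_add, Prod.snd_add, PiLp.add_apply, Int.cast_neg, Set.mem_Icc] <;>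
    constructor
  · linarith [Int.floor_le (u.1 j)]
  · linarith [Int.lt_floor_add_one (u.1 j)]
  · linarith [Int.floor_le (u.2 j)]
  · linarith [Int.lt_floor_add_one (u.2 j)]

/-- The multipliers have modulus one, so `‖φ‖` is periodic and its supremum over the square is its
supremum over `ℝ^{2g}`. -/
lemma seminormBdd_section_univ (k : ℕ) :
    SeminormBdd (fun (φ : SmoothSection g (-(k : ℤ))) (u : Cover g) => ‖φ u‖) := by
  obtain ⟨q, hq, hb⟩ := seminormBdd_section (g := g) (-(k : ℤ)) 0
  refine ⟨q, hq, fun φ u => ?_⟩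
  obtain ⟨l, hl⟩ := exists_add_latt_mem_unitCube u
  have := hb φ ⟨_, hl⟩
  beta_reduce at this ⊢
  rwa [norm_iteratedFDeriv_zero, φ.apply_add_latt, norm_mul, norm_autFactor_zpow, one_mul] at this

end CovariantDerivative

/-! ### Periodic functions and Fourier series on the torus -/

section Periodic

/-- The normalized measure on `ℝ / ℤ`. -/
local instance : MeasureSpace UnitAddCircle := ⟨AddCircle.haarAddCircle⟩

local instance : Measure.IsAddHaarMeasure (volume : Measure UnitAddCircle) :=
  inferInstanceAs (Measure.IsAddHaarMeasure AddCircle.haarAddCircle)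

local instance : IsProbabilityMeasure (volume : Measure UnitAddCircle) :=
  inferInstanceAs (IsProbabilityMeasure AddCircle.haarAddCircle)

variable {g : ℕ}

/-- The vector with integer coordinates `n`. -/
def intVec (n : Fin g → ℤ) : Euc g := WithLp.toLp 2 fun j => (n j : ℝ)

@[simp] lemma intVec_apply (n : Fin g → ℤ) (j : Fin g) : intVec n j = n j := rfl

lemma intVec_add (n m : Fin g → ℤ) : intVec (n + m) = intVec n + intVec m := by
  ext j; simp

/-- The projection of `ℝ^g` onto the torus. -/
def toTorus (x : Euc g) : UnitAddTorus (Fin g) := fun j => (x j : UnitAddCircle)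

lemma toTorus_add (x y : Euc g) : toTorus (x + y) = toTorus x + toTorus y := rfl

lemma isOpenQuotientMap_toTorus : IsOpenQuotientMap (toTorus (g := g)) :=
  (IsOpenQuotientMap.piMap fun _ : Fin g =>
    (QuotientAddGroup.isOpenQuotientMap_mk (N := AddSubgroup.zmultiples (1 : ℝ)))).comp
      (EuclideanSpace.equiv (Fin g) ℝ).toHomeomorph.isOpenQuotientMap

/-- The function on the torus with the pull-back `h`, for a periodic function `h`. -/
def torusFun (h : Euc g → ℂ) (z : UnitAddTorus (Fin g)) : ℂ :=
  h (WithLp.toLp 2 fun j => (AddCircle.equivIoc 1 0 (z j) : ℝ))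

lemma torusFun_toTorus {h : Euc g → ℂ} (hp : ∀ n x, h (x + intVec n) = h x) (x : Euc g) :
    torusFun h (toTorus x) = h x := by
  have h1 : ∀ j, ∃ n : ℤ, (AddCircle.equivIoc 1 0 (toTorus x j) : ℝ) = x j + n := fun j => by
    have h2 := AddCircle.coe_equivIoc (p := (1 : ℝ)) (a := 0) (y := toTorus x j)
    have h3 : ((AddCircle.equivIoc 1 0 (toTorus x j) : ℝ) : UnitAddCircle) = (x j : ℝ) := h2
    rw [← sub_eq_zero, ← AddCircle.coe_sub, AddCircle.coe_eq_zero_iff] at h3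
    obtain ⟨n, hn⟩ := h3
    refine ⟨n, ?_⟩
    rw [zsmul_one] at hn
    linarith
  choose n hn using h1
  rw [torusFun, ← hp n x]
  congr 1
  ext j
  exact hn j

lemma continuous_torusFun {h : Euc g → ℂ} (hp : ∀ n x, h (x + intVec n) = h x)
    (hc : Continuous h) : Continuous (torusFun h) := by
  rw [isOpenQuotientMap_toTorus.isQuotientMap.continuous_iff]
  convert hc using 1
  exact funext (torusFun_toTorus hp)

/-- The faces of the cube are null; the half-open cube is the fundamental domain over which torus
integrals are computed. -/
lemma volume_Ioc_cube_ae : (unitCube g : Set (Euc g)) =ᵐ[volume]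
    {x : Euc g | ∀ j, x j ∈ Set.Ioc (0 : ℝ) (0 + 1)} := by
  have h1 : (Set.univ.pi fun _ : Fin g => Set.Ioc (0 : ℝ) 1) =ᵐ[volume]
      (Set.univ.pi fun _ : Fin g => Set.Icc (0 : ℝ) 1) := by
    have := Measure.univ_pi_Ioc_ae_eq_Icc (μ := fun _ : Fin g => (volume : Measure ℝ))
      (f := fun _ => 0) (g := fun _ => 1)
    rwa [← Set.pi_univ_Icc] at this
  have h2 := (PiLp.volume_preserving_ofLp (Fin g)).quasiMeasurePreserving.preimage_ae_eq h1
  have e1 : (unitCube g : Set (Euc g)) =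
      WithLp.ofLp ⁻¹' (Set.univ.pi fun _ : Fin g => Set.Icc (0 : ℝ) 1) := by
    ext x; simp only [unitCube, Set.mem_preimage, Set.mem_univ_pi]; rfl
  have e2 : {x : Euc g | ∀ j, x j ∈ Set.Ioc (0 : ℝ) (0 + 1)} =
      WithLp.ofLp ⁻¹' (Set.univ.pi fun _ : Fin g => Set.Ioc (0 : ℝ) 1) := by
    ext x; simp [Set.mem_pi]
  rw [e1, e2]
  exact h2.symm

lemma setIntegral_cube_eq (H : UnitAddTorus (Fin g) → ℂ) :
    ∫ x in unitCube g, H (toTorus x) = ∫ z, H z := by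
  rw [setIntegral_congr_set volume_Ioc_cube_ae, UnitAddTorus.integral_preimage H fun _ => 0]
  exact (PiLp.volume_preserving_ofLp (Fin g)).setIntegral_preimage_emb
    (MeasurableEquiv.toLp 2 (Fin g → ℝ)).symm.measurableEmbedding
    (fun x : Fin g → ℝ => H fun i => (x i : UnitAddCircle)) {x | ∀ i, x i ∈ Set.Ioc (0 : ℝ) (0 + 1)}

/-- The function descends to the torus, where Haar measure is translation invariant. -/
lemma setIntegral_cube_add {h : Euc g → ℂ} (hp : ∀ n x, h (x + intVec n) = h x) (v : Euc g) :
    ∫ x in unitCube g, h (x + v) = ∫ x in unitCube g, h x := by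
  have h1 : ∀ x, h x = torusFun h (toTorus x) := fun x => (torusFun_toTorus hp x).symm
  calc ∫ x in unitCube g, h (x + v)
      = ∫ x in unitCube g, (fun z => torusFun h (z + toTorus v)) (toTorus x) := by
        simp only [h1, toTorus_add]
    _ = ∫ z, torusFun h (z + toTorus v) :=
        setIntegral_cube_eq fun z => torusFun h (z + toTorus v)
    _ = ∫ z, torusFun h z := integral_add_right_eq_self _ _
    _ = _ := by rw [← setIntegral_cube_eq]; simp only [← h1]

lemma mFourier_toTorus (n : Fin g → ℤ) (x : Euc g) :
    UnitAddTorus.mFourier n (toTorus x) =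
      Complex.exp (((2 * Real.pi * inner ℝ (intVec n) x : ℝ) : ℂ) * Complex.I) := by
  simp only [UnitAddTorus.mFourier, ContinuousMap.coe_mk, toTorus, fourier_coe_apply,
    ← Complex.exp_sum, PiLp.inner_apply]
  congr 1
  push_cast
  rw [Finset.mul_sum, Finset.sum_mul]
  refine Finset.sum_congr rfl fun j _ => ?_
  simp
  ring

/-- The Fourier series of a continuous periodic function with summable coefficients. -/
lemma hasSum_fourier_of_periodic {h : Euc g → ℂ} (hp : ∀ n x, h (x + intVec n) = h x)
    (hc : Continuous h)
    (hs : Summable fun n : Fin g → ℤ => ∫ x in unitCube g, h x *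
      Complex.exp (((2 * Real.pi * inner ℝ (intVec n) x : ℝ) : ℂ) * Complex.I)) (x : Euc g) :
    HasSum (fun n : Fin g → ℤ => (∫ x in unitCube g, h x *
      Complex.exp (((2 * Real.pi * inner ℝ (intVec n) x : ℝ) : ℂ) * Complex.I)) *
      Complex.exp (-(((2 * Real.pi * inner ℝ (intVec n) x : ℝ) : ℂ) * Complex.I))) (h x) := by
  -- The coefficients here are taken against `exp (2 π i ᵗn x)`, so they are the usual Fourier
  -- coefficients with index `-n`.
  have h1 : ∀ n : Fin g → ℤ, ∫ x in unitCube g, h x *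
      Complex.exp (((2 * Real.pi * inner ℝ (intVec n) x : ℝ) : ℂ) * Complex.I) =
      UnitAddTorus.mFourierCoeff (torusFun h) (-n) := fun n => by
    rw [UnitAddTorus.mFourierCoeff, ← setIntegral_cube_eq, neg_neg]
    simp only [mFourier_toTorus, torusFun_toTorus hp, smul_eq_mul, mul_comm]
  let f : C(UnitAddTorus (Fin g), ℂ) := ⟨torusFun h, continuous_torusFun hp hc⟩
  have h2 : Summable (UnitAddTorus.mFourierCoeff f) := by
    rw [← (Equiv.neg (Fin g → ℤ)).summable_iff]
    exact hs.congr fun n => h1 n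
  have h3 := UnitAddTorus.hasSum_mFourier_series_apply_of_summable h2 (toTorus x)
  rw [← (Equiv.neg (Fin g → ℤ)).hasSum_iff] at h3
  have h4 : f (toTorus x) = h x := torusFun_toTorus hp x
  rw [h4] at h3
  refine h3.congr_fun fun n => ?_
  rw [h1 n]
  simp only [Function.comp_apply, Equiv.neg_apply, smul_eq_mul, mFourier_toTorus]
  have h5 : intVec (-n) = -intVec n := by ext j; simp
  rw [h5, inner_neg_left]
  congr 2
  push_cast
  ring

lemma setIntegral_cube_exp (n : Fin g → ℤ) :
    ∫ x in unitCube g,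
      Complex.exp (((2 * Real.pi * inner ℝ (intVec n) x : ℝ) : ℂ) * Complex.I) =
      if n = 0 then 1 else 0 := by
  have h1 := orthonormal_iff_ite.mp (UnitAddTorus.orthonormal_mFourier (d := Fin g)) 0 n
  simp only [UnitAddTorus.mFourierLp, ContinuousMap.inner_toLp] at h1
  simp only [← mFourier_toTorus]
  rw [setIntegral_cube_eq (fun z => UnitAddTorus.mFourier n z)]
  simp only [UnitAddTorus.mFourier_zero, ContinuousMap.one_apply, map_one, mul_one] at h1
  rw [h1]
  simp only [eq_comm]

end Periodic

/-! ### Differentiation under the integral over a compact set -/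

section ParametricIntegral

lemma continuous_fderiv_partial {X Y : Type*} [NormedAddCommGroup X] [NormedSpace ℝ X]
    [NormedAddCommGroup Y] [NormedSpace ℝ Y] {F : X → Y → ℂ}
    (hF : ContDiff ℝ ∞ (Function.uncurry F)) :
    Continuous fun p : X × Y => fderiv ℝ (fun x => F x p.2) p.1 := by
  have h1 : ∀ p : X × Y, fderiv ℝ (fun x => F x p.2) p.1 =
      (fderiv ℝ (Function.uncurry F) p).comp (ContinuousLinearMap.inl ℝ X Y) := fun p => by
    have h2 : HasFDerivAt (Function.uncurry F) (fderiv ℝ (Function.uncurry F) (p.1, p.2))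
        (p.1, p.2) := (hF.differentiable (by simp) _).hasFDerivAt
    exact (h2.comp p.1 (hasFDerivAt_prodMk_left (𝕜 := ℝ) p.1 p.2)).fderiv
  simp only [h1]
  exact (hF.continuous_fderiv (by simp)).clm_comp continuous_const

lemma hasFDerivAt_setIntegral_of_contDiff {X Y : Type*} [NormedAddCommGroup X] [NormedSpace ℝ X]
    [ProperSpace X] [NormedAddCommGroup Y] [NormedSpace ℝ Y] [MeasurableSpace Y] [BorelSpace Y]
    [SecondCountableTopology Y]
    {μ : Measure Y} [IsFiniteMeasureOnCompacts μ] {K : Set Y} (hK : IsCompact K)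
    {F : X → Y → ℂ} (hF : ContDiff ℝ ∞ (Function.uncurry F)) (x : X) :
    HasFDerivAt (fun x => ∫ y in K, F x y ∂μ) (∫ y in K, fderiv ℝ (fun x => F x y) x ∂μ) x := by
  have hF1 : ∀ y, ContDiff ℝ ∞ fun x => F x y := fun y =>
    hF.comp (contDiff_id.prodMk contDiff_const)
  have hF2 : ∀ x, Continuous fun y => F x y := fun x =>
    hF.continuous.comp (continuous_const.prodMk continuous_id)
  have hd := continuous_fderiv_partial hF
  -- The partial derivative is bounded on the compact product of a closed ball with `K`; this
  -- constant is the integrable majorant.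
  obtain ⟨C, hC⟩ := ((isCompact_closedBall x 1).prod hK).exists_bound_of_continuousOn
    hd.continuousOn
  have hKm : MeasurableSet (K : Set Y) := hK.measurableSet
  refine hasFDerivAt_integral_of_dominated_of_fderiv_le (μ := μ.restrict K)
    (F' := fun x y => fderiv ℝ (fun x => F x y) x) (s := Metric.ball x 1) (bound := fun _ => C)
    (Metric.ball_mem_nhds x one_pos) (Filter.Eventually.of_forall fun x' =>
      (hF2 x').aestronglyMeasurable) ((hF2 x).continuousOn.integrableOn_compact hK) ?_ ?_ ?_ ?_
  · have : Continuous fun y => fderiv ℝ (fun x => F x y) x :=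
      hd.comp (continuous_const.prodMk continuous_id)
    exact this.aestronglyMeasurable
  · refine (ae_restrict_mem hKm).mono fun y hy x' hx' => ?_
    exact hC (x', y) ⟨Metric.ball_subset_closedBall hx', hy⟩
  · exact continuousOn_const.integrableOn_compact hK
  · exact Filter.Eventually.of_forall fun y x' _ =>
      ((hF1 y).differentiable (by simp) x').hasFDerivAt

variable {g : ℕ}

/-- The integral of `h (x + t v)` does not depend on `t`; its derivative at `t = 0` is the integral
in question. This is the integration by parts on the torus. -/
lemma setIntegral_cube_fderiv {h : Euc g → ℂ} (hp : ∀ n x, h (x + intVec n) = h x)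
    (hc : ContDiff ℝ ∞ h) (v : Euc g) : ∫ x in unitCube g, fderiv ℝ h x v = 0 := by
  have h1 := hasFDerivAt_setIntegral_of_contDiff (μ := (volume : Measure (Euc g)))
    (isCompact_unitCube g) (F := fun (t : ℝ) (x : Euc g) => h (x + t • v))
    (hc.comp (by fun_prop)) 0
  simp only [setIntegral_cube_add hp] at h1
  have h2 := congrArg (fun T : ℝ →L[ℝ] ℂ => T 1) (h1.unique (hasFDerivAt_const _ _))
  have h3 : ∀ x : Euc g, HasFDerivAt (fun t : ℝ => h (x + t • v))
      ((fderiv ℝ h x).comp (ContinuousLinearMap.toSpanSingleton ℝ v)) 0 := fun x => by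
    have h4 : HasFDerivAt (fun t : ℝ => x + t • v) (ContinuousLinearMap.toSpanSingleton ℝ v) 0 :=
      ((ContinuousLinearMap.toSpanSingleton ℝ v).hasFDerivAt).const_add x
    have h5 : HasFDerivAt h (fderiv ℝ h x) (x + (0 : ℝ) • v) := by
      simpa using (hc.differentiable (by simp) x).hasFDerivAt
    exact h5.comp 0 h4
  simp only [(h3 _).fderiv] at h2
  rw [ContinuousLinearMap.integral_apply] at h2
  · simpa using h2
  · refine Continuous.continuousOn ?_ |>.integrableOn_compact (isCompact_unitCube g)
    exact (hc.continuous_fderiv (by simp)).clm_comp continuous_const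

end ParametricIntegral

/-! ### Weil–Brezin coefficients as Fourier coefficients in `x` -/

section Coefficients

variable {g k : ℕ}

lemma omega_eq_inner (u v : Cover g) : omega u v = inner ℝ u.2 v.1 - inner ℝ u.1 v.2 := by
  rw [← omegaL_apply]; rfl

/-- A section of `L ^ (-k)`, made periodic in the first variable. -/
def hSec (φ : SmoothSection g (-(k : ℤ))) (Y x : Euc g) : ℂ :=
  φ (x, Y) * Complex.exp (((-(k * Real.pi * inner ℝ x Y) : ℝ) : ℂ) * Complex.I)

/-- The character `exp (2 π i ᵗn x)` of the torus. -/
def expChar (n : Fin g → ℤ) (x : Euc g) : ℂ :=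
  Complex.exp (((2 * Real.pi * inner ℝ (intVec n) x : ℝ) : ℂ) * Complex.I)

lemma contDiff_expI {X : Type*} [NormedAddCommGroup X] [NormedSpace ℝ X] {f : X → ℝ}
    (hf : ContDiff ℝ ∞ f) : ContDiff ℝ ∞ fun x => Complex.exp ((f x : ℂ) * Complex.I) :=
  ((Complex.ofRealCLM.contDiff.comp hf).mul contDiff_const).cexp

lemma contDiff_expChar (n : Fin g → ℤ) : ContDiff ℝ ∞ (expChar n) :=
  contDiff_expI (contDiff_const.mul (contDiff_const.inner ℝ contDiff_id))

lemma norm_expChar (n : Fin g → ℤ) (x : Euc g) : ‖expChar n x‖ = 1 :=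
  Complex.norm_exp_ofReal_mul_I _

lemma expChar_add (n m : Fin g → ℤ) (x : Euc g) :
    expChar (n + m) x = expChar n x * expChar m x := by
  simp only [expChar, ← Complex.exp_add, intVec_add, inner_add_left]
  congr 1
  push_cast
  ring

lemma norm_hSec (φ : SmoothSection g (-(k : ℤ))) (Y x : Euc g) : ‖hSec φ Y x‖ = ‖φ (x, Y)‖ := by
  rw [hSec, norm_mul, Complex.norm_exp_ofReal_mul_I, mul_one]

lemma contDiff_hSec (φ : SmoothSection g (-(k : ℤ))) {X : Type*} [NormedAddCommGroup X]
    [NormedSpace ℝ X] {a b : X → Euc g} (ha : ContDiff ℝ ∞ a) (hb : ContDiff ℝ ∞ b) :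
    ContDiff ℝ ∞ fun p => hSec φ (a p) (b p) :=
  (φ.contDiff.comp (hb.prodMk ha)).mul
    (contDiff_expI (contDiff_const.mul (hb.inner ℝ ha)).neg)

/-- The hypothesis makes the sign `α(λ)` trivial; it holds whenever `n` or `m` is zero, the only
case needed. -/
lemma SmoothSection.apply_add_intVec (φ : SmoothSection g (-(k : ℤ))) (x Y : Euc g)
    (n m : Fin g → ℤ) (h0 : ∑ j, n j * m j = 0) :
    φ (x + intVec n, Y + intVec m) = Complex.exp (((k * Real.pi *
      (inner ℝ Y (intVec n) - inner ℝ x (intVec m)) : ℝ) : ℂ) * Complex.I) * φ (x, Y) := by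
  have h := φ.apply_add_latt (n, m) (x, Y)
  rw [autFactor_zpow_neg] at h
  simp only [h0, zpow_zero, one_zpow, one_mul, omega_eq_inner] at h
  exact h

lemma hSec_add_intVec (φ : SmoothSection g (-(k : ℤ))) (Y : Euc g) (n : Fin g → ℤ) (x : Euc g) :
    hSec φ Y (x + intVec n) = hSec φ Y x := by
  have h := φ.apply_add_intVec x Y n 0 (by simp)
  have h0 : intVec (0 : Fin g → ℤ) = 0 := by ext j; simp
  rw [h0, add_zero] at h
  rw [hSec, h, hSec, mul_comm (Complex.exp _) (φ (x, Y)), mul_assoc, ← Complex.exp_add]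
  congr 2
  rw [inner_zero_right, inner_add_left, real_inner_comm Y (intVec n)]
  push_cast
  ring

/-- The multiplier of the section and the explicit phase each contribute `exp (-k π i ᵗm x)`.
Together they form a character of the torus, so an integral translation in `y` shifts the Fourier
index by a multiple of `k`. -/
lemma hSec_intVec_add (φ : SmoothSection g (-(k : ℤ))) (Y : Euc g) (m : Fin g → ℤ) (x : Euc g) :
    hSec φ (Y + intVec m) x = expChar (-(k : ℤ) • m) x * hSec φ Y x := by
  have h := φ.apply_add_intVec x Y 0 m (by simp)
  have h0 : intVec (0 : Fin g → ℤ) = 0 := by ext j; simp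
  have h1 : intVec (-(k : ℤ) • m) = -(k : ℝ) • intVec m := by ext j; simp
  rw [h0, add_zero] at h
  rw [hSec, h, hSec, expChar, mul_comm (φ (x, Y)), ← mul_assoc, mul_right_comm,
    ← Complex.exp_add, ← Complex.exp_add, h1]
  congr 2
  rw [inner_zero_right, inner_add_right, inner_smul_left, real_inner_comm x (intVec m)]
  simp
  ring

/-- The Weil–Brezin coefficients of a section of `L ^ (-k)`, indexed by all integer vectors. -/
def coefN (φ : SmoothSection g (-(k : ℤ))) (n : Fin g → ℤ) (y : Euc g) : ℂ :=
  ∫ x in unitCube g, hSec φ (y + (k : ℝ)⁻¹ • intVec n) x * expChar n x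

lemma integrableOn_hSec_mul (φ : SmoothSection g (-(k : ℤ))) (Y : Euc g) (n : Fin g → ℤ) :
    IntegrableOn (fun x => hSec φ Y x * expChar n x) (unitCube g) :=
  ((contDiff_hSec φ contDiff_const contDiff_id).mul
    (contDiff_expChar n)).continuous.continuousOn.integrableOn_compact (isCompact_unitCube g)

lemma coefN_add (φ ψ : SmoothSection g (-(k : ℤ))) (n : Fin g → ℤ) (y : Euc g) :
    coefN (φ + ψ) n y = coefN φ n y + coefN ψ n y := by
  rw [coefN, coefN, coefN, ← integral_add (integrableOn_hSec_mul φ _ n)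
    (integrableOn_hSec_mul ψ _ n)]
  simp [hSec, add_mul]

lemma coefN_smul (c : ℂ) (φ : SmoothSection g (-(k : ℤ))) (n : Fin g → ℤ) (y : Euc g) :
    coefN (c • φ) n y = c * coefN φ n y := by
  rw [coefN, coefN, ← integral_const_mul]
  simp [hSec, mul_assoc]

/-- The character produced by translating `y` by `m` cancels the change of the test character, so
only the residue class of the index matters. -/
lemma coefN_add_smul [NeZero k] (φ : SmoothSection g (-(k : ℤ))) (n m : Fin g → ℤ) (y : Euc g) :
    coefN φ (n + (k : ℤ) • m) y = coefN φ n y := by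
  have hk : (k : ℝ) ≠ 0 := Nat.cast_ne_zero.mpr (NeZero.ne k)
  have h1 : y + (k : ℝ)⁻¹ • intVec (n + (k : ℤ) • m) =
      (y + (k : ℝ)⁻¹ • intVec n) + intVec m := by
    ext j
    simp
    field_simp
    ring
  rw [coefN, coefN]
  congr 1
  funext x
  have h2 : expChar (-(k : ℤ) • m) x * expChar ((k : ℤ) • m) x = 1 := by
    rw [← expChar_add, ← add_smul]
    simp [expChar, intVec, inner]
  rw [h1, hSec_intVec_add, expChar_add]
  linear_combination (hSec φ (y + (k : ℝ)⁻¹ • intVec n) x * expChar n x) * h2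

lemma hasFDerivAt_expI {X : Type*} [NormedAddCommGroup X] [NormedSpace ℝ X] {f : X → ℝ}
    {f' : X →L[ℝ] ℝ} {x : X} (hf : HasFDerivAt f f' x) :
    HasFDerivAt (fun x => Complex.exp ((f x : ℂ) * Complex.I))
      (f'.smulRight (Complex.exp ((f x : ℂ) * Complex.I) * Complex.I)) x := by
  have h1 : HasFDerivAt (fun x => (f x : ℂ) * Complex.I)
      ((ContinuousLinearMap.smulRight Complex.ofRealCLM Complex.I).comp f') x :=
    (ContinuousLinearMap.smulRight Complex.ofRealCLM Complex.I).hasFDerivAt.comp x hf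
  convert h1.cexp using 1
  ext v
  simp
  ring

/-- Since `ω((x, Y), (0, b)) = -ᵗx b`, the derivative of the phase is exactly the connection term of
the covariant derivative. -/
lemma fderiv_hSec_left (φ : SmoothSection g (-(k : ℤ))) (Y x b : Euc g) :
    fderiv ℝ (fun Y => hSec φ Y x) Y b = hSec (nabla (0, b) φ) Y x := by
  have h1 : HasFDerivAt (fun Y => φ (x, Y)) ((fderiv ℝ φ (x, Y)).comp
      (ContinuousLinearMap.inr ℝ (Euc g) (Euc g))) Y :=
    HasFDerivAt.comp Y (φ.differentiable (x, Y)).hasFDerivAt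
      (hasFDerivAt_prodMk_right (𝕜 := ℝ) x Y)
  have h2 : HasFDerivAt (fun Y : Euc g => -(k * Real.pi * inner ℝ x Y))
      (-((k * Real.pi) • innerSL ℝ x)) Y :=
    ((innerSL ℝ x).hasFDerivAt.const_mul (k * Real.pi)).neg
  have h3 := h1.mul (hasFDerivAt_expI h2)
  have h4 : HasFDerivAt (fun Y => hSec φ Y x) _ Y := h3
  rw [h4.fderiv, hSec, nabla_apply, omega_eq_inner]
  simp
  ring

/-- In the `x` direction the derivative of the phase and the connection term have opposite signs, so
their discrepancy is twice `k π i ᵗY v` instead of zero. -/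
lemma fderiv_hSec_mul_expChar (φ : SmoothSection g (-(k : ℤ))) (n : Fin g → ℤ) (Y x v : Euc g) :
    fderiv ℝ (fun x => hSec φ Y x * expChar n x) x v =
      hSec (nabla (v, 0) φ) Y x * expChar n x - ((2 * Real.pi *
        (k * inner ℝ Y v - inner ℝ (intVec n) v) : ℝ) : ℂ) * Complex.I *
          (hSec φ Y x * expChar n x) := by
  have h1 : HasFDerivAt (fun x => φ (x, Y)) ((fderiv ℝ φ (x, Y)).comp
      (ContinuousLinearMap.inl ℝ (Euc g) (Euc g))) x :=
    HasFDerivAt.comp x (φ.differentiable (x, Y)).hasFDerivAt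
      (hasFDerivAt_prodMk_left (𝕜 := ℝ) x Y)
  have h2 : HasFDerivAt (fun x : Euc g => -(k * Real.pi * inner ℝ x Y))
      (-((k * Real.pi) • innerSL ℝ Y)) x := by
    simp only [real_inner_comm Y]
    exact ((innerSL ℝ Y).hasFDerivAt.const_mul (k * Real.pi)).neg
  have h3 : HasFDerivAt (fun x : Euc g => 2 * Real.pi * inner ℝ (intVec n) x)
      ((2 * Real.pi) • innerSL ℝ (intVec n)) x :=
    (innerSL ℝ (intVec n)).hasFDerivAt.const_mul (2 * Real.pi)
  have h4 := (h1.mul (hasFDerivAt_expI h2)).mul (hasFDerivAt_expI h3)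
  have h5 : HasFDerivAt (fun x => hSec φ Y x * expChar n x) _ x := h4
  rw [h5.fderiv, hSec, hSec, nabla_apply, omega_eq_inner, expChar]
  simp
  ring

/-- The integral of an `x`-derivative over the torus vanishes, which leaves the multiplication term.
The shift by `n / k` in the argument `Y` cancels the frequency `n` of the character, so only `y`
remains. This identity is the source of polynomial decay. -/
lemma coefN_nabla_left [NeZero k] (φ : SmoothSection g (-(k : ℤ))) (n : Fin g → ℤ)
    (y v : Euc g) :
    coefN (nabla (v, 0) φ) n y =
      ((2 * Real.pi * k * inner ℝ y v : ℝ) : ℂ) * Complex.I * coefN φ n y := by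
  have hk : (k : ℝ) ≠ 0 := Nat.cast_ne_zero.mpr (NeZero.ne k)
  set Y := y + (k : ℝ)⁻¹ • intVec n with hY
  have h1 : ContDiff ℝ ∞ fun x => hSec φ Y x * expChar n x :=
    (contDiff_hSec φ contDiff_const contDiff_id).mul (contDiff_expChar n)
  have h2 := setIntegral_cube_fderiv (h := fun x => hSec φ Y x * expChar n x) (fun m x => by
    rw [hSec_add_intVec]
    congr 1
    rw [expChar, expChar, inner_add_right]
    have : inner ℝ (intVec n) (intVec m) = ((∑ j, n j * m j : ℤ) : ℝ) := by
      simp [PiLp.inner_apply, mul_comm]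
    rw [this, Complex.exp_eq_exp_iff_exists_int]
    exact ⟨∑ j, n j * m j, by push_cast; ring⟩) h1 v
  simp only [fderiv_hSec_mul_expChar] at h2
  rw [integral_sub (integrableOn_hSec_mul _ _ n)
    ((integrableOn_hSec_mul _ _ n).const_mul _), sub_eq_zero, integral_const_mul] at h2
  rw [coefN, ← hY, h2, coefN, ← hY]
  have h3 : k * inner ℝ Y v - inner ℝ (intVec n) v = k * inner ℝ y v := by
    rw [hY, inner_add_left, inner_smul_left]
    simp
    field_simp
    ring
  rw [h3, mul_assoc (2 * Real.pi)]

/-- Differentiation under the integral: the covariant derivatives in `y` become ordinary partial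
derivatives of the coefficients, and the family of coefficients is closed under differentiation. -/
lemma hasFDerivAt_coefN (φ : SmoothSection g (-(k : ℤ))) (n : Fin g → ℤ) (y : Euc g) :
    HasFDerivAt (coefN φ n) (∑ j, (EuclideanSpace.proj (𝕜 := ℝ) j).smulRight
      (coefN (nabla (0, EuclideanSpace.single j 1) φ) n y)) y := by
  set F : Euc g → Euc g → ℂ := fun y x => hSec φ (y + (k : ℝ)⁻¹ • intVec n) x * expChar n x with hF
  have hFc : ContDiff ℝ ∞ (Function.uncurry F) :=
    (contDiff_hSec φ (a := fun p : Euc g × Euc g => p.1 + (k : ℝ)⁻¹ • intVec n)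
      (contDiff_fst.add contDiff_const) contDiff_snd).mul
      ((contDiff_expChar n).comp contDiff_snd)
  have h1 := hasFDerivAt_setIntegral_of_contDiff (μ := (volume : Measure (Euc g)))
    (isCompact_unitCube g) hFc y
  have h2 : ∀ b x, fderiv ℝ (fun y => F y x) y b =
      hSec (nabla (0, b) φ) (y + (k : ℝ)⁻¹ • intVec n) x * expChar n x := fun b x => by
    have h3 : DifferentiableAt ℝ (fun y => hSec φ (y + (k : ℝ)⁻¹ • intVec n) x) y :=
      (contDiff_hSec φ (a := fun p : Euc g => p + (k : ℝ)⁻¹ • intVec n)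
      (contDiff_id.add contDiff_const) contDiff_const).differentiable (by simp) y
    simp only [hF]
    rw [fderiv_mul_const h3]
    have h4 := fderiv_comp_add_right (𝕜 := ℝ) (f := fun Y => hSec φ Y x) (x := y)
      ((k : ℝ)⁻¹ • intVec n)
    simp only [_root_.smul_apply, h4, fderiv_hSec_left, smul_eq_mul, mul_comm]
  have hint : IntegrableOn (fun x => fderiv ℝ (fun y => F y x) y) (unitCube g) := by
    refine Continuous.continuousOn ?_ |>.integrableOn_compact (isCompact_unitCube g)
    exact (continuous_fderiv_partial hFc).comp (continuous_const.prodMk continuous_id)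
  have h5 : ∀ b, (∫ x in unitCube g, fderiv ℝ (fun y => F y x) y) b =
      coefN (nabla (0, b) φ) n y := fun b => by
    rw [ContinuousLinearMap.integral_apply hint]
    simp only [h2]
    rfl
  have h6 : (∫ x in unitCube g, fderiv ℝ (fun y => F y x) y) =
      ∑ j, (EuclideanSpace.proj (𝕜 := ℝ) j).smulRight
      (coefN (nabla (0, EuclideanSpace.single j 1) φ) n y) := by
    ext b
    conv_lhs => rw [← (EuclideanSpace.basisFun (Fin g) ℝ).sum_repr b]
    rw [map_sum]
    simp [← h5]
  rw [← h6]
  exact h1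

end Coefficients

/-! ### The coefficients are Schwartz functions, continuously in the section -/

section SchwartzCoefficients

variable {g k : ℕ}

lemma seminormBdd_coefN (n : Fin g → ℤ) :
    SeminormBdd (fun (φ : SmoothSection g (-(k : ℤ))) (y : Euc g) => ‖coefN φ n y‖) := by
  obtain ⟨q, hq, hb⟩ := seminormBdd_section_univ (g := g) k
  let c : NNReal := ⟨volume.real (unitCube g), measureReal_nonneg⟩
  refine ⟨c • q, hq.const_smul c, fun φ y => ?_⟩
  have h1 := norm_setIntegral_le_of_norm_le_const (μ := (volume : Measure (Euc g)))
    (f := fun x => hSec φ (y + (k : ℝ)⁻¹ • intVec n) x * expChar n x) (C := q φ)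
    (isCompact_unitCube g).measure_lt_top fun x _ => by
      rw [norm_mul, norm_expChar, mul_one, norm_hSec]; exact hb φ _
  refine h1.trans (le_of_eq ?_)
  rw [mul_comm]
  rfl

lemma norm_le_sum_abs (y : Euc g) : ‖y‖ ≤ ∑ j, |y j| := by
  conv_lhs => rw [← (EuclideanSpace.basisFun (Fin g) ℝ).sum_repr y]
  refine (norm_sum_le _ _).trans (Finset.sum_le_sum fun j _ => ?_)
  simp [norm_smul]

/-- Each factor `‖y‖ ≤ ∑ |y_j|` is paid for by covariant derivatives in the `x` directions, which
act on coefficients as multiplication by `2 π i k y_j`. -/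
lemma seminormBdd_pow_mul_coefN [NeZero k] (n : Fin g → ℤ) (m : ℕ) :
    SeminormBdd (fun (φ : SmoothSection g (-(k : ℤ))) (y : Euc g) =>
      ‖y‖ ^ m * ‖coefN φ n y‖) := by
  have hk : (0 : ℝ) < k := Nat.cast_pos.mpr (NeZero.pos k)
  induction m with
  | zero => simpa using seminormBdd_coefN n
  | succ m ih =>
    have h1 := SeminormBdd.sum Finset.univ fun (j : Fin g) _ =>
      (ih.comp (nabla (k := k) (EuclideanSpace.single j (1 : ℝ), 0))).const_mul
        (c := (2 * Real.pi * k)⁻¹) (by positivity)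
    refine h1.of_le fun φ y => ?_
    have h2 : ∀ j : Fin g, (2 * Real.pi * k)⁻¹ *
        (‖y‖ ^ m * ‖coefN (nabla (EuclideanSpace.single j (1 : ℝ), 0) φ) n y‖) =
        ‖y‖ ^ m * ‖coefN φ n y‖ * |y j| := fun j => by
      rw [coefN_nabla_left, norm_mul, norm_mul, Complex.norm_real, Complex.norm_I,
        Real.norm_eq_abs]
      have : inner ℝ y (EuclideanSpace.single j (1 : ℝ)) = y j := by
        simp [EuclideanSpace.inner_single_right]
      rw [this, abs_mul, abs_of_pos (by positivity : 0 < 2 * Real.pi * k)]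
      field_simp
    simp only [h2]
    rw [← Finset.mul_sum, pow_succ, mul_right_comm]
    exact mul_le_mul_of_nonneg_left (norm_le_sum_abs y) (by positivity)

/-- The vanishing last term puts the derivative into the shape required by
`seminormBdd_iteratedFDeriv`, with `A = 0`. -/
lemma hasFDerivAt_coefN' (n : Fin g → ℤ) (φ : SmoothSection g (-(k : ℤ))) (y : Euc g) :
    HasFDerivAt (coefN φ n) (∑ j, (EuclideanSpace.proj (𝕜 := ℝ) j).smulRight
      (coefN (nabla (0, EuclideanSpace.single j 1) φ) n y) +
        coefN φ n y • (0 : Euc g →L[ℝ] ℂ)) y := by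
  have h : coefN φ n y • (0 : Euc g →L[ℝ] ℂ) = 0 := by ext v; simp
  rw [h, add_zero]
  exact hasFDerivAt_coefN φ n y

lemma seminormBdd_iteratedFDeriv_coefN [NeZero k] (n : Fin g → ℤ) (m r : ℕ) :
    SeminormBdd (fun (φ : SmoothSection g (-(k : ℤ))) (y : Euc g) =>
      ‖y‖ ^ m * ‖iteratedFDeriv ℝ r (coefN φ n) y‖) := by
  refine (seminormBdd_iteratedFDeriv (K := Set.univ) (A := fun _ => 0)
    (Θ := fun φ : SmoothSection g (-(k : ℤ)) => coefN φ n)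
    (D := fun j => nabla (0, EuclideanSpace.single j 1)) (ρ := fun y : Euc g => ‖y‖ ^ m)
    (fun y => by positivity) contDiff_const (fun r => ⟨0, fun x _ => ?_⟩)
    (hasFDerivAt_coefN' n)
    ((seminormBdd_pow_mul_coefN n m).reindex Subtype.val) r).reindex
      (fun y => (⟨y, Set.mem_univ y⟩ : (Set.univ : Set (Euc g))))
  rw [show iteratedFDeriv ℝ r (fun _ : Euc g => (0 : Euc g →L[ℝ] ℂ)) = 0 from
    iteratedFDeriv_fun_zero]
  simp

/-- The Weil–Brezin coefficient as a continuous map to the Schwartz space. -/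
def coefS [NeZero k] (n : Fin g → ℤ) : SmoothSection g (-(k : ℤ)) →L[ℂ] 𝓢(Euc g, ℂ) :=
  let T : SmoothSection g (-(k : ℤ)) →ₗ[ℂ] 𝓢(Euc g, ℂ) :=
    { toFun := fun φ =>
        { toFun := coefN φ n
          smooth' := contDiff_of_hasFDerivAt_family contDiff_const (hasFDerivAt_coefN' n) φ
          decay' := fun m r => by
            obtain ⟨q, -, hb⟩ := seminormBdd_iteratedFDeriv_coefN (g := g) (k := k) n m r
            exact ⟨q φ, hb φ⟩ }
      map_add' := fun φ ψ => by ext y; exact coefN_add φ ψ n y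
      map_smul' := fun c φ => by ext y; exact coefN_smul c φ n y }
  ⟨T, continuous_to_schwartz T fun m r => seminormBdd_iteratedFDeriv_coefN n m r⟩

lemma coefS_apply [NeZero k] (n : Fin g → ℤ) (φ : SmoothSection g (-(k : ℤ))) (y : Euc g) :
    coefS n φ y = coefN φ n y := rfl

end SchwartzCoefficients

/-! ### Summability over lattices -/

section LatticeSums

variable {g : ℕ}

lemma summable_prod_apply {b : ℤ → ℝ} (hb : ∀ n, 0 ≤ b n) (hs : Summable b) (g : ℕ) :
    Summable fun n : Fin g → ℤ => ∏ j, b (n j) := by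
  induction g with
  | zero => exact Summable.of_finite
  | succ g ih =>
    rw [← (Fin.consEquiv fun _ : Fin (g + 1) => ℤ).summable_iff]
    refine (hs.mul_of_nonneg ih hb fun n => Finset.prod_nonneg fun j _ => hb _).congr fun p => ?_
    simp [Fin.prod_univ_succ, Fin.consEquiv]

lemma summable_inv_one_add_abs_sq : Summable fun n : ℤ => (((1 + |(n : ℝ)|) ^ 2)⁻¹ : ℝ) := by
  have h : Summable fun n : ℕ => (((1 + (n : ℝ)) ^ 2)⁻¹ : ℝ) := by
    have := (summable_nat_add_iff 1).mpr (Real.summable_one_div_nat_pow.mpr one_lt_two)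
    refine this.congr fun n => ?_
    push_cast
    rw [one_div, add_comm]
  refine Summable.of_nat_of_neg ?_ ?_ <;> simpa using h

/-- The exponent `2 g` allows comparison with a product of `g` one-dimensional factors of exponent
`2`, each coordinate being at most the norm. -/
lemma summable_lattice {c : ℝ} (hc : 0 < c) :
    Summable fun n : Fin g → ℤ => (((1 + ‖c • intVec n‖) ^ (2 * g))⁻¹ : ℝ) := by
  have h0 : Summable fun n : ℤ => (((1 + |c * (n : ℝ)|) ^ 2)⁻¹ : ℝ) := by
    -- With this `d` one has `d (1 + |n|) ≤ 1 + |c n|`, which reduces the sum to the case `c = 1`.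
    set d := min 1 c
    have hd : 0 < d := lt_min one_pos hc
    refine (summable_inv_one_add_abs_sq.mul_left ((d ^ 2)⁻¹)).of_nonneg_of_le
      (fun n => by positivity) fun n => ?_
    rw [← mul_inv, ← mul_pow]
    refine inv_anti₀ (by positivity) (pow_le_pow_left₀ (by positivity) ?_ 2)
    rw [mul_add, mul_one, abs_mul, abs_of_pos hc]
    exact add_le_add (min_le_left _ _) (mul_le_mul_of_nonneg_right (min_le_right _ _)
      (abs_nonneg _))
  refine (summable_prod_apply (fun n => by positivity) h0 g).of_nonneg_of_le
    (fun n => by positivity) fun n => ?_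
  rw [Finset.prod_inv_distrib, pow_mul]
  refine inv_anti₀ (Finset.prod_pos fun j _ => by positivity) ?_
  calc ∏ j, (1 + |c * (n j : ℝ)|) ^ 2 ≤ ∏ j : Fin g, (1 + ‖c • intVec n‖) ^ 2 := by
        refine Finset.prod_le_prod (fun j _ => by positivity) fun j _ => ?_
        have := PiLp.norm_apply_le (c • intVec n) j
        simp only [PiLp.smul_apply, intVec_apply, smul_eq_mul, Real.norm_eq_abs] at this
        gcongr
    _ = _ := by simp

/-- A Peetre type inequality: decay of a function in `y - z` becomes decay in `z`, uniformly for
bounded `y`. -/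
lemma one_add_norm_le {R : ℝ} {y z : Euc g} (hy : ‖y‖ ≤ R) :
    1 + ‖z‖ ≤ (1 + R) * (1 + ‖y - z‖) := by
  have h1 : ‖z‖ ≤ ‖y‖ + ‖y - z‖ := by
    have := norm_sub_le y (y - z)
    simpa using this
  nlinarith [norm_nonneg (y - z), norm_nonneg y]

end LatticeSums

/-! ### Terms of the Weil–Brezin series -/

section WeilBrezinExpansion

/-- The summable majorant of the Weil–Brezin expansion. -/
def wbWeight (g k : ℕ) (n : Fin g → ℤ) : ℝ := ((1 + ‖(k : ℝ)⁻¹ • intVec n‖) ^ (2 * g))⁻¹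

lemma wbWeight_nonneg {g k : ℕ} (n : Fin g → ℤ) : 0 ≤ wbWeight g k n := by
  unfold wbWeight
  positivity

/-- The connection form of `L ^ (-k)`, up to sign. -/
def connForm (g k : ℕ) : Cover g →L[ℝ] Cover g →L[ℝ] ℂ :=
  -(ContinuousLinearMap.compL ℝ (Cover g) ℝ ℂ (((k * Real.pi : ℝ)) •
    Complex.ofRealCLM.smulRight Complex.I)).comp (omegaL g)

lemma connForm_apply {g k : ℕ} (u w : Cover g) :
    connForm g k u w = -(((k * Real.pi * omega u w : ℝ) : ℂ) * Complex.I) := by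
  simp [connForm, omegaL_apply]
  ring

variable {g k : ℕ} [NeZero k]

/-- The residue modulo `k` of an integer vector. -/
def residue (k : ℕ) [NeZero k] (n : Fin g → ℤ) : Idx g k := fun j =>
  ⟨(n j % k).toNat, by
    have hk : (0 : ℤ) < k := Nat.cast_pos.mpr (NeZero.pos k)
    have h1 := Int.emod_nonneg (n j) hk.ne'
    have h2 := Int.emod_lt_of_pos (n j) hk
    omega⟩

/-- The representative of a residue class. -/
def repr (l : Idx g k) : Fin g → ℤ := fun j => ((l j : ℕ) : ℤ)

lemma residue_repr (l : Idx g k) : residue k (repr l) = l := by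
  funext j
  ext
  simp only [residue, repr]
  rw [← Int.natCast_mod, Int.toNat_natCast, Nat.mod_eq_of_lt (l j).2]

lemma residue_add (n m : Fin g → ℤ) : residue k (n + (k : ℤ) • m) = residue k n := by
  funext j
  ext
  simp [residue]

lemma repr_residue (n : Fin g → ℤ) :
    n = repr (residue k n) + (k : ℤ) • fun j => n j / k := by
  have hk : (0 : ℤ) < k := Nat.cast_pos.mpr (NeZero.pos k)
  funext j
  have h1 := Int.emod_nonneg (n j) hk.ne'
  simp only [residue, repr, Pi.add_apply, Pi.smul_apply, smul_eq_mul, Int.toNat_of_nonneg h1]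
  exact (Int.emod_add_mul_ediv (n j) k).symm

/-- The `n`-th term of the Weil–Brezin expansion of a section of `L ^ (-k)`. -/
def wbTerm (f : Idx g k → 𝓢(Euc g, ℂ)) (n : Fin g → ℤ) (u : Cover g) : ℂ :=
  Complex.exp (((k * Real.pi * inner ℝ u.1 u.2 - 2 * Real.pi * inner ℝ (intVec n) u.1 : ℝ) : ℂ) *
    Complex.I) * f (residue k n) (u.2 - (k : ℝ)⁻¹ • intVec n)

/-- The Weil–Brezin expansion. -/
def wbSum (f : Idx g k → 𝓢(Euc g, ℂ)) (u : Cover g) : ℂ := ∑' n, wbTerm f n u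

lemma norm_wbTerm (f : Idx g k → 𝓢(Euc g, ℂ)) (n : Fin g → ℤ) (u : Cover g) :
    ‖wbTerm f n u‖ = ‖f (residue k n) (u.2 - (k : ℝ)⁻¹ • intVec n)‖ := by
  rw [wbTerm, norm_mul, Complex.norm_exp_ofReal_mul_I, one_mul]

lemma summable_wbWeight : Summable (wbWeight g k) :=
  summable_lattice (inv_pos.mpr (Nat.cast_pos.mpr (NeZero.pos k)))

/-- The `n`-th term is a Schwartz function at `y - n / k` times a phase, so for bounded `y` it
decays in `n` like the chosen weight. This one majorant yields summability, termwise differentiation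
and continuity in the coefficients. -/
lemma exists_norm_wbTerm_le (R : ℝ) : ∃ q : Seminorm ℂ (Idx g k → 𝓢(Euc g, ℂ)), Continuous q ∧
    ∀ f (n : Fin g → ℤ) (u : Cover g), ‖u.2‖ ≤ R → ‖wbTerm f n u‖ ≤ wbWeight g k n * q f := by
  have h1 : SeminormBdd (fun (f : 𝓢(Euc g, ℂ)) (_ : Unit) =>
      2 ^ (2 * g) * (Finset.Iic (2 * g, 0)).sup (fun m => SchwartzMap.seminorm ℂ m.1 m.2) f) := by
    refine SeminormBdd.const_mul ⟨_, ?_, fun f _ => le_rfl⟩ (by positivity)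
    exact ((schwartz_withSeminorms ℂ (Euc g) ℂ).continuous_seminorm |> fun h =>
      Seminorm.continuous_finsetSup (s := Finset.Iic (2 * g, 0)) fun i _ => h i)
  have h2 := (SeminormBdd.sum Finset.univ fun (l : Idx g k) _ =>
    h1.comp (ContinuousLinearMap.proj (R := ℂ) (φ := fun _ : Idx g k => 𝓢(Euc g, ℂ)) l)).const_mul
      (c := (1 + |R|) ^ (2 * g)) (by positivity)
  obtain ⟨q, hq, hb⟩ := h2
  refine ⟨q, hq, fun f n u hu => ?_⟩
  set z := (k : ℝ)⁻¹ • intVec n with hz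
  have h3 := one_add_norm_le (z := z) (hu.trans (le_abs_self R))
  have h4 := SchwartzMap.one_add_le_sup_seminorm_apply (𝕜 := ℂ) (m := (2 * g, 0)) (k := 2 * g)
    (n := 0) le_rfl le_rfl (f (residue k n)) (u.2 - z)
  rw [norm_iteratedFDeriv_zero] at h4
  have h5 := hb f ()
  have h6 : 2 ^ (2 * g) * (Finset.Iic (2 * g, 0)).sup (fun m => SchwartzMap.seminorm ℂ m.1 m.2)
      (f (residue k n)) ≤ ∑ l, 2 ^ (2 * g) * (Finset.Iic (2 * g, 0)).sup
        (fun m => SchwartzMap.seminorm ℂ m.1 m.2) (f l) :=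
    Finset.single_le_sum (f := fun l => 2 ^ (2 * g) * (Finset.Iic (2 * g, 0)).sup
        (fun m => SchwartzMap.seminorm ℂ m.1 m.2) (f l))
      (fun l _ => mul_nonneg (by positivity) (apply_nonneg _ _)) (Finset.mem_univ _)
  rw [norm_wbTerm, wbWeight, ← hz, inv_mul_eq_div, le_div_iff₀ (by positivity)]
  calc ‖f (residue k n) (u.2 - z)‖ * (1 + ‖z‖) ^ (2 * g)
      ≤ ‖f (residue k n) (u.2 - z)‖ * ((1 + |R|) * (1 + ‖u.2 - z‖)) ^ (2 * g) := by gcongr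
    _ = (1 + |R|) ^ (2 * g) * ((1 + ‖u.2 - z‖) ^ (2 * g) * ‖f (residue k n) (u.2 - z)‖) := by
        rw [mul_pow]; ring
    _ ≤ (1 + |R|) ^ (2 * g) * ∑ l, 2 ^ (2 * g) * (Finset.Iic (2 * g, 0)).sup
        (fun m => SchwartzMap.seminorm ℂ m.1 m.2) (f l) :=
        mul_le_mul_of_nonneg_left (h4.trans h6) (by positivity)
    _ ≤ q f := h5

lemma summable_wbTerm (f : Idx g k → 𝓢(Euc g, ℂ)) (u : Cover g) :
    Summable fun n => wbTerm f n u := by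
  obtain ⟨q, -, hb⟩ := exists_norm_wbTerm_le (g := g) (k := k) ‖u.2‖
  exact Summable.of_norm_bounded (summable_wbWeight.mul_right (q f)) fun n => hb f n u le_rfl

/-- The linear form `2 π i k y_j`, as a complex function. -/
def coordMul (k : ℕ) (j : Fin g) : Euc g →L[ℝ] ℂ :=
  ((2 * Real.pi * k) • EuclideanSpace.proj (𝕜 := ℝ) j).smulRight Complex.I

open LineDeriv in
/-- The operators on coefficients that correspond to the covariant derivatives. -/
def wbDeriv (k : ℕ) : Fin g ⊕ Fin g → (Idx g k → 𝓢(Euc g, ℂ)) →L[ℂ] (Idx g k → 𝓢(Euc g, ℂ))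
  | .inl j => ContinuousLinearMap.pi fun l =>
      (SchwartzMap.smulLeftCLM ℂ (coordMul k j)).comp (ContinuousLinearMap.proj l)
  | .inr j => ContinuousLinearMap.pi fun l =>
      (lineDerivOpCLM ℂ 𝓢(Euc g, ℂ) (EuclideanSpace.single j (1 : ℝ))).comp
        (ContinuousLinearMap.proj l)

/-- The coordinates of `ℝ^{2g}`. -/
def coverCoord : Fin g ⊕ Fin g → Cover g →L[ℝ] ℝ
  | .inl j => (EuclideanSpace.proj (𝕜 := ℝ) j).comp (ContinuousLinearMap.fst ℝ (Euc g) (Euc g))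
  | .inr j => (EuclideanSpace.proj (𝕜 := ℝ) j).comp (ContinuousLinearMap.snd ℝ (Euc g) (Euc g))

/-- The differential of the exponent is `2 π i k ᵗ(y - n/k) dx - k π i ω(u, du)`. The first part
depends on `n` only through the argument of the Schwartz function, hence is absorbed into new
coefficients; the second is independent of `n`. So the terms of all expansions form a family closed
under differentiation. -/
lemma hasFDerivAt_wbTerm (f : Idx g k → 𝓢(Euc g, ℂ)) (n : Fin g → ℤ) (u : Cover g) :
    HasFDerivAt (wbTerm f n) (∑ i, (coverCoord i).smulRight (wbTerm (wbDeriv k i f) n u) +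
      wbTerm f n u • connForm g k u) u := by
  have hk : (k : ℂ) ≠ 0 := Nat.cast_ne_zero.mpr (NeZero.ne k)
  set z := (k : ℝ)⁻¹ • intVec n with hz
  have h1 : HasFDerivAt (fun u : Cover g =>
      k * Real.pi * inner ℝ u.1 u.2 - 2 * Real.pi * inner ℝ (intVec n) u.1)
      ((k * Real.pi) • ((innerSL ℝ u.1).comp (ContinuousLinearMap.snd ℝ (Euc g) (Euc g)) +
        (innerSL ℝ u.2).comp (ContinuousLinearMap.fst ℝ (Euc g) (Euc g))) -
        (2 * Real.pi) • (innerSL ℝ (intVec n)).comp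
          (ContinuousLinearMap.fst ℝ (Euc g) (Euc g))) u := by
    have ha : HasFDerivAt (fun u : Cover g => inner ℝ u.1 u.2)
        ((innerSL ℝ u.1).comp (ContinuousLinearMap.snd ℝ (Euc g) (Euc g)) +
        (innerSL ℝ u.2).comp (ContinuousLinearMap.fst ℝ (Euc g) (Euc g))) u := by
      refine ((hasFDerivAt_fst (𝕜 := ℝ) (p := u)).inner ℝ
        (hasFDerivAt_snd (𝕜 := ℝ) (p := u))).congr_fderiv ?_
      ext w <;> simp [real_inner_comm]
    have hb : HasFDerivAt (fun u : Cover g => inner ℝ (intVec n) u.1)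
        ((innerSL ℝ (intVec n)).comp (ContinuousLinearMap.fst ℝ (Euc g) (Euc g))) u :=
      ((innerSL ℝ (intVec n)).comp (ContinuousLinearMap.fst ℝ (Euc g) (Euc g))).hasFDerivAt
    exact (ha.const_mul _).sub (hb.const_mul _)
  have h2 : HasFDerivAt (fun u : Cover g => f (residue k n) (u.2 - z))
      ((fderiv ℝ (f (residue k n)) (u.2 - z)).comp
        (ContinuousLinearMap.snd ℝ (Euc g) (Euc g))) u :=
    ((f (residue k n)).hasFDerivAt (u.2 - z)).comp u (hasFDerivAt_snd.sub_const z)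
  have h3 : HasFDerivAt (wbTerm f n) _ u := (hasFDerivAt_expI h1).mul h2
  refine h3.congr_fderiv ?_
  have hl : ∀ j, wbTerm (wbDeriv k (.inl j) f) n u =
      ((2 * Real.pi * k * (u.2 - z) j : ℝ) : ℂ) * Complex.I * wbTerm f n u := fun j => by
    have : wbDeriv k (.inl j) f (residue k n) (u.2 - z) =
        ((2 * Real.pi * k * (u.2 - z) j : ℝ) : ℂ) * Complex.I * f (residue k n) (u.2 - z) := by
      change SchwartzMap.smulLeftCLM ℂ (coordMul k j) (f (residue k n)) (u.2 - z) = _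
      rw [SchwartzMap.smulLeftCLM_apply_apply (coordMul k j).hasTemperateGrowth]
      simp [coordMul]
    rw [wbTerm, ← hz, this, wbTerm, ← hz]
    ring
  have hr : ∀ j, wbTerm (wbDeriv k (.inr j) f) n u =
      Complex.exp (((k * Real.pi * inner ℝ u.1 u.2 - 2 * Real.pi * inner ℝ (intVec n) u.1 : ℝ) : ℂ)
        * Complex.I) * fderiv ℝ (f (residue k n)) (u.2 - z) (EuclideanSpace.single j 1) :=
    fun j => rfl
  refine ContinuousLinearMap.ext fun w => Eq.symm ?_
  have e1 : ∑ j, w.1 j * (u.2 - z) j = inner ℝ (u.2 - z) w.1 := by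
    simp [PiLp.inner_apply]
  have e2 : ∑ j, (w.2 j : ℂ) * fderiv ℝ (f (residue k n)) (u.2 - z) (EuclideanSpace.single j 1) =
      fderiv ℝ (f (residue k n)) (u.2 - z) w.2 := by
    conv_rhs => rw [← (EuclideanSpace.basisFun (Fin g) ℝ).sum_repr w.2]
    rw [map_sum]
    simp
  have e3 : inner ℝ (u.2 - z) w.1 = inner ℝ u.2 w.1 - (k : ℝ)⁻¹ * inner ℝ (intVec n) w.1 := by
    rw [inner_sub_left, hz, inner_smul_left]
    simp
  have e4 : (∑ i, (coverCoord i).smulRight (wbTerm (wbDeriv k i f) n u)) w =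
      ((2 * Real.pi * k * inner ℝ (u.2 - z) w.1 : ℝ) : ℂ) * Complex.I * wbTerm f n u +
      Complex.exp (((k * Real.pi * inner ℝ u.1 u.2 - 2 * Real.pi * inner ℝ (intVec n) u.1 : ℝ) : ℂ)
        * Complex.I) * fderiv ℝ (f (residue k n)) (u.2 - z) w.2 := by
    rw [Fintype.sum_sum_type, ← e1, ← e2]
    simp only [hl, hr, coverCoord, _root_.add_apply, FunLike.coe_sum,
      Finset.sum_apply, ContinuousLinearMap.smulRight_apply, ContinuousLinearMap.comp_apply,
      Complex.real_smul]
    rw [Finset.mul_sum, Finset.mul_sum, Complex.ofReal_sum, Finset.sum_mul, Finset.sum_mul]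
    congr 1
    · refine Finset.sum_congr rfl fun j _ => ?_
      simp
      ring
    · refine Finset.sum_congr rfl fun j _ => ?_
      simp
      ring
  rw [_root_.add_apply, e4, e3]
  simp only [_root_.smul_apply, connForm_apply, omega_eq_inner, wbTerm, ← hz, _root_.add_apply]
  simp
  field_simp
  ring

end WeilBrezinExpansion

/-! ### The Weil–Brezin isomorphism -/

section WeilBrezinSum

variable {g k : ℕ} [NeZero k]

lemma hasFDerivAt_wbSum (f : Idx g k → 𝓢(Euc g, ℂ)) (u : Cover g) :
    HasFDerivAt (wbSum f) (∑ i, (coverCoord i).smulRight (wbSum (wbDeriv k i f) u) +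
      wbSum f u • connForm g k u) u := by
  -- The majorant is uniform only on bounded sets, so termwise differentiation is carried out in a
  -- ball around the origin that contains `u`.
  set R := ‖u‖ + 1 with hR
  obtain ⟨q, -, hb⟩ := exists_norm_wbTerm_le (g := g) (k := k) R
  have hball : ∀ v ∈ Metric.ball (0 : Cover g) R, ‖v‖ ≤ R := fun v hv =>
    (mem_ball_zero_iff.mp hv).le
  have hu : u ∈ Metric.ball (0 : Cover g) R := mem_ball_zero_iff.mpr (lt_add_one _)
  set C := ∑ i, ‖(coverCoord i : Cover g →L[ℝ] ℝ)‖ * q (wbDeriv k i f) +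
    q f * (‖connForm g k‖ * R) with hC
  have h1 := hasFDerivAt_tsum_of_isPreconnected (u := fun n => wbWeight g k n * C)
    (summable_wbWeight.mul_right C) Metric.isOpen_ball
    (convex_ball (0 : Cover g) R).isPreconnected
    (fun n v (_ : v ∈ Metric.ball (0 : Cover g) R) => hasFDerivAt_wbTerm f n v)
    (fun n v hv => by
      have hv2 : ‖v.2‖ ≤ R := (norm_snd_le v).trans (hball v hv)
      have hw := wbWeight_nonneg (g := g) (k := k) n
      refine (norm_add_le _ _).trans ?_
      rw [hC, mul_add, Finset.mul_sum]
      refine add_le_add ((norm_sum_le _ _).trans (Finset.sum_le_sum fun i _ => ?_)) ?_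
      · rw [ContinuousLinearMap.norm_smulRight_apply, mul_left_comm]
        exact mul_le_mul_of_nonneg_left (hb _ n v hv2) (norm_nonneg _)
      · rw [norm_smul, ← mul_assoc]
        exact mul_le_mul (hb f n v hv2) ((ContinuousLinearMap.le_opNorm _ _).trans
          (mul_le_mul_of_nonneg_left (hball v hv) (norm_nonneg _))) (norm_nonneg _)
          (mul_nonneg hw (apply_nonneg _ _)))
    hu (summable_wbTerm f u) hu
  refine h1.congr_fderiv (HasSum.tsum_eq ?_)
  refine (hasSum_sum fun i _ => ?_).add ((summable_wbTerm f u).hasSum.smul_const _)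
  exact (ContinuousLinearMap.smulRightL ℝ (Cover g) ℂ (coverCoord i)).hasSum
    (summable_wbTerm (wbDeriv k i f) u).hasSum

lemma contDiff_wbSum (f : Idx g k → 𝓢(Euc g, ℂ)) : ContDiff ℝ ∞ (wbSum f) :=
  contDiff_of_hasFDerivAt_family (D := fun i => wbDeriv k i) (connForm g k).contDiff
    hasFDerivAt_wbSum f

/-- Shifting the summation index by `k λ''`, with `λ''` the second half of `λ`, compensates the
translation of `y` in the Schwartz function. What remains is a comparison of exponentials. -/
lemma wbTerm_add_latt (f : Idx g k → 𝓢(Euc g, ℂ)) (l : (Fin g → ℤ) × (Fin g → ℤ))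
    (n : Fin g → ℤ) (u : Cover g) :
    wbTerm f (n + (k : ℤ) • l.2) (u + latt l) = autFactor l u ^ (-(k : ℤ)) * wbTerm f n u := by
  have hk : (k : ℝ) ≠ 0 := Nat.cast_ne_zero.mpr (NeZero.ne k)
  have h0 : latt l = (intVec l.1, intVec l.2) := rfl
  have h1 : (u + latt l).2 - (k : ℝ)⁻¹ • intVec (n + (k : ℤ) • l.2) =
      u.2 - (k : ℝ)⁻¹ • intVec n := by
    ext j
    simp [h0]
    field_simp
    ring
  have hs : inner ℝ (intVec l.1) (intVec l.2) = ((∑ j, l.1 j * l.2 j : ℤ) : ℝ) := by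
    simp [PiLp.inner_apply, mul_comm]
  have hn : inner ℝ (intVec n) (intVec l.1) = ((∑ j, n j * l.1 j : ℤ) : ℝ) := by
    simp [PiLp.inner_apply, mul_comm]
  have hv : intVec (n + (k : ℤ) • l.2) = intVec n + (k : ℝ) • intVec l.2 := by
    ext j; simp
  rw [wbTerm, wbTerm, h1, residue_add, autFactor_zpow_neg, omega_eq_inner, h0, hv]
  simp only [Prod.fst_add, Prod.snd_add, inner_add_left, inner_add_right, inner_smul_left,
    real_inner_comm (intVec l.1) (intVec l.2), hs, hn, real_inner_comm u.1 (intVec l.2),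
    real_inner_comm u.2 (intVec l.1)]
  set N := ∑ j, l.1 j * l.2 j
  set M := ∑ j, n j * l.1 j
  have hsign : ((-1 : ℂ) ^ N) ^ (-(k : ℤ)) = Complex.exp (-(k * N : ℤ) * (Real.pi * Complex.I)) := by
    rw [← zpow_mul, ← Complex.exp_pi_mul_I, ← Complex.exp_int_mul]
    congr 1
    push_cast
    ring
  rw [hsign, ← mul_assoc, ← Complex.exp_add, ← Complex.exp_add]
  congr 1
  rw [Complex.exp_eq_exp_iff_exists_int]
  -- The phases differ by `k π ω(u, λ) - k π N - 2 π M`: the middle term is the sign `α(λ)^(-k)`,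
  -- and the last one is an integral multiple of `2 π`.
  refine ⟨-M, ?_⟩
  push_cast
  simp
  ring

lemma wbSum_add_latt (f : Idx g k → 𝓢(Euc g, ℂ)) (l : (Fin g → ℤ) × (Fin g → ℤ))
    (u : Cover g) : wbSum f (u + latt l) = autFactor l u ^ (-(k : ℤ)) * wbSum f u := by
  rw [wbSum, wbSum, ← tsum_mul_left, ← (Equiv.addRight ((k : ℤ) • l.2)).tsum_eq]
  exact tsum_congr fun n => wbTerm_add_latt f l n u

/-- The Weil–Brezin expansion as a linear map to smooth sections. -/
def wbLM : (Idx g k → 𝓢(Euc g, ℂ)) →ₗ[ℂ] SmoothSection g (-(k : ℤ)) where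
  toFun f := ⟨wbSum f, contDiff_wbSum f, wbSum_add_latt f⟩
  map_add' f h := by
    refine Subtype.ext (funext fun u => ?_)
    change wbSum (f + h) u = wbSum f u + wbSum h u
    rw [wbSum, wbSum, wbSum, ← (summable_wbTerm f u).tsum_add (summable_wbTerm h u)]
    exact tsum_congr fun n => by simp [wbTerm, mul_add]
  map_smul' c f := by
    refine Subtype.ext (funext fun u => ?_)
    change wbSum (c • f) u = c * wbSum f u
    rw [wbSum, wbSum, ← tsum_mul_left]
    exact tsum_congr fun n => by simp [wbTerm, mul_left_comm]

lemma continuous_wbLM : Continuous (wbLM (g := g) (k := k)) := by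
  refine continuous_to_section _ fun r => ?_
  have hK := isCompact_unitSquare g
  obtain ⟨R, hR⟩ := hK.isBounded.exists_norm_le
  obtain ⟨q, hq, hb⟩ := exists_norm_wbTerm_le (g := g) (k := k) R
  have h1 : SeminormBdd (fun (f : Idx g k → 𝓢(Euc g, ℂ))
      (u : (unitCube g ×ˢ unitCube g : Set (Cover g))) => (1 : ℝ) * ‖wbSum f u‖) := by
    have h2 : SeminormBdd (fun (f : Idx g k → 𝓢(Euc g, ℂ))
        (_ : (unitCube g ×ˢ unitCube g : Set (Cover g))) => q f) := ⟨q, hq, fun _ _ => le_rfl⟩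
    refine (h2.const_mul (c := ∑' n, wbWeight g k n)
      (tsum_nonneg wbWeight_nonneg)).of_le fun f u => ?_
    rw [one_mul, ← tsum_mul_right]
    exact tsum_of_norm_bounded (summable_wbWeight.mul_right (q f)).hasSum fun n =>
      hb f n u ((norm_snd_le _).trans (hR u u.2))
  have h3 := seminormBdd_iteratedFDeriv (K := unitCube g ×ˢ unitCube g) (ρ := fun _ => 1)
    (D := wbDeriv k) (fun _ => zero_le_one) (connForm g k).contDiff
    (exists_norm_iteratedFDeriv_le hK (connForm g k).contDiff) hasFDerivAt_wbSum h1 r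
  simp only [one_mul] at h3
  exact h3

/-- The factor `exp (k π i ᵗx y)` common to all terms is removed by the phase in `hSec`, which
leaves a Fourier series in `x`. -/
lemma hSec_wbLM (f : Idx g k → 𝓢(Euc g, ℂ)) (Y x : Euc g) :
    hSec (wbLM f) Y x =
      ∑' n, f (residue k n) (Y - (k : ℝ)⁻¹ • intVec n) * expChar (-n) x := by
  change wbSum f (x, Y) * _ = _
  rw [wbSum, ← tsum_mul_right]
  refine tsum_congr fun n => ?_
  have h : intVec (-n) = -intVec n := by ext j; simp
  rw [wbTerm, mul_right_comm, ← Complex.exp_add, mul_comm, expChar, h, inner_neg_left]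
  congr 2
  push_cast
  ring

/-- Absolute convergence permits integrating the Fourier series term by term, and orthogonality of
characters keeps only the index `repr l`. -/
lemma coefN_wbLM (f : Idx g k → 𝓢(Euc g, ℂ)) (l : Idx g k) (y : Euc g) :
    coefN (wbLM f) (repr l) y = f l y := by
  set Y := y + (k : ℝ)⁻¹ • intVec (repr l) with hY
  set F : (Fin g → ℤ) → Euc g → ℂ := fun n x =>
    f (residue k n) (Y - (k : ℝ)⁻¹ • intVec n) * (expChar (repr l - n) x) with hF
  have h1 : ∀ x, hSec (wbLM f) Y x * expChar (repr l) x = ∑' n, F n x := fun x => by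
    rw [hSec_wbLM, ← tsum_mul_right]
    refine tsum_congr fun n => ?_
    rw [hF, mul_assoc, ← expChar_add, neg_add_eq_sub]
  have hint : ∀ n, IntegrableOn (F n) (unitCube g) := fun n =>
    ((contDiff_expChar _).continuous.const_mul _).continuousOn.integrableOn_compact
      (isCompact_unitCube g)
  have hnorm : ∀ n x, ‖F n x‖ = ‖f (residue k n) (Y - (k : ℝ)⁻¹ • intVec n)‖ := fun n x => by
    rw [hF, norm_mul, norm_expChar, mul_one]
  have hsum : Summable fun n => ‖f (residue k n) (Y - (k : ℝ)⁻¹ • intVec n)‖ :=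
    (summable_wbTerm f (0, Y)).norm.congr fun n => norm_wbTerm f n (0, Y)
  have h2 := hasSum_integral_of_summable_integral_norm hint (by
    simp only [hnorm, integral_const]
    exact hsum.const_smul _)
  simp only [← h1] at h2
  rw [coefN, ← hY]
  refine h2.unique ?_
  have h3 : ∀ n, ∫ x in unitCube g, F n x = if n = repr l then f l y else 0 := fun n => by
    rw [hF, integral_const_mul]
    simp only [expChar]
    rw [setIntegral_cube_exp]
    by_cases hn : n = repr l
    · subst hn
      simp [residue_repr, hY]
    · rw [if_neg hn, if_neg (fun h => hn (sub_eq_zero.mp h).symm), mul_zero]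
  simp only [h3]
  exact hasSum_ite_eq _ _

lemma coefN_eq_residue (φ : SmoothSection g (-(k : ℤ))) (n : Fin g → ℤ) :
    coefN φ n = coefN φ (repr (residue k n)) := by
  funext y
  conv_lhs => rw [repr_residue (k := k) n]
  exact coefN_add_smul φ _ _ y

/-- This is Fourier inversion in `x` at fixed `y`. The required summability is already known, since
the Fourier coefficients are values of Schwartz functions at lattice translates. -/
lemma wbLM_coefS (φ : SmoothSection g (-(k : ℤ))) :
    wbLM (fun l => coefS (repr l) φ) = φ := by
  refine Subtype.ext (funext fun u => ?_)
  change wbSum (fun l => coefS (repr l) φ) u = φ u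
  set f : Idx g k → 𝓢(Euc g, ℂ) := fun l => coefS (repr l) φ with hf
  have h1 : ∀ n : Fin g → ℤ, ∫ x in unitCube g, hSec φ u.2 x *
      Complex.exp (((2 * Real.pi * inner ℝ (intVec n) x : ℝ) : ℂ) * Complex.I) =
      f (residue k n) (u.2 - (k : ℝ)⁻¹ • intVec n) := fun n => by
    rw [hf, coefS_apply, ← coefN_eq_residue, coefN, sub_add_cancel]
    rfl
  have h2 := hasSum_fourier_of_periodic (h := hSec φ u.2) (hSec_add_intVec φ u.2)
    (contDiff_hSec φ contDiff_const contDiff_id).continuous (by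
      simp only [h1]
      exact ((summable_wbTerm f u).norm.congr fun n => norm_wbTerm f n u).of_norm) u.1
  simp only [h1] at h2
  have h3 := h2.mul_right (Complex.exp (((k * Real.pi * inner ℝ u.1 u.2 : ℝ) : ℂ) * Complex.I))
  have h4 : hSec φ u.2 u.1 * Complex.exp (((k * Real.pi * inner ℝ u.1 u.2 : ℝ) : ℂ) * Complex.I)
      = φ u := by
    rw [hSec, mul_assoc, ← Complex.exp_add, ← add_mul, ← Complex.ofReal_add]
    simp
  rw [h4] at h3
  refine (h3.congr_fun fun n => ?_).tsum_eq
  rw [wbTerm, mul_assoc (f (residue k n) _), ← Complex.exp_add, mul_comm]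
  congr 2
  push_cast
  ring

/-- The Weil–Brezin expansion of smooth sections, as a topological isomorphism. -/
def wbEquiv : SmoothSection g (-(k : ℤ)) ≃L[ℂ] (Idx g k → 𝓢(Euc g, ℂ)) :=
  ContinuousLinearEquiv.equivOfInverse
    (ContinuousLinearMap.pi fun l => coefS (repr l)) ⟨wbLM, continuous_wbLM⟩
    wbLM_coefS (fun f => funext fun l => by ext y; exact coefN_wbLM f l y)

lemma wbEquiv_apply (φ : SmoothSection g (-(k : ℤ))) (l : Idx g k) (y : Euc g) :
    wbEquiv φ l y = star (wbCoeff (fun u => star (φ u)) l y) := by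
  change coefN φ (repr l) y = _
  rw [coefN, wbCoeff, Complex.star_def, ← integral_conj]
  congr 1
  funext x
  have h1 : y + (k : ℝ)⁻¹ • intVec (repr l) = y + WithLp.toLp 2 fun j => ((l j : ℕ) : ℝ) / k := by
    ext j
    simp [repr, div_eq_inv_mul]
  have h2 : inner ℝ x (y + WithLp.toLp 2 fun j => ((l j : ℕ) : ℝ) / k) =
      ∑ j, x j * (y j + ((l j : ℕ) : ℝ) / k) := by
    simp [PiLp.inner_apply, mul_comm]
  have h3 : inner ℝ (intVec (repr l)) x = ∑ j, ((l j : ℕ) : ℝ) * x j := by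
    simp [PiLp.inner_apply, repr, mul_comm]
  rw [h1, hSec, expChar, h2, h3, map_mul, map_mul, ← Complex.exp_conj, ← Complex.exp_conj]
  simp only [Complex.conj_conj, map_mul, map_neg, Complex.conj_I,
    Complex.conj_ofReal, map_natCast, map_ofNat]
  congr 2
  · congr 1
    push_cast
    ring
  · push_cast
    ring

/-- The Weil–Brezin isomorphism of distributional sections. -/
def wbDist : DistSection g k ≃L[ℂ] (Idx g k → 𝓢'(Euc g, ℂ)) :=
  ContinuousLinearEquiv.equivOfInverse
    (ContinuousLinearMap.pi fun l => PointwiseConvergenceCLM.precomp ℂ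
      (wbEquiv.symm.toContinuousLinearMap.comp
        (ContinuousLinearMap.single ℂ (fun _ : Idx g k => 𝓢(Euc g, ℂ)) l)))
    (∑ l, (PointwiseConvergenceCLM.precomp ℂ
      ((ContinuousLinearMap.proj l).comp wbEquiv.toContinuousLinearMap)).comp
        (ContinuousLinearMap.proj l))
    (fun σ => by
      ext φ
      rw [_root_.sum_apply, _root_.sum_apply]
      change ∑ l, σ (wbEquiv.symm (Pi.single l (wbEquiv φ l))) = σ φ
      rw [← map_sum, ← map_sum, Finset.univ_sum_single, wbEquiv.symm_apply_apply])
    (fun τ => by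
      funext l
      ext f
      rw [_root_.sum_apply, ContinuousLinearMap.pi_apply]
      change (∑ j, (PointwiseConvergenceCLM.precomp ℂ ((ContinuousLinearMap.proj j).comp
        (wbEquiv (g := g) (k := k)).toContinuousLinearMap)) (τ j) : DistSection g k)
          (wbEquiv.symm (Pi.single l f)) = τ l f
      rw [_root_.sum_apply]
      change ∑ j, τ j (wbEquiv (wbEquiv.symm (Pi.single l f)) j) = τ l f
      rw [wbEquiv.apply_symm_apply, Finset.sum_eq_single l]
      · rw [Pi.single_eq_same]
      · intro j _ hj
        rw [Pi.single_eq_of_ne hj, map_zero]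
      · simp)

lemma wbDist_apply (σ : DistSection g k) (l : Idx g k) (f : 𝓢(Euc g, ℂ)) :
    wbDist σ l f = σ (wbEquiv.symm (Pi.single l f)) := rfl

theorem existsUnique_weilBrezin :
    ∃! W : DistSection g k ≃L[ℂ] (Idx g k → 𝓢'(Euc g, ℂ)), IsWeilBrezin W := by
  refine ⟨wbDist, fun σ φ f hf => ?_, fun W hW => ?_⟩
  · have h1 : f = wbEquiv φ := funext fun l => by
      ext y
      rw [hf, wbEquiv_apply]
    subst h1
    simp only [wbDist_apply]
    rw [← map_sum, ← map_sum, Finset.univ_sum_single, wbEquiv.symm_apply_apply]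
  · refine ContinuousLinearEquiv.ext (funext fun σ => funext fun l => ?_)
    ext f
    -- The section with a single nonzero coefficient `f` in position `l` isolates `W σ l f`, so the
    -- defining identity leaves no freedom.
    have h1 := hW σ (wbEquiv.symm (Pi.single l f)) (Pi.single l f) fun j y => by
      rw [← wbEquiv_apply, wbEquiv.apply_symm_apply]
    rw [wbDist_apply, h1, Finset.sum_eq_single l]
    · rw [Pi.single_eq_same]
    · intro j _ hj
      rw [Pi.single_eq_of_ne hj, map_zero]
    · simp

end WeilBrezinSum

/-! ### Gaussians are Schwartz functions -/

section Gaussian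

variable {g : ℕ}

/-- Combine `(1 + t)^N ≤ N! exp (1 + t)` with `t ≤ c t² + 1/c`. -/
lemma exists_pow_mul_exp_le (c : ℝ) (hc : 0 < c) (N : ℕ) :
    ∃ C, ∀ t : ℝ, 0 ≤ t → (1 + t) ^ N * Real.exp (-(c * t ^ 2)) ≤ C := by
  refine ⟨N.factorial * Real.exp (1 + 1 / c), fun t ht => ?_⟩
  have h1 := Real.pow_div_factorial_le_exp (1 + t) (by linarith) N
  rw [div_le_iff₀ (by positivity)] at h1
  have h2 : t ≤ c * t ^ 2 + 1 / c := by
    have h3 : c * t ^ 2 + 1 / c - t = (c * t - 1 / 2) ^ 2 / c + 3 / (4 * c) := by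
      field_simp
      ring
    have h4 : 0 ≤ (c * t - 1 / 2) ^ 2 / c + 3 / (4 * c) := by positivity
    linarith
  calc (1 + t) ^ N * Real.exp (-(c * t ^ 2))
      ≤ Real.exp (1 + t) * N.factorial * Real.exp (-(c * t ^ 2)) := by gcongr
    _ = N.factorial * Real.exp (1 + t - c * t ^ 2) := by
        rw [sub_eq_add_neg, Real.exp_add (1 + t)]
        ring
    _ ≤ N.factorial * Real.exp (1 + 1 / c) := by
        gcongr
        linarith

/-- The Gaussian `exp (-c |x|²)` as a Schwartz function. -/
def gaussS (g : ℕ) (c : ℝ) (hc : 0 < c) : 𝓢(Euc g, ℂ) where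
  toFun x := (Real.exp (-(c * ‖x‖ ^ 2)) : ℂ)
  smooth' := Complex.ofRealCLM.contDiff.comp
    (Real.contDiff_exp.comp (contDiff_const.mul (contDiff_norm_sq ℝ)).neg)
  decay' m n := by
    set q : Euc g → ℝ := fun x => -(c * ‖x‖ ^ 2) with hq
    have hqt : q.HasTemperateGrowth := by
      have : q = fun x : Euc g => ∑ i, (-c) * (x i * x i) := by
        funext x
        change -(c * ‖x‖ ^ 2) = _
        rw [← Finset.mul_sum, EuclideanSpace.norm_sq_eq]
        simp [sq]
      rw [this]
      refine Function.HasTemperateGrowth.sum fun i _ => ?_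
      have hi : (fun u : Euc g => u i).HasTemperateGrowth :=
        (EuclideanSpace.proj (𝕜 := ℝ) i).hasTemperateGrowth
      exact (Function.HasTemperateGrowth.const _).mul (hi.mul hi)
    obtain ⟨k, C, hC, hb⟩ := hqt.norm_iteratedFDeriv_le_uniform n
    -- The `n`-th derivative of `exp ∘ q` is bounded by `n! exp (q x) D^n` with `D` of degree `k` in
    -- `1 + ‖x‖`; together with the weight `‖x‖^m` this requires the power `m + k n`.
    obtain ⟨B, hB⟩ := exists_pow_mul_exp_le c hc (m + k * n)
    refine ⟨n.factorial * (C + 1) ^ n * B, fun x => ?_⟩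
    -- The summand `1` ensures `D ≥ 1`, so that `D` bounds the derivatives of `q` also in the form
    -- `D ^ i` for `i ≥ 1`.
    set D := (C + 1) * (1 + ‖x‖) ^ k with hD
    have hx1 : 1 ≤ (1 + ‖x‖) ^ k := one_le_pow₀ (by linarith [norm_nonneg x])
    have hD1 : 1 ≤ D := by nlinarith
    have h1 : ‖iteratedFDeriv ℝ n (Real.exp ∘ q) x‖ ≤ n.factorial * Real.exp (q x) * D ^ n := by
      refine norm_iteratedFDeriv_comp_le Real.contDiff_exp hqt.1 (N := ∞)
        (by exact_mod_cast le_top) x (fun i _ => ?_) (fun i hi hin => ?_)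
      · rw [norm_iteratedFDeriv_eq_norm_iteratedDeriv, iteratedDeriv_eq_iterate, Real.iter_deriv_exp]
        simp
      · refine (hb i hin x).trans (le_trans ?_ (le_self_pow₀ hD1 (by omega)))
        rw [hD]
        gcongr
        linarith
    have h2 : ‖iteratedFDeriv ℝ n (fun x => (Real.exp (-(c * ‖x‖ ^ 2)) : ℂ)) x‖ ≤
        ‖iteratedFDeriv ℝ n (Real.exp ∘ q) x‖ :=
      le_of_eq (Complex.ofRealLI.norm_iteratedFDeriv_comp_left
        ((Real.contDiff_exp.comp hqt.1).contDiffAt (n := ∞)) (by exact_mod_cast le_top))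
    calc ‖x‖ ^ m * ‖iteratedFDeriv ℝ n (fun x => (Real.exp (-(c * ‖x‖ ^ 2)) : ℂ)) x‖
        ≤ (1 + ‖x‖) ^ m * (n.factorial * Real.exp (q x) * D ^ n) := by
          refine mul_le_mul ?_ (h2.trans h1) (norm_nonneg _) (by positivity)
          gcongr
          linarith
      _ = n.factorial * (C + 1) ^ n * ((1 + ‖x‖) ^ (m + k * n) * Real.exp (-(c * ‖x‖ ^ 2))) := by
          rw [hD, mul_pow, ← pow_mul, pow_add, hq]
          ring
      _ ≤ n.factorial * (C + 1) ^ n * B := by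
          gcongr
          exact hB _ (norm_nonneg x)

lemma gaussS_apply (c : ℝ) (hc : 0 < c) (x : Euc g) :
    gaussS g c hc x = (Real.exp (-(c * ‖x‖ ^ 2)) : ℂ) := rfl

lemma gaussS_ne_zero (c : ℝ) (hc : 0 < c) (x : Euc g) : gaussS g c hc x ≠ 0 := by
  rw [gaussS_apply]
  exact Complex.ofReal_ne_zero.mpr (Real.exp_pos _).ne'

end Gaussian

/-! ### Weyl operators and their conjugation by generators -/

section WeylOperators

variable {g k : ℕ}

/-- The first half of a vector of `ℝ^{2g}`. -/
def topPart (z : Fin g ⊕ Fin g → ℝ) : Euc g := WithLp.toLp 2 (z ∘ Sum.inl)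

/-- The second half of a vector of `ℝ^{2g}`. -/
def botPart (z : Fin g ⊕ Fin g → ℝ) : Euc g := WithLp.toLp 2 (z ∘ Sum.inr)

/-- The phase of the Weyl operator. -/
def weylPhase (k : ℕ) (b a x : Euc g) : ℝ :=
  2 * Real.pi * k * (inner ℝ b x - inner ℝ b a / 2)

lemma expI_weylPhase_hasTemperateGrowth (k : ℕ) (b a : Euc g) :
    (fun x => Complex.exp ((weylPhase k b a x : ℂ) * Complex.I)).HasTemperateGrowth := by
  have h : (weylPhase k b a).HasTemperateGrowth :=
    (Function.HasTemperateGrowth.const (2 * Real.pi * k)).mul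
      ((innerSL ℝ b).hasTemperateGrowth.sub (Function.HasTemperateGrowth.const _))
  exact expI_hasTemperateGrowth.comp h

/-- The Weyl operator `f ↦ exp (2 π i k (ᵗb x - ᵗb a / 2)) f (x - a)`. -/
def weyl (k : ℕ) (b a : Euc g) : 𝓢(Euc g, ℂ) →L[ℂ] 𝓢(Euc g, ℂ) :=
  (SchwartzMap.smulLeftCLM ℂ fun x => Complex.exp ((weylPhase k b a x : ℂ) * Complex.I)).comp
    (SchwartzMap.compSubConstCLM ℂ a)

lemma weyl_apply (b a : Euc g) (f : 𝓢(Euc g, ℂ)) (x : Euc g) :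
    weyl k b a f x = Complex.exp ((weylPhase k b a x : ℂ) * Complex.I) * f (x - a) := by
  rw [weyl, ContinuousLinearMap.comp_apply,
    SchwartzMap.smulLeftCLM_apply_apply (expI_weylPhase_hasTemperateGrowth k b a), smul_eq_mul,
    SchwartzMap.compSubConstCLM_apply]

lemma inner_toLp (u v : Fin g → ℝ) : inner ℝ (WithLp.toLp 2 u) (WithLp.toLp 2 v) = u ⬝ᵥ v := by
  simp [PiLp.inner_apply, dotProduct, mul_comm]

/-- A matrix acting on Euclidean space. -/
def matVec (A : Matrix (Fin g) (Fin g) ℝ) (u : Euc g) : Euc g := WithLp.toLp 2 (A *ᵥ u.ofLp)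

lemma inner_eq_dotProduct (u v : Euc g) : inner ℝ u v = u.ofLp ⬝ᵥ v.ofLp := inner_toLp _ _

lemma inner_matVec (A : Matrix (Fin g) (Fin g) ℝ) (u v : Euc g) :
    inner ℝ u (matVec A v) = inner ℝ (matVec Aᵀ u) v := by
  simp only [inner_eq_dotProduct, matVec]
  rw [Matrix.dotProduct_mulVec, Matrix.mulVec_transpose]

lemma matVec_sub (A : Matrix (Fin g) (Fin g) ℝ) (u v : Euc g) :
    matVec A (u - v) = matVec A u - matVec A v := by
  simp [matVec, Matrix.mulVec_sub]

lemma matVec_matVec (A B : Matrix (Fin g) (Fin g) ℝ) (u : Euc g) :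
    matVec A (matVec B u) = matVec (A * B) u := by
  simp [matVec, Matrix.mulVec_mulVec]

lemma matVec_one (u : Euc g) : matVec 1 u = u := by simp [matVec]

lemma quad_eq_inner (P : Matrix (Fin g) (Fin g) ℝ) (u : Euc g) :
    quad P u = inner ℝ u (matVec P u) := by
  rw [inner_eq_dotProduct]; rfl

lemma quad_sub {P : Matrix (Fin g) (Fin g) ℝ} (hP : P.IsSymm) (x a : Euc g) :
    quad P (x - a) = quad P x - 2 * inner ℝ (matVec P a) x + inner ℝ (matVec P a) a := by
  have h1 : inner ℝ x (matVec P a) = inner ℝ (matVec P a) x := real_inner_comm _ _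
  have h2 : inner ℝ a (matVec P x) = inner ℝ (matVec P a) x := by rw [inner_matVec, hP.eq]
  have h3 : inner ℝ a (matVec P a) = inner ℝ (matVec P a) a := real_inner_comm _ _
  simp only [quad_eq_inner, matVec_sub, inner_sub_left, inner_sub_right, h1, h2, h3]
  ring

/-- The difference `quad P x - quad P (x - a)` equals `2 ᵗ(P a) x - ᵗ(P a) a`. This is exactly the
change of the phase when `b` becomes `b + P a`; the term `-ᵗb a / 2` in the phase is there so that
no scalar is left over. -/
lemma chirp_weyl {P : Matrix (Fin g) (Fin g) ℝ} (hP : P.IsSymm) (b a : Euc g) (f : 𝓢(Euc g, ℂ)) :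
    chirpCLE k P (weyl k b a f) = weyl k (b + matVec P a) a (chirpCLE k P f) := by
  ext x
  rw [chirpCLE_apply, weyl_apply, weyl_apply, chirpCLE_apply, chirp, chirp, ← mul_assoc,
    ← mul_assoc, ← Complex.exp_add, ← Complex.exp_add, quad_sub hP]
  congr 2
  simp only [weylPhase, inner_add_left]
  push_cast
  ring

lemma fourier_weyl (b a : Euc g) (f : 𝓢(Euc g, ℂ)) (w : Euc g) :
    𝓕 (weyl k b a f) w = Complex.exp (((-(2 * Real.pi * (inner ℝ a w - k * inner ℝ b a / 2)) : ℝ) :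
      ℂ) * Complex.I) * 𝓕 f (w - (k : ℝ) • b) := by
  rw [SchwartzMap.fourier_coe, SchwartzMap.fourier_coe, Real.fourier_eq', Real.fourier_eq',
    ← integral_const_mul, ← integral_add_right_eq_self _ a]
  congr 1
  funext v
  rw [weyl_apply, add_sub_cancel_right, smul_eq_mul, smul_eq_mul, ← mul_assoc, ← mul_assoc,
    ← Complex.exp_add, ← Complex.exp_add]
  congr 2
  simp only [weylPhase, inner_add_left, inner_sub_right, inner_add_right, inner_smul_right,
    real_inner_comm a b, real_inner_comm v b]
  push_cast
  ring

/-- The factors of the generator act in turn: the chirp of `Q` adds `Q a` to `b`, the Fourier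
transform followed by the substitution `k L u` exchanges translation and modulation, and the chirp
of `P` adds `P` times the new translation. The symmetric normalization makes all constants cancel.
-/
lemma genS_weyl [NeZero k] (D : GenData g) (b a : Euc g) (f : 𝓢(Euc g, ℂ)) :
    genS k D (weyl k b a f) =
      weyl k (-matVec D.Lᵀ a + matVec D.P (matVec D.L⁻¹ (b + matVec D.Q a)))
        (matVec D.L⁻¹ (b + matVec D.Q a)) (genS k D f) := by
  ext u
  have hL : matVec D.L (matVec D.L⁻¹ (b + matVec D.Q a)) = b + matVec D.Q a := by
    rw [matVec_matVec, Matrix.mul_nonsing_inv _ D.isUnit_L, matVec_one]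
  set c := b + matVec D.Q a with hc
  set d := matVec D.L⁻¹ c with hd
  have hk : ∀ v : Euc g, WithLp.toLp 2 (((k : ℝ) • D.L) *ᵥ v.ofLp) = (k : ℝ) • matVec D.L v :=
    fun v => by simp [matVec, Matrix.smul_mulVec]
  rw [genS_apply_fourier, weyl_apply, genS_apply_fourier, chirp_weyl D.symm_Q, fourier_weyl, hk, hk,
    matVec_sub, hL, smul_sub, ← hc, chirp, chirp, quad_sub D.symm_P]
  have e1 : inner ℝ (matVec D.Lᵀ a) u = inner ℝ a (matVec D.L u) := (inner_matVec _ _ _).symm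
  have e2 : inner ℝ (matVec D.Lᵀ a) d = inner ℝ c a := by
    rw [← inner_matVec, hL, real_inner_comm]
  have e3 : ((k * Real.pi * quad D.P u : ℝ) : ℂ) * Complex.I +
      ((-(2 * Real.pi * (inner ℝ a ((k : ℝ) • matVec D.L u) - k * inner ℝ c a / 2)) : ℝ) : ℂ) *
        Complex.I = ((weylPhase k (-matVec D.Lᵀ a + matVec D.P d) d u : ℝ) : ℂ) * Complex.I +
      ((k * Real.pi * (quad D.P u - 2 * inner ℝ (matVec D.P d) u + inner ℝ (matVec D.P d) d) : ℝ) :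
        ℂ) * Complex.I := by
    simp only [weylPhase, inner_add_left, inner_neg_left, e1, e2, inner_smul_right]
    push_cast
    ring
  have e4 := congrArg Complex.exp e3
  rw [Complex.exp_add, Complex.exp_add] at e4
  linear_combination (genConst k D *
    𝓕 (chirpCLE k D.Q f) ((k : ℝ) • matVec D.L u - (k : ℝ) • c)) * e4

lemma weyl_injective [NeZero k] {b a b' a' : Euc g} (h : weyl k b a = weyl k b' a') :
    b = b' ∧ a = a' := by
  have hk : (0 : ℝ) < k := Nat.cast_pos.mpr (NeZero.pos k)
  have h1 : ∀ x, Complex.exp ((weylPhase k b a x : ℂ) * Complex.I) * gaussS g 1 one_pos (x - a) =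
      Complex.exp ((weylPhase k b' a' x : ℂ) * Complex.I) * gaussS g 1 one_pos (x - a') := fun x => by
    rw [← weyl_apply, ← weyl_apply, h]
  have ha : a = a' := by
    -- At `x = a` the left Gaussian attains its maximum, which the right one attains only at `a'`.
    have h2 := congrArg norm (h1 a)
    rw [norm_mul, norm_mul, Complex.norm_exp_ofReal_mul_I, Complex.norm_exp_ofReal_mul_I,
      gaussS_apply, gaussS_apply, Complex.norm_real, Complex.norm_real, Real.norm_eq_abs,
      Real.norm_eq_abs, Real.abs_exp, Real.abs_exp] at h2
    simpa [sub_eq_zero, eq_comm (a := (1 : ℝ)), Real.exp_eq_one_iff] using h2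
  subst ha
  refine ⟨?_, rfl⟩
  by_contra hb
  have hd : 0 < ‖b - b'‖ ^ 2 := by
    have := norm_pos_iff.mpr (sub_ne_zero.mpr hb)
    positivity
  -- Equality of the phases modulo `2 π` makes an affine function of `x` integer valued, which is
  -- impossible unless its linear part `b - b'` vanishes.
  have h2 : ∀ x, ∃ n : ℤ, (k : ℝ) * (inner ℝ (b - b') x - inner ℝ (b - b') a / 2) = n := fun x => by
    have h3 := mul_right_cancel₀ (gaussS_ne_zero 1 one_pos _) (h1 x)
    rw [Complex.exp_eq_exp_iff_exists_int] at h3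
    obtain ⟨n, hn⟩ := h3
    refine ⟨n, ?_⟩
    have h4 : ((weylPhase k b a x : ℝ) : ℂ) = ((weylPhase k b' a x + n * (2 * Real.pi) : ℝ) : ℂ) := by
      have := mul_right_cancel₀ Complex.I_ne_zero
        (hn.trans (by push_cast; ring : _ = ((weylPhase k b' a x + n * (2 * Real.pi) : ℝ) : ℂ) *
          Complex.I))
      exact this
    have h5 := Complex.ofReal_injective h4
    simp only [weylPhase] at h5
    have h6 : 2 * Real.pi * (k * (inner ℝ (b - b') x - inner ℝ (b - b') a / 2)) =
        2 * Real.pi * n := by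
      rw [inner_sub_left, inner_sub_left]
      linarith
    exact mul_left_cancel₀ (by positivity) h6
  obtain ⟨n, hn⟩ := h2 0
  -- This vector is chosen so that the affine function grows by `1/2` from the origin to it.
  obtain ⟨m, hm⟩ := h2 ((1 / (2 * k * ‖b - b'‖ ^ 2)) • (b - b'))
  rw [inner_smul_right, real_inner_self_eq_norm_sq] at hm
  rw [inner_zero_right] at hn
  have h7 : (k : ℝ) * (1 / (2 * k * ‖b - b'‖ ^ 2) * ‖b - b'‖ ^ 2) = 1 / 2 := by
    have h10 : ‖b - b'‖ ≠ 0 := norm_ne_zero_iff.mpr (sub_ne_zero.mpr hb)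
    field_simp
  have h8 : (2 * (m - n) : ℝ) = 1 := by linarith
  have h9 : 2 * (m - n) = 1 := by exact_mod_cast h8
  omega

end WeylOperators

/-! ### Symplectic block relations and matrices of generators -/

section Symplectic

variable {g : ℕ}

lemma mem_symplectic_iff_blocks (a b c d : Matrix (Fin g) (Fin g) ℝ) :
    Matrix.fromBlocks a b c d ∈ Matrix.symplecticGroup (Fin g) ℝ ↔
      aᵀ * c = cᵀ * a ∧ aᵀ * d - cᵀ * b = 1 ∧ bᵀ * d = dᵀ * b := by
  rw [SymplecticGroup.mem_iff', Matrix.J, Matrix.fromBlocks_transpose, Matrix.fromBlocks_multiply,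
    Matrix.fromBlocks_multiply, Matrix.fromBlocks_inj]
  simp only [Matrix.mul_zero, Matrix.mul_one, Matrix.mul_neg, zero_add, add_zero, Matrix.neg_mul]
  constructor
  · rintro ⟨h1, h2, h3, h4⟩
    refine ⟨?_, ?_, ?_⟩
    · rw [← sub_eq_zero, ← neg_eq_zero, ← h1]; abel
    · rw [← neg_inj, ← h2]; abel
    · rw [← sub_eq_zero, ← neg_eq_zero, ← h4]; abel
  · rintro ⟨h1, h2, h3⟩
    refine ⟨?_, ?_, ?_, ?_⟩
    · rw [h1]; abel
    · rw [← h2]; abel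
    · have := congrArg Matrix.transpose h2
      simp only [Matrix.transpose_sub, Matrix.transpose_mul, Matrix.transpose_transpose,
        Matrix.transpose_one] at this
      rw [← this]; abel
    · rw [h3]; abel

/-- The third relation is the one for the transpose, which is symplectic too. -/
lemma sp_blocks (M : Sp g) :
    M.1.toBlocks₁₁ᵀ * M.1.toBlocks₂₁ = M.1.toBlocks₂₁ᵀ * M.1.toBlocks₁₁ ∧
      M.1.toBlocks₁₁ᵀ * M.1.toBlocks₂₂ - M.1.toBlocks₂₁ᵀ * M.1.toBlocks₁₂ = 1 ∧
      M.1.toBlocks₂₁ * M.1.toBlocks₂₂ᵀ = M.1.toBlocks₂₂ * M.1.toBlocks₂₁ᵀ := by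
  have h := M.2
  have ht := SymplecticGroup.transpose_mem M.2
  rw [← Matrix.fromBlocks_toBlocks M.1] at h ht
  rw [Matrix.fromBlocks_transpose] at ht
  rw [mem_symplectic_iff_blocks] at h ht
  refine ⟨h.1, h.2.1, ?_⟩
  simpa using ht.2.2

/-- The symplectic matrix of the generator `S(P, L, Q)_m`. -/
def genMat (D : GenData g) : Sp g :=
  ⟨Matrix.fromBlocks (D.P * D.L⁻¹) (D.P * D.L⁻¹ * D.Q - D.Lᵀ) D.L⁻¹ (D.L⁻¹ * D.Q), by
    have h1 : D.L⁻¹ * D.L = 1 := Matrix.nonsing_inv_mul _ D.isUnit_L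
    have h2 : D.Lᵀ * D.L⁻¹ᵀ = 1 := by rw [← Matrix.transpose_mul, h1, Matrix.transpose_one]
    have h3 : D.L⁻¹ᵀ * D.Lᵀ = 1 := by
      rw [← Matrix.transpose_mul, Matrix.mul_nonsing_inv _ D.isUnit_L, Matrix.transpose_one]
    have h4 : D.L * D.L⁻¹ = 1 := Matrix.mul_nonsing_inv _ D.isUnit_L
    have hP := D.symm_P.eq
    have hQ := D.symm_Q.eq
    rw [mem_symplectic_iff_blocks]
    simp only [Matrix.transpose_mul, Matrix.transpose_sub, hP, hQ, Matrix.transpose_transpose,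
      Matrix.mul_sub, Matrix.sub_mul, Matrix.mul_assoc, h3]
    refine ⟨trivial, by abel, ?_⟩
    rw [← Matrix.mul_assoc D.L, h4, Matrix.one_mul, Matrix.mul_one]⟩

lemma exists_sq_eq_sign {x : ℝ} (hx : x ≠ 0) :
    ∃ m : ℤ, (Complex.I ^ m) ^ 2 = ((SignType.sign x : ℝ) : ℂ) := by
  rcases lt_or_gt_of_ne hx with h | h
  · exact ⟨1, by simp [sign_neg h]⟩
  · exact ⟨0, by simp [sign_pos h]⟩

/-- The data are forced: `L = c⁻¹`, `P = a c⁻¹`, `Q = c⁻¹ d`. Symmetry of `P` and `Q` is two of the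
symplectic relations, and the remaining relation recovers `b`. -/
lemma exists_genMat_eq (M : Sp g) (h : IsUnit M.1.toBlocks₂₁.det) : ∃ D, genMat D = M := by
  obtain ⟨h1, h2, h3⟩ := sp_blocks M
  set a := M.1.toBlocks₁₁ with ha
  set b := M.1.toBlocks₁₂ with hb
  set c := M.1.toBlocks₂₁ with hc
  set d := M.1.toBlocks₂₂ with hd
  have hM : M.1 = Matrix.fromBlocks a b c d := (Matrix.fromBlocks_toBlocks M.1).symm
  have hci : IsUnit c⁻¹.det := Matrix.isUnit_nonsing_inv_det c h
  obtain ⟨m, hm⟩ := exists_sq_eq_sign hci.ne_zero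
  have e1 : c * c⁻¹ = 1 := Matrix.mul_nonsing_inv _ h
  have e2 : c⁻¹ * c = 1 := Matrix.nonsing_inv_mul _ h
  have e3 : cᵀ * c⁻¹ᵀ = 1 := by rw [← Matrix.transpose_mul, e2, Matrix.transpose_one]
  have e4 : c⁻¹ᵀ * cᵀ = 1 := by rw [← Matrix.transpose_mul, e1, Matrix.transpose_one]
  have hP : (a * c⁻¹).IsSymm := by
    rw [Matrix.IsSymm, Matrix.transpose_mul]
    calc c⁻¹ᵀ * aᵀ = c⁻¹ᵀ * (aᵀ * c) * c⁻¹ := by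
          rw [Matrix.mul_assoc, Matrix.mul_assoc, e1, Matrix.mul_one]
      _ = a * c⁻¹ := by rw [h1, ← Matrix.mul_assoc, e4, Matrix.one_mul]
  have hQ : (c⁻¹ * d).IsSymm := by
    rw [Matrix.IsSymm, Matrix.transpose_mul]
    calc dᵀ * c⁻¹ᵀ = c⁻¹ * (c * dᵀ) * c⁻¹ᵀ := by
          rw [← Matrix.mul_assoc, e2, Matrix.one_mul]
      _ = c⁻¹ * d := by rw [h3, Matrix.mul_assoc, Matrix.mul_assoc, e3, Matrix.mul_one]
  refine ⟨⟨a * c⁻¹, c⁻¹, c⁻¹ * d, m, hP, hQ, hci, hm⟩, Subtype.ext ?_⟩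
  rw [hM, genMat]
  simp only [Matrix.nonsing_inv_nonsing_inv _ h]
  have f1 : a * c⁻¹ * c = a := by rw [Matrix.mul_assoc, e2, Matrix.mul_one]
  have f2 : c * (c⁻¹ * d) = d := by rw [← Matrix.mul_assoc, e1, Matrix.one_mul]
  have f3 : a * (c⁻¹ * d) - c⁻¹ᵀ = b := by
    have : a * (c⁻¹ * d) = c⁻¹ᵀ * (aᵀ * d) := by
      rw [← Matrix.mul_assoc, ← hP.eq, Matrix.transpose_mul, Matrix.mul_assoc]
    rw [this, ← Matrix.mul_one c⁻¹ᵀ, Matrix.mul_assoc, Matrix.one_mul, ← Matrix.mul_sub, ← h2,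
      sub_sub_cancel, ← Matrix.mul_assoc, e4, Matrix.one_mul]
  rw [f1, f2, f3]

end Symplectic

/-! ### The action on the Siegel upper half-space -/

section UpperAction

variable {g : ℕ}

/-- The numerator `A Ω + B`. -/
def upNum (M : Sp g) (Ω : Matrix (Fin g) (Fin g) ℂ) : Matrix (Fin g) (Fin g) ℂ :=
  blkA M * Ω + blkB M

/-- The denominator `C Ω + D`. -/
def upDen (M : Sp g) (Ω : Matrix (Fin g) (Fin g) ℂ) : Matrix (Fin g) (Fin g) ℂ :=
  blkC M * Ω + blkD M

lemma toC_mul_frame (M : Sp g) (Ω : Matrix (Fin g) (Fin g) ℂ) :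
    toC M.1 * frame Ω = Matrix.fromRows (upNum M Ω) (upDen M Ω) := by
  rw [toC_eq_blocks, frame, Matrix.fromBlocks_mul_fromRows, Matrix.mul_one, Matrix.mul_one]
  rfl

lemma sub_conjTranspose_eq (Ω : SiegelUpper g) :
    Ω.1 - Ω.1ᴴ = (2 * Complex.I) • toC (Ω.1.map Complex.im) := by
  ext i j
  have h2 : Ω.1 j i = Ω.1 i j := Ω.2.1.apply i j
  simp only [Matrix.smul_apply, Matrix.sub_apply, Matrix.conjTranspose_apply, h2, Matrix.map_apply,
    smul_eq_mul, Complex.star_def, Complex.sub_conj]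
  push_cast
  ring

/-- The relation `ᵗM J M = J` is sandwiched between the frame of `Ω` and its adjoint; since `M` is
real, the adjoint of `M` is its transpose. -/
lemma upper_hermitian_smul (M : Sp g) (Ω : SiegelUpper g) :
    (upDen M Ω.1)ᴴ * upNum M Ω.1 - (upNum M Ω.1)ᴴ * upDen M Ω.1 =
      (2 * Complex.I) • toC (Ω.1.map Complex.im) := by
  have h := congrArg (fun X => (frame Ω.1)ᴴ * X * frame Ω.1) (toC_transpose_J M)
  have h1 : (frame Ω.1)ᴴ * ((toC M.1)ᵀ * Matrix.J (Fin g) ℂ * toC M.1) * frame Ω.1 =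
      (toC M.1 * frame Ω.1)ᴴ * Matrix.J (Fin g) ℂ * (toC M.1 * frame Ω.1) := by
    simp only [Matrix.conjTranspose_mul, toC_conjTranspose, Matrix.mul_assoc]
  simp only [h1, toC_mul_frame] at h
  simp only [frame, Matrix.conjTranspose_fromRows_eq_fromCols_conjTranspose, Matrix.J,
    Matrix.fromCols_mul_fromBlocks, Matrix.fromCols_mul_fromRows] at h
  simp only [Matrix.mul_neg, Matrix.mul_one, Matrix.mul_zero, add_zero, zero_add,
    Matrix.conjTranspose_one, Matrix.neg_mul, Matrix.one_mul] at h
  rw [← sub_conjTranspose_eq, sub_eq_add_neg, h]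
  abel

lemma upper_symm_smul (M : Sp g) (Ω : SiegelUpper g) :
    (upDen M Ω.1)ᵀ * upNum M Ω.1 = (upNum M Ω.1)ᵀ * upDen M Ω.1 := by
  have h := congrArg (fun X => (frame Ω.1)ᵀ * X * frame Ω.1) (toC_transpose_J M)
  have h1 : (frame Ω.1)ᵀ * ((toC M.1)ᵀ * Matrix.J (Fin g) ℂ * toC M.1) * frame Ω.1 =
      (toC M.1 * frame Ω.1)ᵀ * Matrix.J (Fin g) ℂ * (toC M.1 * frame Ω.1) := by
    simp only [Matrix.transpose_mul, Matrix.mul_assoc]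
  simp only [h1, toC_mul_frame] at h
  simp only [frame, Matrix.transpose_fromRows, Matrix.J,
    Matrix.fromCols_mul_fromBlocks, Matrix.fromCols_mul_fromRows] at h
  simp only [Matrix.mul_neg, Matrix.mul_one, Matrix.mul_zero, add_zero, zero_add,
    Matrix.transpose_one, Matrix.neg_mul, Ω.2.1.eq, Matrix.one_mul, add_neg_cancel] at h
  rw [← sub_eq_zero, ← h]
  abel

/-- A null vector of `C Ω + D` would annihilate the Hermitian form on the left of
`upper_hermitian_smul`, whereas `Im Ω` is positive definite. -/
lemma upDen_isUnit (M : Sp g) (Ω : SiegelUpper g) : IsUnit (upDen M Ω.1).det := by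
  rw [isUnit_iff_ne_zero]
  intro h0
  obtain ⟨v, hv, hv0⟩ := Matrix.exists_mulVec_eq_zero_iff.mpr h0
  have hH := congrArg (fun X => star v ⬝ᵥ (X *ᵥ v)) (upper_hermitian_smul M Ω)
  have h1 : star v ⬝ᵥ ((upDen M Ω.1)ᴴ *ᵥ (upNum M Ω.1 *ᵥ v)) = 0 := by
    rw [Matrix.dotProduct_mulVec, ← Matrix.star_mulVec, hv0]
    simp
  simp only [Matrix.sub_mulVec _ _ v, dotProduct_sub, Matrix.smul_mulVec, dotProduct_smul,
    ← Matrix.mulVec_mulVec, h1, hv0, Matrix.mulVec_zero, dotProduct_zero, sub_self, smul_eq_mul] at hH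
  have h2 := (toC_posDef Ω.2.2).dotProduct_mulVec_pos hv
  have h3 : (2 * Complex.I : ℂ) ≠ 0 := by simp
  rcases mul_eq_zero.mp hH.symm with h | h
  · exact h3 h
  · exact h2.ne' h

lemma posDef_of_toC {S : Matrix (Fin g) (Fin g) ℝ} (hS : (toC S).PosDef) : S.PosDef := by
  refine Matrix.PosDef.of_dotProduct_mulVec_pos ?_ fun v hv => ?_
  · ext i j
    have := congrFun (congrFun hS.isHermitian.eq i) j
    simpa using this
  · have hv' : (Complex.ofReal ∘ v) ≠ 0 := by
      intro h
      apply hv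
      ext i
      simpa using congrFun h i
    have h := hS.dotProduct_mulVec_pos hv'
    have e : star (Complex.ofReal ∘ v) ⬝ᵥ (toC S *ᵥ (Complex.ofReal ∘ v)) =
        ((star v ⬝ᵥ (S *ᵥ v) : ℝ) : ℂ) := by
      simp [dotProduct, Matrix.mulVec]
    rw [e] at h
    exact Complex.zero_lt_real.mp h

/-- The symplectic action on the Siegel upper half-space. -/
instance : SMul (Sp g) (SiegelUpper g) where
  smul M Ω := ⟨upNum M Ω.1 * (upDen M Ω.1)⁻¹, by
    have hV := upDen_isUnit M Ω
    have hVt : IsUnit (upDen M Ω.1)ᵀ.det := by rwa [Matrix.det_transpose]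
    have hVh : IsUnit (upDen M Ω.1)ᴴ.det := by rw [Matrix.det_conjTranspose]; exact hV.star
    have hs : (upNum M Ω.1 * (upDen M Ω.1)⁻¹).IsSymm := by
      rw [Matrix.IsSymm, Matrix.transpose_mul, Matrix.transpose_nonsing_inv]
      calc ((upDen M Ω.1)ᵀ)⁻¹ * (upNum M Ω.1)ᵀ
          = ((upDen M Ω.1)ᵀ)⁻¹ * ((upNum M Ω.1)ᵀ * upDen M Ω.1) * (upDen M Ω.1)⁻¹ := by
            rw [Matrix.mul_assoc, Matrix.mul_assoc, Matrix.mul_nonsing_inv _ hV, Matrix.mul_one]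
        _ = _ := by
            rw [← upper_symm_smul, ← Matrix.mul_assoc, Matrix.nonsing_inv_mul _ hVt,
              Matrix.one_mul]
    refine ⟨hs, posDef_of_toC ?_⟩
    set Z := upNum M Ω.1 * (upDen M Ω.1)⁻¹ with hZ
    have e1 : Z - Zᴴ = (2 * Complex.I) • toC (Z.map Complex.im) := by
      ext i j
      have h2 : Z j i = Z i j := hs.apply i j
      simp only [Matrix.smul_apply, Matrix.sub_apply, Matrix.conjTranspose_apply, h2,
        Matrix.map_apply, smul_eq_mul, Complex.star_def, Complex.sub_conj]
      push_cast
      ring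
    have e2 : Z - Zᴴ = ((upDen M Ω.1)⁻¹)ᴴ * ((2 * Complex.I) • toC (Ω.1.map Complex.im)) *
        (upDen M Ω.1)⁻¹ := by
      rw [← upper_hermitian_smul, Matrix.mul_sub, Matrix.sub_mul, hZ, Matrix.conjTranspose_mul,
        Matrix.conjTranspose_nonsing_inv, ← Matrix.mul_assoc, Matrix.nonsing_inv_mul _ hVh,
        Matrix.one_mul, ← Matrix.mul_assoc, Matrix.mul_assoc _ (upDen M Ω.1),
        Matrix.mul_nonsing_inv _ hV, Matrix.mul_one]
    -- The imaginary part transforms by congruence with `(C Ω + D)⁻¹`, which preserves positivity.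
    have e3 : toC (Z.map Complex.im) =
        ((upDen M Ω.1)⁻¹)ᴴ * toC (Ω.1.map Complex.im) * (upDen M Ω.1)⁻¹ := by
      rw [e1, Matrix.mul_smul, Matrix.smul_mul] at e2
      exact smul_right_injective _ (by simp : (2 * Complex.I : ℂ) ≠ 0) e2
    rw [e3]
    refine (toC_posDef Ω.2.2).conjTranspose_mul_mul_same ?_
    refine Matrix.mulVec_injective_iff_isUnit.mpr ?_
    rw [Matrix.isUnit_iff_isUnit_det]
    exact Matrix.isUnit_nonsing_inv_det _ hV⟩

lemma toC_mul_frame_upper (M : Sp g) (Ω : SiegelUpper g) :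
    toC M.1 * frame Ω.1 = frame (M • Ω).1 * upDen M Ω.1 := by
  rw [toC_mul_frame, frame, Matrix.fromRows_mul, Matrix.one_mul]
  congr 1
  change _ = upNum M Ω.1 * (upDen M Ω.1)⁻¹ * upDen M Ω.1
  rw [Matrix.mul_assoc, Matrix.nonsing_inv_mul _ (upDen_isUnit M Ω), Matrix.mul_one]

lemma frame_mul_inj {Z Z' X Y : Matrix (Fin g) (Fin g) ℂ} (hX : IsUnit X.det)
    (h : frame Z * X = frame Z' * Y) : Z = Z' ∧ X = Y := by
  rw [frame, frame, Matrix.fromRows_mul, Matrix.fromRows_mul, Matrix.one_mul, Matrix.one_mul,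
    Matrix.fromRows_ext_iff] at h
  obtain ⟨h1, h2⟩ := h
  subst h2
  refine ⟨?_, rfl⟩
  have := congrArg (fun Z => Z * X⁻¹) h1
  simpa only [Matrix.mul_assoc, Matrix.mul_nonsing_inv _ hX, Matrix.mul_one] using this

/-- Writing the frame of `Ω` transformed by `M N` in two ways gives the action law from the upper
block and the cocycle law from the lower block. -/
lemma mul_smul_upper_and_den (M N : Sp g) (Ω : SiegelUpper g) :
    ((M * N) • Ω).1 = (M • N • Ω).1 ∧ upDen (M * N) Ω.1 = upDen M (N • Ω).1 * upDen N Ω.1 := by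
  refine frame_mul_inj (upDen_isUnit _ _) ?_
  have h : toC (M * N).1 = toC M.1 * toC N.1 := (Matrix.map_mul (f := Complex.ofRealHom))
  rw [← toC_mul_frame_upper, h, Matrix.mul_assoc, toC_mul_frame_upper, ← Matrix.mul_assoc,
    toC_mul_frame_upper, Matrix.mul_assoc]

lemma one_smul_upper_and_den (Ω : SiegelUpper g) :
    ((1 : Sp g) • Ω).1 = Ω.1 ∧ upDen 1 Ω.1 = 1 := by
  refine frame_mul_inj (upDen_isUnit _ _) ?_
  have h : toC (1 : Sp g).1 = 1 := Matrix.map_one Complex.ofReal (by simp) (by simp)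
  rw [← toC_mul_frame_upper, h, Matrix.one_mul, Matrix.mul_one]

instance : MulAction (Sp g) (SiegelUpper g) where
  one_smul Ω := Subtype.ext (one_smul_upper_and_den Ω).1
  mul_smul M N Ω := Subtype.ext (mul_smul_upper_and_den M N Ω).1

lemma upDen_mul (M N : Sp g) (Ω : SiegelUpper g) :
    upDen (M * N) Ω.1 = upDen M (N • Ω).1 * upDen N Ω.1 := (mul_smul_upper_and_den M N Ω).2

lemma upDen_one (Ω : SiegelUpper g) : upDen 1 Ω.1 = 1 := (one_smul_upper_and_den Ω).2

/-- The point `i` of the upper half-space. -/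
def upI (g : ℕ) : SiegelUpper g :=
  ⟨Complex.I • 1, by simp [Matrix.IsSymm], by
    have : ((Complex.I • 1 : Matrix (Fin g) (Fin g) ℂ).map Complex.im) = 1 := by
      ext i j
      by_cases h : i = j <;> simp [h, Matrix.one_apply]
    rw [this]
    exact Matrix.PosDef.one⟩

end UpperAction

/-! ### The covering homomorphism and its surjectivity -/

section Covering

variable {g k : ℕ} [NeZero k]

lemma mp_induction {p : Mp g k → Prop} (gen : ∀ D, p (mpGen k D)) (one : p 1)
    (mul : ∀ A B, p A → p B → p (A * B)) (inv : ∀ A, p A → p A⁻¹) (A : Mp g k) : p A := by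
  obtain ⟨A, hA⟩ := A
  induction hA using Subgroup.closure_induction with
  | mem x hx => obtain ⟨D, rfl⟩ := hx; exact gen D
  | one => exact one
  | mul x y hx hy h1 h2 => exact mul ⟨x, hx⟩ ⟨y, hy⟩ h1 h2
  | inv x hx h => exact inv ⟨x, hx⟩ h

lemma mp_hom_ext {G : Type*} [Group G] {φ ψ : Mp g k →* G}
    (h : ∀ D, φ (mpGen k D) = ψ (mpGen k D)) : φ = ψ := by
  ext A
  refine mp_induction (p := fun A => φ A = ψ A) h (by simp) (fun A B hA hB => ?_)
    (fun A hA => ?_) A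
  · rw [map_mul, map_mul, hA, hB]
  · rw [map_inv, map_inv, hA]

/-- The Weyl operator attached to a point of `ℝ^{2g}`. -/
def weylZ (k : ℕ) (z : Fin g ⊕ Fin g → ℝ) : 𝓢(Euc g, ℂ) →L[ℂ] 𝓢(Euc g, ℂ) :=
  weyl k (topPart z) (botPart z)

lemma weylZ_injective : Function.Injective (weylZ (g := g) k) := by
  intro z z' h
  obtain ⟨h1, h2⟩ := weyl_injective h
  ext (i | i)
  · exact congrArg (fun u : Euc g => u i) h1
  · exact congrArg (fun u : Euc g => u i) h2

lemma genS_weylZ (D : GenData g) (z : Fin g ⊕ Fin g → ℝ) (f : 𝓢(Euc g, ℂ)) :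
    genS k D (weylZ k z f) = weylZ k ((genMat D).1 *ᵥ z) (genS k D f) := by
  rw [weylZ, genS_weyl, weylZ]
  have hz : z = Sum.elim (z ∘ Sum.inl) (z ∘ Sum.inr) := (Sum.elim_comp_inl_inr z).symm
  have h1 : topPart ((genMat D).1 *ᵥ z) = -matVec D.Lᵀ (botPart z) +
      matVec D.P (matVec D.L⁻¹ (topPart z + matVec D.Q (botPart z))) := by
    rw [hz, genMat, Matrix.fromBlocks_mulVec]
    simp only [topPart, botPart, matVec, Sum.elim_comp_inl, Sum.elim_comp_inr, ← WithLp.toLp_add,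
      ← WithLp.toLp_neg, Matrix.mulVec_add, Matrix.sub_mulVec, Matrix.mulVec_mulVec, Matrix.mul_assoc]
    congr 1
    abel
  have h2 : botPart ((genMat D).1 *ᵥ z) =
      matVec D.L⁻¹ (topPart z + matVec D.Q (botPart z)) := by
    rw [hz, genMat, Matrix.fromBlocks_mulVec]
    simp only [topPart, botPart, matVec, Sum.elim_comp_inl, Sum.elim_comp_inr, ← WithLp.toLp_add,
      Matrix.mulVec_add, Matrix.mulVec_mulVec]
  rw [h1, h2]

/-- Conjugating Weyl operators by a symplectic matrix is a property stable under products and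
inverses, and generators have it. -/
lemma exists_cov (A : Mp g k) : ∃ M : Sp g, ∀ z f, A.1 (weylZ k z f) = weylZ k (M.1 *ᵥ z) (A.1 f) := by
  refine mp_induction (p := fun A => ∃ M : Sp g, ∀ z f, A.1 (weylZ k z f) =
    weylZ k (M.1 *ᵥ z) (A.1 f)) (fun D => ⟨genMat D, genS_weylZ D⟩) ⟨1, fun z f => ?_⟩ ?_ ?_ A
  · change weylZ k z f = weylZ k ((1 : Matrix _ _ ℝ) *ᵥ z) f
    rw [Matrix.one_mulVec]
  · rintro A B ⟨M, hM⟩ ⟨N, hN⟩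
    refine ⟨M * N, fun z f => ?_⟩
    change A.1 (B.1 _) = weylZ k ((M.1 * N.1) *ᵥ z) (A.1 (B.1 f))
    rw [hN, hM, Matrix.mulVec_mulVec]
  · rintro A ⟨M, hM⟩
    refine ⟨M⁻¹, fun z f => ?_⟩
    have h := hM ((M⁻¹ : Sp g).1 *ᵥ z) (A.1.symm f)
    have h1 : M.1 * (M⁻¹ : Sp g).1 = 1 := congrArg Subtype.val (mul_inv_cancel M)
    rw [Matrix.mulVec_mulVec, h1, Matrix.one_mulVec, A.1.apply_symm_apply] at h
    change A.1.symm (weylZ k z f) = weylZ k ((M⁻¹ : Sp g).1 *ᵥ z) (A.1.symm f)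
    rw [← h, A.1.symm_apply_apply]

/-- The operator `A` is onto, so the two Weyl operators on the right agree on all Schwartz
functions, and Weyl operators determine their labels. -/
lemma cov_unique (A : Mp g k) {M N : Sp g}
    (hM : ∀ z f, A.1 (weylZ k z f) = weylZ k (M.1 *ᵥ z) (A.1 f))
    (hN : ∀ z f, A.1 (weylZ k z f) = weylZ k (N.1 *ᵥ z) (A.1 f)) : M = N := by
  refine Subtype.ext (Matrix.ext_of_mulVec_single fun i => ?_)
  refine weylZ_injective (k := k) (ContinuousLinearMap.ext fun f => ?_)
  have h := (hM (Pi.single i 1) (A.1.symm f)).symm.trans (hN (Pi.single i 1) (A.1.symm f))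
  rwa [A.1.apply_symm_apply] at h

/-- The symplectic matrix by which a metaplectic operator conjugates the Weyl operators. -/
def covHom (g k : ℕ) [NeZero k] : Mp g k →* Sp g where
  toFun A := (exists_cov A).choose
  map_one' := cov_unique 1 (exists_cov 1).choose_spec fun z f => by
    change weylZ k z f = weylZ k ((1 : Matrix _ _ ℝ) *ᵥ z) f
    rw [Matrix.one_mulVec]
  map_mul' A B := cov_unique (A * B) (exists_cov (A * B)).choose_spec fun z f => by
    change A.1 (B.1 _) = weylZ k (((exists_cov A).choose.1 * (exists_cov B).choose.1) *ᵥ z)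
      (A.1 (B.1 f))
    rw [(exists_cov B).choose_spec, (exists_cov A).choose_spec, Matrix.mulVec_mulVec]

lemma covHom_spec (A : Mp g k) (z : Fin g ⊕ Fin g → ℝ) (f : 𝓢(Euc g, ℂ)) :
    A.1 (weylZ k z f) = weylZ k ((covHom g k A).1 *ᵥ z) (A.1 f) := (exists_cov A).choose_spec z f

lemma covHom_gen (D : GenData g) : covHom g k (mpGen k D) = genMat D :=
  cov_unique (mpGen k D) (covHom_spec _) (genS_weylZ D)

lemma exists_cov_eq_of_isUnit (M : Sp g) (h : IsUnit M.1.toBlocks₂₁.det) :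
    ∃ A : Mp g k, covHom g k A = M := by
  obtain ⟨D, hD⟩ := exists_genMat_eq M h
  exact ⟨mpGen k D, (covHom_gen D).trans hD⟩

/-- The generator with `P = z`, `L = 1`, `Q = 0`, `m = 0`. -/
def scalarData (g : ℕ) (z : ℝ) : GenData g where
  P := z • 1
  L := 1
  Q := 0
  m := 0
  symm_P := by simp [Matrix.IsSymm]
  symm_Q := by simp [Matrix.IsSymm]
  isUnit_L := by simp
  sq_m := by simp

lemma genMat_scalarData (z : ℝ) : (genMat (scalarData g z)).1 = Matrix.fromBlocks (z • 1) (-1) 1 0 := by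
  simp [genMat, scalarData]

/-- Up to transposition and a power of `i`, this determinant is `det (C' Ω + D')` at `Ω = i` for
another symplectic matrix. -/
lemma isUnit_upper_sub_lower (M : Sp g) :
    IsUnit (blkA M - Complex.I • blkC M).det := by
  -- The lower blocks of this matrix are the transposes of the two left blocks of `M`.
  set N : Sp g := genMat (scalarData g 0) * ⟨M.1ᵀ, SymplecticGroup.transpose_mem M.2⟩ with hN
  have h := upDen_isUnit N (upI g)
  have hN1 : N.1 = Matrix.fromBlocks (-M.1.toBlocks₁₂ᵀ) (-M.1.toBlocks₂₂ᵀ) M.1.toBlocks₁₁ᵀ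
      M.1.toBlocks₂₁ᵀ := by
    change (genMat (scalarData g 0)).1 * M.1ᵀ = _
    conv_lhs => rw [← Matrix.fromBlocks_toBlocks M.1]
    rw [genMat_scalarData, Matrix.fromBlocks_transpose, Matrix.fromBlocks_multiply]
    simp
  have h1 : upDen N (upI g).1 = Complex.I • (blkA M - Complex.I • blkC M)ᵀ := by
    simp only [upDen, blkC, blkD, blkA, hN1, Matrix.toBlocks_fromBlocks₂₁,
      Matrix.toBlocks_fromBlocks₂₂, upI, Matrix.mul_smul, Matrix.mul_one, Matrix.transpose_sub,
      Matrix.transpose_smul, smul_sub, smul_smul, Complex.I_mul_I, Matrix.transpose_map]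
    module
  rw [h1, Matrix.det_smul, Matrix.det_transpose] at h
  exact isUnit_of_mul_isUnit_right h

/-- As a polynomial in `z` the determinant does not vanish at `z = i`, by `isUnit_upper_sub_lower`,
so it does not vanish at all real `z`. -/
lemma exists_isUnit_sub_smul (M : Sp g) :
    ∃ z : ℝ, IsUnit (z • M.1.toBlocks₂₁ - M.1.toBlocks₁₁).det := by
  by_contra! hne
  set a := M.1.toBlocks₁₁ with ha
  set c := M.1.toBlocks₂₁ with hc
  set p : Polynomial ℝ := ((Polynomial.X : Polynomial ℝ) • c.map Polynomial.C - a.map Polynomial.C).det with hp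
  have hp0 : p = 0 := by
    refine Polynomial.funext fun z => ?_
    have h := hne z
    rw [isUnit_iff_ne_zero, not_not] at h
    rw [Polynomial.eval_zero, ← h, hp, ← Polynomial.coe_evalRingHom, RingHom.map_det]
    congr 1
    ext i j
    simp
    ring
  have h := isUnit_upper_sub_lower M
  have h1 : blkA M - Complex.I • blkC M = -(((Polynomial.X : Polynomial ℝ) • c.map Polynomial.C -
      a.map Polynomial.C).map (Polynomial.eval₂RingHom Complex.ofRealHom Complex.I)) := by
    ext i j
    simp [blkA, blkC, ← ha, ← hc]
    ring
  have h2 := congrArg (Polynomial.eval₂RingHom Complex.ofRealHom Complex.I) hp0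
  rw [hp, RingHom.map_det, map_zero] at h2
  rw [RingHom.mapMatrix_apply] at h2
  rw [h1, Matrix.det_neg] at h
  rw [h2, mul_zero] at h
  exact not_isUnit_zero h

/-- Multiplication by the inverse of the generator with `P = z`, `L = 1`, `Q = 0` turns the lower
left block into `z C - A`, which is invertible for a suitable real `z`. -/
lemma covHom_surjective : Function.Surjective (covHom g k) := by
  intro M
  obtain ⟨z, hz⟩ := exists_isUnit_sub_smul M
  set K := genMat (scalarData g z) with hK
  set N := K⁻¹ * M with hN
  have hM : M = K * N := by rw [hN, mul_inv_cancel_left]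
  have h1 : M.1 = Matrix.fromBlocks (z • N.1.toBlocks₁₁ - N.1.toBlocks₂₁)
      (z • N.1.toBlocks₁₂ - N.1.toBlocks₂₂) N.1.toBlocks₁₁ N.1.toBlocks₁₂ := by
    rw [hM]
    change K.1 * N.1 = _
    conv_lhs => rw [← Matrix.fromBlocks_toBlocks N.1, hK, genMat_scalarData,
      Matrix.fromBlocks_multiply]
    simp [sub_eq_add_neg]
  have h2 : z • M.1.toBlocks₂₁ - M.1.toBlocks₁₁ = N.1.toBlocks₂₁ := by
    rw [h1, Matrix.toBlocks_fromBlocks₂₁, Matrix.toBlocks_fromBlocks₁₁]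
    abel
  obtain ⟨B, hB⟩ := exists_cov_eq_of_isUnit (k := k) N (h2 ▸ hz)
  refine ⟨mpGen k (scalarData g z) * B, ?_⟩
  rw [map_mul, covHom_gen, hB, hM]

end Covering

/-! ### Operators that commute with all Weyl operators -/

section Kernel

variable {g k : ℕ} [NeZero k]

/-- The product `conj f * h` of Schwartz functions. -/
def starMul (f h : 𝓢(Euc g, ℂ)) : 𝓢(Euc g, ℂ) := SchwartzMap.smulLeftCLM ℂ (conjS f) h

lemma starMul_apply (f h : 𝓢(Euc g, ℂ)) (x : Euc g) : starMul f h x = star (f x) * h x := by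
  rw [starMul, SchwartzMap.smulLeftCLM_apply_apply (conjS f).hasTemperateGrowth, smul_eq_mul,
    conjS_apply]

/-- This expresses the Fourier transform of a pointwise product as a matrix coefficient of a
modulation, a quantity preserved by unitary operators commuting with modulations. -/
lemma fourier_starMul (f h : 𝓢(Euc g, ℂ)) (w : Euc g) :
    𝓕 (starMul f h) w = ∫ x, star (f x) * weyl k (-((k : ℝ)⁻¹ • w)) 0 h x := by
  have hk : (k : ℝ) ≠ 0 := Nat.cast_ne_zero.mpr (NeZero.ne k)
  rw [SchwartzMap.fourier_coe, Real.fourier_eq']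
  congr 1
  funext x
  rw [starMul_apply, weyl_apply, sub_zero, smul_eq_mul, mul_left_comm]
  congr 3
  simp only [weylPhase, inner_zero_right, inner_neg_left, inner_smul_left, real_inner_comm x w]
  simp only [map_inv₀, RCLike.conj_to_real]
  push_cast
  have hk' : (k : ℂ) ≠ 0 := Nat.cast_ne_zero.mpr (NeZero.ne k)
  field_simp
  ring

lemma starMul_eq_of_commute (A : Mp g k) (hA : covHom g k A = 1) (f h : 𝓢(Euc g, ℂ)) :
    starMul (A.1 f) (A.1 h) = starMul f h := by
  refine (FourierTransform.fourierCLE ℂ 𝓢(Euc g, ℂ)).injective ?_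
  change 𝓕 (starMul (A.1 f) (A.1 h)) = 𝓕 (starMul f h)
  ext w
  rw [fourier_starMul (k := k), fourier_starMul (k := k)]
  set z : Fin g ⊕ Fin g → ℝ := Sum.elim (-((k : ℝ)⁻¹ • w)).ofLp 0 with hz
  have h1 : weyl k (-((k : ℝ)⁻¹ • w)) 0 = weylZ k z := rfl
  have h2 := covHom_spec A z h
  rw [hA] at h2
  change _ = weylZ k ((1 : Matrix _ _ ℝ) *ᵥ z) _ at h2
  rw [Matrix.one_mulVec] at h2
  rw [h1, ← Mp_isometry A f, h2]

/-- A direct form of Schur's lemma. Commuting with modulations, together with unitarity, preserves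
`conj f * h` pointwise, so the operator is multiplication by a function; commuting with translations
makes that function constant. -/
lemma exists_scalar_of_cov_eq_one (A : Mp g k) (hA : covHom g k A = 1) :
    ∃ c : ℂ, ∀ h, A.1 h = c • h := by
  set γ := gaussS g 1 one_pos with hγ
  have h1 : ∀ f h x, star (A.1 f x) * A.1 h x = star (f x) * h x := fun f h x => by
    rw [← starMul_apply, ← starMul_apply, starMul_eq_of_commute A hA]
  -- The Gaussian has no zeros, so by `h1` its image has none, and one may divide by it.
  have h2 : ∀ x, star (A.1 γ x) ≠ 0 := fun x h0 => by
    have := h1 γ γ x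
    rw [h0, zero_mul, eq_comm, mul_eq_zero, star_eq_zero, or_self] at this
    exact gaussS_ne_zero 1 one_pos x this
  set c : Euc g → ℂ := fun x => star (γ x) / star (A.1 γ x) with hc
  have h3 : ∀ h x, A.1 h x = c x * h x := fun h x => by
    rw [hc, div_mul_eq_mul_div, ← h1, mul_div_cancel_left₀ _ (h2 x)]
  have h4 : ∀ x a, c x = c (x - a) := fun x a => by
    set z : Fin g ⊕ Fin g → ℝ := Sum.elim 0 a.ofLp with hz
    have e1 : weyl k 0 a = weylZ k z := rfl
    have e2 := covHom_spec A z γ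
    rw [hA] at e2
    change _ = weylZ k ((1 : Matrix _ _ ℝ) *ᵥ z) _ at e2
    rw [Matrix.one_mulVec, ← e1] at e2
    have e3 := congrArg (fun f : 𝓢(Euc g, ℂ) => f x) e2
    simp only [h3, weyl_apply, weylPhase, inner_zero_left] at e3
    simp only [zero_div, sub_zero, mul_zero, Complex.ofReal_zero, zero_mul, Complex.exp_zero,
      one_mul] at e3
    exact mul_right_cancel₀ (gaussS_ne_zero 1 one_pos _) e3
  refine ⟨c 0, fun h => ?_⟩
  ext x
  rw [h3, h4 x x, sub_self]
  rfl

end Kernel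

/-! ### Gaussian integrals with complex symmetric matrices -/

section GaussianIntegral

variable {g : ℕ}

lemma exists_orthogonal_diagonal {S : Matrix (Fin g) (Fin g) ℝ} (hS : S.IsHermitian) :
    ∃ U : Matrix (Fin g) (Fin g) ℝ, Uᵀ * U = 1 ∧ Uᵀ * S * U = Matrix.diagonal hS.eigenvalues := by
  refine ⟨hS.eigenvectorUnitary.1, ?_, ?_⟩
  · have h := (Matrix.mem_unitaryGroup_iff' (n := Fin g) (α := ℝ)).mp hS.eigenvectorUnitary.2
    simpa [Matrix.star_eq_conjTranspose] using h
  · have h := hS.conjStarAlgAut_star_eigenvectorUnitary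
    rw [Unitary.conjStarAlgAut_apply] at h
    simpa [Matrix.star_eq_conjTranspose] using h

/-- Simultaneous diagonalization of a positive definite and a symmetric matrix. -/
lemma exists_simultaneous_diagonal {X Y : Matrix (Fin g) (Fin g) ℝ} (hX : X.PosDef) (hY : Y.IsSymm) :
    ∃ (B : Matrix (Fin g) (Fin g) ℝ) (y : Fin g → ℝ), B.det ≠ 0 ∧ Bᵀ * X * B = 1 ∧
      Bᵀ * Y * B = Matrix.diagonal y := by
  obtain ⟨U, hU, hUX⟩ := exists_orthogonal_diagonal hX.isHermitian
  set d := hX.isHermitian.eigenvalues with hd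
  have hdpos : ∀ i, 0 < d i := hX.eigenvalues_pos
  -- Scaling the eigenvectors of `X` by `d_i^(-1/2)` turns `X` into the identity, which a further
  -- orthogonal change of basis leaves alone while it diagonalizes `Y`.
  set B₀ := U * Matrix.diagonal fun i => (√(d i))⁻¹ with hB₀
  have h1 : B₀ᵀ * X * B₀ = 1 := by
    have : B₀ᵀ * X * B₀ = Matrix.diagonal (fun i => (√(d i))⁻¹) * (Uᵀ * X * U) *
        Matrix.diagonal (fun i => (√(d i))⁻¹) := by
      rw [hB₀, Matrix.transpose_mul, Matrix.diagonal_transpose]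
      simp only [Matrix.mul_assoc]
    rw [this, hUX, Matrix.diagonal_mul_diagonal, Matrix.diagonal_mul_diagonal, ← Matrix.diagonal_one]
    congr 1
    funext i
    have h2 := Real.mul_self_sqrt (hdpos i).le
    have h3 : √(d i) ≠ 0 := (Real.sqrt_pos.mpr (hdpos i)).ne'
    field_simp
    rw [sq, h2]
  have hT : (B₀ᵀ * Y * B₀).IsHermitian := by
    rw [Matrix.IsHermitian, Matrix.conjTranspose_eq_transpose_of_trivial,
      Matrix.transpose_mul (B₀ᵀ * Y) B₀, Matrix.transpose_mul B₀ᵀ Y, Matrix.transpose_transpose, hY.eq, Matrix.mul_assoc]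
  obtain ⟨V, hV, hVT⟩ := exists_orthogonal_diagonal hT
  have h4 : (B₀ * V)ᵀ * X * (B₀ * V) = 1 := by
    calc _ = Vᵀ * (B₀ᵀ * X * B₀) * V := by
          rw [Matrix.transpose_mul]
          simp only [Matrix.mul_assoc]
      _ = 1 := by rw [h1, Matrix.mul_one, hV]
  refine ⟨B₀ * V, hT.eigenvalues, fun h0 => ?_, h4, ?_⟩
  · have := congrArg Matrix.det h4
    rw [Matrix.det_mul, h0, mul_zero, Matrix.det_one] at this
    exact zero_ne_one this
  · rw [← hVT, Matrix.transpose_mul]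
    simp only [Matrix.mul_assoc]

/-- The complex quadratic form `ᵗξ Z ξ` at a real vector. -/
def cquad (Z : Matrix (Fin g) (Fin g) ℂ) (ξ : Fin g → ℝ) : ℂ :=
  (fun j => (ξ j : ℂ)) ⬝ᵥ (Z *ᵥ fun j => (ξ j : ℂ))

/-- Symmetric complex matrices with positive definite real part. -/
def reHalfSpace (g : ℕ) : Set (Matrix (Fin g) (Fin g) ℂ) :=
  {Z | Z.IsSymm ∧ (Z.map Complex.re).PosDef}

lemma integral_comp_mulVec {B : Matrix (Fin g) (Fin g) ℝ} (hB : B.det ≠ 0) (F : (Fin g → ℝ) → ℂ) :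
    ∫ v, F v = |B.det| * ∫ v, F (B *ᵥ v) := by
  have h1 : MeasurableEmbedding (Matrix.toLin' B) :=
    (LinearMap.continuous_of_finiteDimensional _).measurableEmbedding
      (Matrix.mulVec_injective_iff_isUnit.mpr
        ((Matrix.isUnit_iff_isUnit_det _).mpr (Ne.isUnit hB)))
  have h2 := h1.integral_map (μ := volume) F
  rw [Real.map_matrix_volume_pi_eq_smul_volume_pi hB, integral_smul_measure,
    ENNReal.toReal_ofReal (abs_nonneg _)] at h2
  simp only [Matrix.toLin'_apply] at h2
  rw [← h2, Complex.real_smul, ← mul_assoc, ← Complex.ofReal_mul, ← abs_mul, mul_inv_cancel₀ hB]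
  simp

lemma ofReal_mulVec (B : Matrix (Fin g) (Fin g) ℝ) (v : Fin g → ℝ) :
    (fun j => ((B *ᵥ v) j : ℂ)) = toC B *ᵥ fun j => (v j : ℂ) := by
  ext j
  simp [Matrix.mulVec, dotProduct]

/-- A real change of variables makes the real part of `Z` the identity and its imaginary part
diagonal, so the integral splits into one-dimensional ones with coefficients `1 + i y_j`. The
constant, its square and the formula with a linear term come out together; the constant is then
recognized as `sqrtDet Z` by taking `w = 0`. -/
lemma gaussian_integral_aux {Z : Matrix (Fin g) (Fin g) ℂ} (hZ : Z ∈ reHalfSpace g) :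
    ∃ c : ℂ, c ≠ 0 ∧ c ^ 2 = Z.det ∧ ∀ w : Fin g → ℂ,
      ∫ ξ : Euc g, Complex.exp (-(Real.pi * cquad Z ξ.ofLp) +
        2 * Real.pi * (w ⬝ᵥ fun j => (ξ j : ℂ))) =
        c⁻¹ * Complex.exp (Real.pi * (w ⬝ᵥ (Z⁻¹ *ᵥ w))) := by
  have hY : (Z.map Complex.im).IsSymm := by
    ext i j
    exact congrArg Complex.im (hZ.1.apply i j)
  obtain ⟨B, y, hB, hBX, hBY⟩ := exists_simultaneous_diagonal hZ.2 hY
  have hpi : (Real.pi : ℂ) ≠ 0 := Complex.ofReal_ne_zero.mpr Real.pi_ne_zero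
  set d : Fin g → ℂ := fun i => 1 + y i * Complex.I with hd
  have hre : ∀ i, (d i).re = 1 := fun i => by simp [hd]
  have hd0 : ∀ i, d i ≠ 0 := fun i h => by
    have := hre i
    rw [h] at this
    simp at this
  have hBZ : (toC B)ᵀ * Z * toC B = Matrix.diagonal d := by
    have hZs : Z = toC (Z.map Complex.re) + Complex.I • toC (Z.map Complex.im) := by
      ext i j
      simp [mul_comm Complex.I, Complex.re_add_im]
    have hm : ∀ X : Matrix (Fin g) (Fin g) ℝ, (toC B)ᵀ * toC X * toC B = toC (Bᵀ * X * B) := by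
      intro X
      simp only [toC]
      exact ((Matrix.map_mul (f := Complex.ofRealHom)).trans
        (congrArg (· * B.map Complex.ofReal) (Matrix.map_mul (f := Complex.ofRealHom)))).symm
    rw [hZs, Matrix.mul_add, Matrix.add_mul, Matrix.mul_smul, Matrix.smul_mul, hm, hm, hBX, hBY]
    ext i j
    by_cases h : i = j
    · subst h
      simp [hd, mul_comm]
    · simp [h]
  have hdetB : (toC B).det = (B.det : ℂ) := (RingHom.map_det Complex.ofRealHom B).symm
  have hBc : IsUnit (toC B).det := by
    rw [hdetB]
    exact (Complex.ofReal_ne_zero.mpr hB).isUnit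
  have hdetZ : Z.det * (B.det : ℂ) ^ 2 = ∏ i, d i := by
    have := congrArg Matrix.det hBZ
    rw [Matrix.det_mul, Matrix.det_mul, Matrix.det_transpose, Matrix.det_diagonal, hdetB] at this
    rw [← this]
    ring
  have hZu : IsUnit Z.det := by
    rw [isUnit_iff_ne_zero]
    intro h
    rw [h, zero_mul] at hdetZ
    exact Finset.prod_ne_zero_iff.mpr (fun i _ => hd0 i) hdetZ.symm
  have hinv : Z⁻¹ = toC B * Matrix.diagonal (fun i => (d i)⁻¹) * (toC B)ᵀ := by
    refine Matrix.inv_eq_right_inv ?_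
    have hBt : IsUnit (toC B)ᵀ.det := by rwa [Matrix.det_transpose]
    have e1 : Z * toC B = ((toC B)ᵀ)⁻¹ * Matrix.diagonal d := by
      rw [← hBZ, Matrix.mul_assoc, ← Matrix.mul_assoc ((toC B)ᵀ)⁻¹, Matrix.nonsing_inv_mul _ hBt,
        Matrix.one_mul]
    have e2 : Matrix.diagonal d * Matrix.diagonal (fun i => (d i)⁻¹) = 1 := by
      rw [Matrix.diagonal_mul_diagonal, ← Matrix.diagonal_one]
      congr 1
      funext i
      exact mul_inv_cancel₀ (hd0 i)
    rw [← Matrix.mul_assoc, ← Matrix.mul_assoc, e1, Matrix.mul_assoc _ (Matrix.diagonal d), e2,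
      Matrix.mul_one, Matrix.nonsing_inv_mul _ hBt]
  set p : ℂ := ∏ i, ((d i)⁻¹) ^ (1 / 2 : ℂ) with hp
  have hp0 : p ≠ 0 := Finset.prod_ne_zero_iff.mpr fun i _ => by
    rw [Complex.cpow_def_of_ne_zero (inv_ne_zero (hd0 i))]
    exact Complex.exp_ne_zero _
  have hpsq : p ^ 2 = (∏ i, d i)⁻¹ := by
    rw [hp, ← Finset.prod_pow, ← Finset.prod_inv_distrib]
    refine Finset.prod_congr rfl fun i _ => ?_
    rw [← Complex.cpow_nat_mul]
    simp
  have hB0 : ((|B.det| : ℝ) : ℂ) ≠ 0 := Complex.ofReal_ne_zero.mpr (abs_ne_zero.mpr hB)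
  -- The Jacobian contributes `|det B|` and the one-dimensional Gaussians contribute `p`, so this is
  -- the reciprocal of the integral at `w = 0`.
  refine ⟨(|B.det| * p)⁻¹, inv_ne_zero (mul_ne_zero hB0 hp0), ?_, fun w => ?_⟩
  · rw [inv_pow, mul_pow, hpsq, ← hdetZ, ← Complex.ofReal_pow, sq_abs, Complex.ofReal_pow]
    have : (B.det : ℂ) ≠ 0 := Complex.ofReal_ne_zero.mpr hB
    have hz := hZu.ne_zero
    field_simp
  · rw [inv_inv]
    have h1 : ∫ ξ : Euc g, Complex.exp (-(Real.pi * cquad Z ξ.ofLp) +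
        2 * Real.pi * (w ⬝ᵥ fun j => (ξ j : ℂ))) = ∫ v : Fin g → ℝ,
        Complex.exp (-(Real.pi * cquad Z v) + 2 * Real.pi * (w ⬝ᵥ fun j => (v j : ℂ))) := by
      rw [← (PiLp.volume_preserving_toLp (Fin g)).integral_comp
        (MeasurableEquiv.toLp 2 _).measurableEmbedding]
    rw [h1, integral_comp_mulVec hB, mul_assoc]
    congr 1
    set c : Fin g → ℂ := (toC B)ᵀ *ᵥ w with hc
    have h2 : ∀ v : Fin g → ℝ, -(Real.pi * cquad Z (B *ᵥ v)) +
        2 * Real.pi * (w ⬝ᵥ fun j => ((B *ᵥ v) j : ℂ)) =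
        -∑ i, (Real.pi * d i) * (v i : ℂ) ^ 2 + ∑ i, (2 * Real.pi * c i) * v i := fun v => by
      have e1 : cquad Z (B *ᵥ v) = ∑ i, d i * (v i : ℂ) ^ 2 := by
        rw [cquad, ofReal_mulVec, Matrix.mulVec_mulVec, ← Matrix.vecMul_transpose,
          ← Matrix.dotProduct_mulVec, Matrix.mulVec_mulVec, ← Matrix.mul_assoc, hBZ]
        simp only [dotProduct, Matrix.mulVec_diagonal]
        exact Finset.sum_congr rfl fun i _ => by ring
      have e2 : (w ⬝ᵥ fun j => ((B *ᵥ v) j : ℂ)) = ∑ i, c i * v i := by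
        rw [ofReal_mulVec, Matrix.dotProduct_mulVec, ← Matrix.mulVec_transpose]
        rfl
      rw [e1, e2, Finset.mul_sum, Finset.mul_sum]
      simp only [mul_assoc]
    simp only [h2]
    rw [GaussianFourier.integral_cexp_neg_sum_mul_add (fun i => by
      simp [hre, Real.pi_pos]), Finset.prod_mul_distrib, ← Complex.exp_sum]
    have h3 : w ⬝ᵥ (Z⁻¹ *ᵥ w) = ∑ i, c i ^ 2 * (d i)⁻¹ := by
      rw [hinv, ← Matrix.mulVec_mulVec, ← Matrix.mulVec_mulVec, Matrix.dotProduct_mulVec,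
        ← Matrix.mulVec_transpose, ← hc]
      simp only [dotProduct, Matrix.mulVec_diagonal]
      exact Finset.sum_congr rfl fun i _ => by ring
    have h4 : ∏ i, ((Real.pi : ℂ) / (Real.pi * d i)) ^ (1 / 2 : ℂ) = p :=
      Finset.prod_congr rfl fun i _ => by
        have := hd0 i
        congr 1
        field_simp
    have h5 : ∑ i, (2 * Real.pi * c i) ^ 2 / (4 * (Real.pi * d i)) =
        Real.pi * (w ⬝ᵥ (Z⁻¹ *ᵥ w)) := by
      rw [h3, Finset.mul_sum]
      refine Finset.sum_congr rfl fun i _ => ?_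
      have := hd0 i
      field_simp
      ring
    rw [h4, h5]

lemma sqrtDet_eq_of_integral {Z : Matrix (Fin g) (Fin g) ℂ} {c : ℂ}
    (h : ∀ w : Fin g → ℂ, ∫ ξ : Euc g, Complex.exp (-(Real.pi * cquad Z ξ.ofLp) +
        2 * Real.pi * (w ⬝ᵥ fun j => (ξ j : ℂ))) =
        c⁻¹ * Complex.exp (Real.pi * (w ⬝ᵥ (Z⁻¹ *ᵥ w)))) : sqrtDet Z = c := by
  have h0 := h 0
  simp only [zero_dotProduct, mul_zero, add_zero, Complex.exp_zero, mul_one] at h0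
  rw [sqrtDet]
  exact (congrArg Inv.inv h0).trans (inv_inv c)

lemma sqrtDet_ne_zero {Z : Matrix (Fin g) (Fin g) ℂ} (hZ : Z ∈ reHalfSpace g) : sqrtDet Z ≠ 0 := by
  obtain ⟨c, hc, -, h⟩ := gaussian_integral_aux hZ
  rwa [sqrtDet_eq_of_integral h]

lemma sqrtDet_sq {Z : Matrix (Fin g) (Fin g) ℂ} (hZ : Z ∈ reHalfSpace g) :
    sqrtDet Z ^ 2 = Z.det := by
  obtain ⟨c, -, hc, h⟩ := gaussian_integral_aux hZ
  rwa [sqrtDet_eq_of_integral h]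

lemma gaussian_integral {Z : Matrix (Fin g) (Fin g) ℂ} (hZ : Z ∈ reHalfSpace g) (w : Fin g → ℂ) :
    ∫ ξ : Euc g, Complex.exp (-(Real.pi * cquad Z ξ.ofLp) +
      2 * Real.pi * (w ⬝ᵥ fun j => (ξ j : ℂ))) =
      (sqrtDet Z)⁻¹ * Complex.exp (Real.pi * (w ⬝ᵥ (Z⁻¹ *ᵥ w))) := by
  obtain ⟨c, -, hc, h⟩ := gaussian_integral_aux hZ
  rw [sqrtDet_eq_of_integral h, h]

/-- The substitution `ξ ↦ √c ξ` has Jacobian `c^(g/2)`. -/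
lemma sqrtDet_smul (c : ℝ) (hc : 0 < c) (Z : Matrix (Fin g) (Fin g) ℂ) :
    sqrtDet ((c : ℂ) • Z) = ((c ^ ((g : ℝ) / 2) : ℝ) : ℂ) * sqrtDet Z := by
  have h1 := integral_comp_mulVec (g := g) (B := (√c) • 1)
    (by simp [Real.sqrt_ne_zero'.mpr hc])
    (fun v => Complex.exp (-(Real.pi * cquad Z v)))
  have h2 : ∀ Y : Matrix (Fin g) (Fin g) ℂ,
      sqrtDet Y = (∫ v : Fin g → ℝ, Complex.exp (-(Real.pi * cquad Y v)))⁻¹ := fun Y => by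
    rw [sqrtDet, ← (PiLp.volume_preserving_toLp (Fin g)).integral_comp
      (MeasurableEquiv.toLp 2 _).measurableEmbedding]
    rfl
  have h3 : ∀ v : Fin g → ℝ, cquad Z ((√c • (1 : Matrix (Fin g) (Fin g) ℝ)) *ᵥ v) =
      cquad ((c : ℂ) • Z) v := fun v => by
    have e1 : (fun j => (((√c • (1 : Matrix (Fin g) (Fin g) ℝ)) *ᵥ v) j : ℂ)) =
        (√c : ℂ) • fun j => (v j : ℂ) := by
      ext j
      simp [Matrix.smul_mulVec]
    rw [cquad, e1, cquad, Matrix.mulVec_smul, smul_dotProduct, dotProduct_smul, Matrix.smul_mulVec,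
      dotProduct_smul, smul_smul, ← Complex.ofReal_mul, Real.mul_self_sqrt hc.le]
  simp only [h3] at h1
  have h4 : |((√c) • (1 : Matrix (Fin g) (Fin g) ℝ)).det| = c ^ ((g : ℝ) / 2) := by
    rw [Matrix.det_smul, Matrix.det_one, mul_one, Fintype.card_fin,
      abs_of_nonneg (pow_nonneg (Real.sqrt_nonneg c) g), Real.sqrt_eq_rpow, ← Real.rpow_natCast,
      ← Real.rpow_mul hc.le]
    congr 1
    ring
  rw [h2, h2, h1, h4, mul_inv, ← mul_assoc, mul_inv_cancel₀, one_mul]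
  exact Complex.ofReal_ne_zero.mpr (Real.rpow_pos_of_pos hc _).ne'

end GaussianIntegral

/-! ### Continuity of the square root of the determinant -/

section SqrtDetContinuity

variable {g : ℕ}

lemma exists_pos_le_quad {X : Matrix (Fin g) (Fin g) ℝ} (hX : X.PosDef) :
    ∃ δ > 0, ∀ v : Euc g, δ * ‖v‖ ^ 2 ≤ quad X v := by
  obtain ⟨B, -, hB, hBX, -⟩ := exists_simultaneous_diagonal hX (Matrix.isSymm_zero (n := Fin g))
  set T := Matrix.toEuclideanCLM (𝕜 := ℝ) B with hT
  -- In the coordinates `v = B η` the form is `‖η‖²`, and `‖v‖ ≤ ‖B‖ ‖η‖`; adding `1` keeps the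
  -- denominator positive.
  refine ⟨1 / (‖T‖ + 1) ^ 2, by positivity, fun v => ?_⟩
  set η := matVec B⁻¹ v with hη
  have hv : v = matVec B η := by
    rw [hη, matVec_matVec, Matrix.mul_nonsing_inv _ (Ne.isUnit hB), matVec_one]
  have h1 : quad X v = ‖η‖ ^ 2 := by
    have h2 := inner_matVec Bᵀ η (matVec X (matVec B η))
    rw [Matrix.transpose_transpose] at h2
    rw [hv, quad_eq_inner, ← h2, matVec_matVec, matVec_matVec, hBX, matVec_one,
      real_inner_self_eq_norm_sq]
  have h3 : ‖v‖ ≤ (‖T‖ + 1) * ‖η‖ := by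
    rw [hv]
    refine (T.le_opNorm η).trans ?_
    gcongr
    linarith
  rw [h1, div_mul_eq_mul_div, one_mul, div_le_iff₀ (by positivity)]
  calc ‖v‖ ^ 2 ≤ ((‖T‖ + 1) * ‖η‖) ^ 2 := by gcongr
    _ = ‖η‖ ^ 2 * (‖T‖ + 1) ^ 2 := by ring

lemma re_cquad (Z : Matrix (Fin g) (Fin g) ℂ) (v : Euc g) :
    (cquad Z v.ofLp).re = quad (Z.map Complex.re) v := by
  simp [cquad, quad, dotProduct, Matrix.mulVec]

lemma norm_cquad_le (Z : Matrix (Fin g) (Fin g) ℂ) (v : Euc g) :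
    ‖cquad Z v.ofLp‖ ≤ (∑ i, ∑ j, ‖Z i j‖) * ‖v‖ ^ 2 := by
  have h : cquad Z v.ofLp = ∑ i, ∑ j, (v i : ℂ) * (Z i j * (v j : ℂ)) := by
    simp [cquad, dotProduct, Matrix.mulVec, Finset.mul_sum]
  rw [h, Finset.sum_mul]
  refine (norm_sum_le _ _).trans (Finset.sum_le_sum fun i _ => ?_)
  rw [Finset.sum_mul]
  refine (norm_sum_le _ _).trans (Finset.sum_le_sum fun j _ => ?_)
  have hi := PiLp.norm_apply_le v i
  have hj := PiLp.norm_apply_le v j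
  rw [norm_mul, norm_mul, Complex.norm_real, Complex.norm_real]
  calc ‖v i‖ * (‖Z i j‖ * ‖v j‖) ≤ ‖v‖ * (‖Z i j‖ * ‖v‖) := by gcongr
    _ = _ := by ring

lemma cquad_sub (Z Y : Matrix (Fin g) (Fin g) ℂ) (v : Fin g → ℝ) :
    cquad (Z - Y) v = cquad Z v - cquad Y v := by
  simp [cquad, Matrix.sub_mulVec]

lemma continuous_cquad_left (v : Fin g → ℝ) :
    Continuous fun Z : Matrix (Fin g) (Fin g) ℂ => cquad Z v := by
  unfold cquad
  fun_prop

lemma continuous_cquad_right (Z : Matrix (Fin g) (Fin g) ℂ) :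
    Continuous fun v : Euc g => cquad Z v.ofLp := by
  have h : (fun v : Euc g => cquad Z v.ofLp) =
      fun v : Euc g => ∑ i, ∑ j, (v i : ℂ) * (Z i j * (v j : ℂ)) := by
    funext v
    simp [cquad, dotProduct, Matrix.mulVec, Finset.mul_sum]
  rw [h]
  fun_prop

/-- Dominated convergence: near `Z₀` the real part of the form stays above `(δ/2) ‖ξ‖²`, so one
fixed Gaussian majorizes all integrands. -/
lemma continuousAt_sqrtDet {Z₀ : Matrix (Fin g) (Fin g) ℂ} (hZ : Z₀ ∈ reHalfSpace g) :
    ContinuousAt sqrtDet Z₀ := by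
  have hne := sqrtDet_ne_zero hZ
  obtain ⟨δ, hδ, hb⟩ := exists_pos_le_quad hZ.2
  have hnear : ∀ᶠ Z in nhds Z₀, (∑ i, ∑ j, ‖(Z - Z₀) i j‖) < δ / 2 := by
    have hc : Continuous fun Z : Matrix (Fin g) (Fin g) ℂ => ∑ i, ∑ j, ‖(Z - Z₀) i j‖ := by
      fun_prop
    refine hc.continuousAt.eventually_lt continuousAt_const ?_
    simpa using hδ
  have : FirstCountableTopology (Matrix (Fin g) (Fin g) ℂ) :=
    inferInstanceAs (FirstCountableTopology (Fin g → Fin g → ℂ))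
  have hc : 0 < Real.pi * (δ / 2) := by positivity
  have hint : ContinuousAt (fun Z => ∫ ξ : Euc g, Complex.exp (-(Real.pi * cquad Z ξ.ofLp))) Z₀ := by
    refine continuousAt_of_dominated (bound := fun ξ => ‖gaussS g (Real.pi * (δ / 2)) hc ξ‖)
      ?_ ?_ (gaussS g _ hc).integrable.norm ?_
    · refine Filter.Eventually.of_forall fun Z => Continuous.aestronglyMeasurable ?_
      exact (continuous_const.mul (continuous_cquad_right Z)).neg.cexp
    · filter_upwards [hnear] with Z hZn
      refine Filter.Eventually.of_forall fun ξ => ?_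
      rw [Complex.norm_exp, gaussS_apply, Complex.norm_real, Real.norm_eq_abs, Real.abs_exp]
      refine Real.exp_le_exp.mpr ?_
      have h1 : (cquad Z ξ.ofLp).re = (cquad Z₀ ξ.ofLp).re + (cquad (Z - Z₀) ξ.ofLp).re := by
        rw [cquad_sub, Complex.sub_re]
        ring
      have h2 : |(cquad (Z - Z₀) ξ.ofLp).re| ≤ δ / 2 * ‖ξ‖ ^ 2 :=
        (Complex.abs_re_le_norm _).trans ((norm_cquad_le _ _).trans (by gcongr))
      have h3 := (abs_le.mp h2).1
      have h4 : δ / 2 * ‖ξ‖ ^ 2 ≤ (cquad Z ξ.ofLp).re := by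
        rw [h1, re_cquad Z₀]
        linarith [hb ξ]
      rw [Complex.neg_re, Complex.re_ofReal_mul, neg_le_neg_iff, mul_assoc]
      exact mul_le_mul_of_nonneg_left h4 Real.pi_pos.le
    · refine Filter.Eventually.of_forall fun ξ => Continuous.continuousAt ?_
      exact (continuous_const.mul (continuous_cquad_left _)).neg.cexp
  exact hint.inv₀ fun h => hne (by rw [sqrtDet]; exact (congrArg Inv.inv h).trans inv_zero)

end SqrtDetContinuity

/-! ### Metaplectic operators on Gaussians and the automorphy factor -/

section Gaussians

variable {g k : ℕ} [NeZero k]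

/-- The real part of `Ω` is a chirp, and a linear substitution normalizes the imaginary part to the
standard Gaussian, so the function is obtained by automorphisms of the Schwartz space. -/
lemma exists_gaussUp (k : ℕ) [NeZero k] (Ω : SiegelUpper g) : ∃ f : 𝓢(Euc g, ℂ), ∀ v : Euc g,
    f v = Complex.exp (k * Real.pi * Complex.I * cquad Ω.1 v.ofLp) := by
  have hk : (0 : ℝ) < k := Nat.cast_pos.mpr (NeZero.pos k)
  obtain ⟨B, -, hB, hBX, -⟩ := exists_simultaneous_diagonal Ω.2.2 (Matrix.isSymm_zero (n := Fin g))
  have hBi : IsUnit B⁻¹.det := Matrix.isUnit_nonsing_inv_det _ (Ne.isUnit hB)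
  refine ⟨chirpCLE k (Ω.1.map Complex.re) (substCLE (matCLE B⁻¹ hBi)
    (gaussS g (k * Real.pi) (by positivity))), fun v => ?_⟩
  rw [chirpCLE_apply, substCLE_apply, gaussS_apply, chirp, Complex.ofReal_exp, ← Complex.exp_add]
  congr 1
  have h1 : ‖matCLE B⁻¹ hBi v‖ ^ 2 = quad (Ω.1.map Complex.im) v := by
    change ‖matVec B⁻¹ v‖ ^ 2 = _
    have hv : v = matVec B (matVec B⁻¹ v) := by
      rw [matVec_matVec, Matrix.mul_nonsing_inv _ (Ne.isUnit hB), matVec_one]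
    have h2 := inner_matVec Bᵀ (matVec B⁻¹ v) (matVec (Ω.1.map Complex.im) (matVec B (matVec B⁻¹ v)))
    rw [Matrix.transpose_transpose] at h2
    conv_rhs => rw [hv]
    rw [quad_eq_inner, ← h2, matVec_matVec Bᵀ, matVec_matVec _ B, hBX, matVec_one,
      real_inner_self_eq_norm_sq]
  have h3 : cquad Ω.1 v.ofLp =
      quad (Ω.1.map Complex.re) v + quad (Ω.1.map Complex.im) v * Complex.I := by
    apply Complex.ext
    · simp [re_cquad]
    · simp [cquad, quad, dotProduct, Matrix.mulVec]
  rw [h1, h3]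
  push_cast
  linear_combination (-(k * Real.pi * quad (Ω.1.map Complex.im) v : ℂ)) * Complex.I_mul_I

/-- The Gaussian `exp (k π i ᵗv Ω v)`. -/
def gaussUp (k : ℕ) [NeZero k] (Ω : SiegelUpper g) : 𝓢(Euc g, ℂ) := (exists_gaussUp k Ω).choose

lemma gaussUp_apply (Ω : SiegelUpper g) (v : Euc g) :
    gaussUp k Ω v = Complex.exp (k * Real.pi * Complex.I * cquad Ω.1 v.ofLp) :=
  (exists_gaussUp k Ω).choose_spec v

lemma gaussUp_zero (Ω : SiegelUpper g) : gaussUp k Ω 0 = 1 := by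
  rw [gaussUp_apply]
  simp [cquad, dotProduct]

lemma neg_I_smul_mem (Ω : SiegelUpper g) {Q : Matrix (Fin g) (Fin g) ℝ} (hQ : Q.IsSymm) :
    -(Complex.I • (Ω.1 + toC Q)) ∈ reHalfSpace g := by
  constructor
  · have h : (toC Q)ᵀ = toC Q := by
      ext i j
      simp [hQ.apply i j]
    simp only [Matrix.IsSymm, Matrix.transpose_neg, Matrix.transpose_smul, Matrix.transpose_add,
      Ω.2.1.eq, h]
  · have : (-(Complex.I • (Ω.1 + toC Q))).map Complex.re = Ω.1.map Complex.im := by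
      ext i j
      simp
    rw [this]
    exact Ω.2.2

/-- The automorphy factor of the generator `S(P, L, Q)_m`. -/
def genJ (D : GenData g) (Ω : SiegelUpper g) : ℂ :=
  Complex.I ^ (-D.m) * ((|D.L.det| ^ (-(1 / 2 : ℝ)) : ℝ) : ℂ) * sqrtDetAdd Ω D.Q

lemma iPow_add (a b : ℝ) : iPow (a + b) = iPow a * iPow b := by
  rw [iPow, iPow, iPow, ← Complex.exp_add]
  congr 1
  push_cast
  ring

lemma iPow_one : iPow 1 = Complex.I := by
  rw [iPow, show (Real.pi * Complex.I / 2 * ((1 : ℝ) : ℂ)) = (Real.pi / 2 : ℂ) * Complex.I by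
    push_cast; ring, Complex.exp_mul_I, Complex.cos_pi_div_two, Complex.sin_pi_div_two]
  simp

lemma iPow_intCast (m : ℤ) : iPow (m : ℝ) = Complex.I ^ m := by
  rw [← iPow_one, iPow, iPow, ← Complex.exp_int_mul]
  congr 1
  push_cast
  ring

lemma iPow_ne_zero (a : ℝ) : iPow a ≠ 0 := Complex.exp_ne_zero _

lemma genJ_ne_zero (D : GenData g) (Ω : SiegelUpper g) : genJ D Ω ≠ 0 := by
  refine mul_ne_zero (mul_ne_zero (zpow_ne_zero _ Complex.I_ne_zero) ?_)
    (mul_ne_zero (iPow_ne_zero _) (sqrtDet_ne_zero (neg_I_smul_mem Ω D.symm_Q)))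
  exact Complex.ofReal_ne_zero.mpr
    (Real.rpow_pos_of_pos (abs_pos.mpr D.isUnit_L.ne_zero) _).ne'

lemma upDen_genMat (D : GenData g) (Ω : SiegelUpper g) :
    upDen (genMat D) Ω.1 = toC D.L⁻¹ * (Ω.1 + toC D.Q) := by
  have h : toC (D.L⁻¹ * D.Q) = toC D.L⁻¹ * toC D.Q := Matrix.map_mul (f := Complex.ofRealHom)
  simp only [upDen, blkC, blkD, genMat, Matrix.toBlocks_fromBlocks₂₁, Matrix.toBlocks_fromBlocks₂₂]
  rw [h, Matrix.mul_add]

lemma add_isUnit (Ω : SiegelUpper g) (D : GenData g) : IsUnit (Ω.1 + toC D.Q).det := by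
  have h := upDen_isUnit (genMat D) Ω
  rw [upDen_genMat, Matrix.det_mul] at h
  exact isUnit_of_mul_isUnit_right h

/-- This form of the transformed point is the one that appears when the Gaussian integral of the
generator is evaluated. -/
lemma genMat_smul (D : GenData g) (Ω : SiegelUpper g) :
    (genMat D • Ω).1 = toC D.P - toC D.Lᵀ * (Ω.1 + toC D.Q)⁻¹ * toC D.L := by
  have hm : ∀ X Y : Matrix (Fin g) (Fin g) ℝ, toC (X * Y) = toC X * toC Y := fun X Y =>
    Matrix.map_mul (f := Complex.ofRealHom)
  have hs : toC (D.P * D.L⁻¹ * D.Q - D.Lᵀ) = toC D.P * toC D.L⁻¹ * toC D.Q - toC D.Lᵀ := by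
    rw [← hm, ← hm]
    ext i j
    simp
  have h1 : upNum (genMat D) Ω.1 = toC D.P * toC D.L⁻¹ * (Ω.1 + toC D.Q) - toC D.Lᵀ := by
    simp only [upNum, blkA, blkB, genMat, Matrix.toBlocks_fromBlocks₁₁,
      Matrix.toBlocks_fromBlocks₁₂]
    rw [hs, hm, Matrix.mul_add]
    abel
  have hi : (toC D.L⁻¹)⁻¹ = toC D.L := by
    refine Matrix.inv_eq_right_inv ?_
    rw [← hm, Matrix.nonsing_inv_mul _ D.isUnit_L]
    exact Matrix.map_one Complex.ofReal (by simp) (by simp)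
  have hl : toC D.L⁻¹ * toC D.L = 1 := by
    rw [← hm, Matrix.nonsing_inv_mul _ D.isUnit_L]
    exact Matrix.map_one Complex.ofReal (by simp) (by simp)
  change upNum _ _ * (upDen _ _)⁻¹ = _
  rw [h1, upDen_genMat, Matrix.mul_inv_rev, hi, Matrix.sub_mul]
  congr 1
  · rw [Matrix.mul_assoc, ← Matrix.mul_assoc _ _ (toC D.L), Matrix.mul_nonsing_inv _ (add_isUnit Ω D),
      Matrix.one_mul, Matrix.mul_assoc, hl, Matrix.mul_one]
  · rw [Matrix.mul_assoc]

/-- The condition on `m` supplies the sign that turns `|det L|⁻¹` into `(det L)⁻¹`, and the powers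
of `i` and `-i` cancel. -/
lemma genJ_sq (D : GenData g) (Ω : SiegelUpper g) :
    genJ D Ω ^ 2 = (upDen (genMat D) Ω.1).det := by
  have hL := D.isUnit_L.ne_zero
  have hdet : (toC D.L⁻¹).det = ((D.L.det)⁻¹ : ℝ) := by
    rw [← Ring.inverse_eq_inv', ← Matrix.det_nonsing_inv]
    exact (RingHom.map_det Complex.ofRealHom D.L⁻¹).symm
  have h1 : (Complex.I ^ (-D.m)) ^ 2 = ((SignType.sign D.L.det : ℝ) : ℂ) := by
    rw [zpow_neg, inv_pow, D.sq_m]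
    rcases lt_or_gt_of_ne hL with h | h
    · simp [sign_neg h]
    · simp [sign_pos h]
  have h2 : ((|D.L.det| ^ (-(1 / 2 : ℝ)) : ℝ) : ℂ) ^ 2 = ((|D.L.det|⁻¹ : ℝ) : ℂ) := by
    rw [← Complex.ofReal_pow, ← Real.rpow_natCast, ← Real.rpow_mul (abs_nonneg _),
      ← Real.rpow_neg_one]
    norm_num
  have h3 : (iPow ((g : ℝ) / 2)) ^ 2 = Complex.I ^ g := by
    rw [sq, ← iPow_add, add_halves, ← zpow_natCast, ← iPow_intCast]
    simp
  have h4 : ((SignType.sign D.L.det : ℝ) : ℂ) * ((|D.L.det|⁻¹ : ℝ) : ℂ) = ((D.L.det)⁻¹ : ℝ) := by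
    rw [← Complex.ofReal_mul]
    congr 1
    rcases lt_or_gt_of_ne hL with h | h
    · rw [sign_neg h, abs_of_neg h, inv_neg]
      simp
    · simp [sign_pos h, abs_of_pos h]
  have h5 : Complex.I ^ g * (-Complex.I) ^ g = 1 := by
    rw [← mul_pow]
    simp
  rw [genJ, sqrtDetAdd, mul_pow, mul_pow, mul_pow, h1, h2, h3, h4,
    sqrtDet_sq (neg_I_smul_mem Ω D.symm_Q), upDen_genMat, Matrix.det_mul, hdet, ← neg_smul,
    Matrix.det_smul, Fintype.card_fin, ← mul_assoc (Complex.I ^ g), h5, one_mul]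

/-- The kernel times a Gaussian is the exponential of a quadratic plus a linear form in `v`. The
integral gives a Gaussian in `u` whose matrix is the Möbius transform, and a constant which is the
reciprocal of the automorphy factor. -/
lemma genS_gaussUp (D : GenData g) (Ω : SiegelUpper g) :
    genS k D (gaussUp k Ω) = (genJ D Ω)⁻¹ • gaussUp k (genMat D • Ω) := by
  have hk : (0 : ℝ) < k := Nat.cast_pos.mpr (NeZero.pos k)
  have hk0 : (k : ℂ) ≠ 0 := Nat.cast_ne_zero.mpr (NeZero.ne k)
  have hkp : (k : ℝ) ^ ((g : ℝ) / 2) ≠ 0 := (Real.rpow_pos_of_pos hk _).ne'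
  set Y := Ω.1 + toC D.Q with hY
  have hmem := neg_I_smul_mem Ω D.symm_Q
  have hYu : IsUnit Y.det := add_isUnit Ω D
  -- With this `Z` the quadratic exponent `k π i ᵗv (Ω + Q) v` equals `-π ᵗv Z v`.
  set Z : Matrix (Fin g) (Fin g) ℂ := ((k : ℝ) : ℂ) • (-(Complex.I • Y)) with hZ
  have hZmem : Z ∈ reHalfSpace g := by
    refine ⟨?_, ?_⟩
    · rw [hZ, Matrix.IsSymm, Matrix.transpose_smul, hmem.1.eq]
    · have : Z.map Complex.re = (k : ℝ) • (-(Complex.I • Y)).map Complex.re := by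
        ext i j
        simp [hZ]
      rw [this]
      exact hmem.2.smul hk
  have hZinv : Z⁻¹ = (Complex.I * (k : ℂ)⁻¹) • Y⁻¹ := by
    refine Matrix.inv_eq_right_inv ?_
    rw [hZ, Matrix.smul_mul, Matrix.neg_mul, Matrix.smul_mul, Matrix.mul_smul,
      Matrix.mul_nonsing_inv _ hYu, smul_smul, ← neg_smul, smul_smul]
    have : ((k : ℝ) : ℂ) * -(Complex.I * (Complex.I * (k : ℂ)⁻¹)) = 1 := by
      rw [← mul_assoc Complex.I, Complex.I_mul_I]
      push_cast
      field_simp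
    rw [this, one_smul]
  ext u
  rw [genS_apply_fourier, SchwartzMap.fourier_coe, Real.fourier_eq']
  -- The Fourier phase at frequency `k L u` equals `exp (2 π ᵗw v)`.
  set w : Fin g → ℂ := fun j => -Complex.I * k * ((D.L *ᵥ u.ofLp) j : ℂ) with hw
  have hcq : ∀ v : Euc g, cquad Y v.ofLp = cquad Ω.1 v.ofLp + quad D.Q v := fun v => by
    simp [cquad, quad, hY, dotProduct, Matrix.mulVec, add_mul, mul_add, Finset.sum_add_distrib]
  have hint : ∀ v : Euc g, Complex.exp (((-2 * Real.pi * inner ℝ v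
      (WithLp.toLp 2 (((k : ℝ) • D.L) *ᵥ u.ofLp)) : ℝ) : ℂ) * Complex.I) •
      chirpCLE k D.Q (gaussUp k Ω) v = Complex.exp (-(Real.pi * cquad Z v.ofLp) +
        2 * Real.pi * (w ⬝ᵥ fun j => (v j : ℂ))) := fun v => by
    rw [chirpCLE_apply, gaussUp_apply, chirp, smul_eq_mul, ← Complex.exp_add, ← Complex.exp_add]
    congr 1
    have e1 : cquad Z v.ofLp = -(k * Complex.I) * cquad Y v.ofLp := by
      rw [cquad, hZ, ← neg_smul, smul_smul, Matrix.smul_mulVec, dotProduct_smul, smul_eq_mul, cquad]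
      push_cast
      ring
    have e2 : (w ⬝ᵥ fun j => (v j : ℂ)) = -Complex.I * (inner ℝ v
        (WithLp.toLp 2 (((k : ℝ) • D.L) *ᵥ u.ofLp)) : ℝ) := by
      rw [inner_eq_dotProduct, Matrix.smul_mulVec]
      simp only [hw, dotProduct, Pi.smul_apply, smul_eq_mul]
      push_cast
      rw [Finset.mul_sum]
      exact Finset.sum_congr rfl fun i _ => by ring
    rw [e1, e2, hcq]
    push_cast
    ring
  simp only [hint]
  rw [gaussian_integral hZmem, hZ, sqrtDet_smul _ hk]
  have hquad : (Real.pi : ℂ) * (w ⬝ᵥ (Z⁻¹ *ᵥ w)) = k * Real.pi * Complex.I *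
      -(cquad (toC D.Lᵀ * Y⁻¹ * toC D.L) u.ofLp) := by
    have e1 : w = (-Complex.I * k) • (toC D.L *ᵥ fun j => (u j : ℂ)) := by
      rw [← ofReal_mulVec]
      rfl
    have e2 : cquad (toC D.Lᵀ * Y⁻¹ * toC D.L) u.ofLp =
        (toC D.L *ᵥ fun j => (u j : ℂ)) ⬝ᵥ (Y⁻¹ *ᵥ (toC D.L *ᵥ fun j => (u j : ℂ))) := by
      rw [cquad, ← Matrix.mulVec_mulVec, ← Matrix.mulVec_mulVec, Matrix.dotProduct_mulVec,
        ← Matrix.mulVec_transpose]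
      rfl
    rw [hZinv, e1, e2, Matrix.smul_mulVec, Matrix.mulVec_smul, smul_dotProduct, dotProduct_smul,
      dotProduct_smul]
    simp only [smul_eq_mul]
    have h3 := Complex.I_mul_I
    field_simp
    linear_combination ((toC D.L *ᵥ fun j => (u j : ℂ)) ⬝ᵥ
      (Y⁻¹ *ᵥ (toC D.L *ᵥ fun j => (u j : ℂ)))) * h3
  have hP : cquad (toC D.P) u.ofLp = quad D.P u := by
    simp [cquad, quad, dotProduct, Matrix.mulVec]
  -- The powers of `i` and of `|det L|` in the two constants are reciprocal; what is left is the
  -- square root for `Z`, with `k^(g/2)` split off.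
  have hconst : genConst k D * genJ D Ω =
      (((k : ℝ) ^ ((g : ℝ) / 2) : ℝ) : ℂ) * sqrtDet (-(Complex.I • Y)) := by
    have hL : 0 < |D.L.det| := abs_pos.mpr D.isUnit_L.ne_zero
    have e1 : ((√|D.L.det| : ℝ) : ℂ) * ((|D.L.det| ^ (-(1 / 2 : ℝ)) : ℝ) : ℂ) = 1 := by
      rw [← Complex.ofReal_mul, Real.sqrt_eq_rpow, ← Real.rpow_add hL]
      simp
    have e2 : iPow (-(g : ℝ) / 2 + D.m) * (Complex.I ^ (-D.m) * iPow ((g : ℝ) / 2)) = 1 := by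
      rw [← iPow_intCast, ← iPow_add, ← iPow_add]
      have : -(g : ℝ) / 2 + D.m + ((-D.m : ℤ) + (g : ℝ) / 2) = 0 := by
        push_cast
        ring
      rw [this, iPow]
      simp
    rw [genConst, genJ, sqrtDetAdd, Complex.ofReal_mul]
    linear_combination (iPow (-(g : ℝ) / 2 + D.m) * (Complex.I ^ (-D.m) * iPow ((g : ℝ) / 2)) *
      (((k : ℝ) ^ ((g : ℝ) / 2) : ℝ) : ℂ) * sqrtDet (-(Complex.I • Y))) * e1 +
      ((((k : ℝ) ^ ((g : ℝ) / 2) : ℝ) : ℂ) * sqrtDet (-(Complex.I • Y))) * e2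
  change _ = (genJ D Ω)⁻¹ • gaussUp k (genMat D • Ω) u
  have hs0 : sqrtDet (-(Complex.I • Y)) ≠ 0 := sqrtDet_ne_zero hmem
  have hkc : (((k : ℝ) ^ ((g : ℝ) / 2) : ℝ) : ℂ) ≠ 0 := Complex.ofReal_ne_zero.mpr hkp
  have hJ := genJ_ne_zero D Ω
  have hexp : chirp k D.P u * Complex.exp (Real.pi * (w ⬝ᵥ (Z⁻¹ *ᵥ w))) =
      gaussUp k (genMat D • Ω) u := by
    rw [gaussUp_apply, genMat_smul, cquad_sub, hquad, chirp, ← Complex.exp_add, hP]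
    congr 1
    push_cast
    ring
  have hfin : genConst k D * ((((k : ℝ) ^ ((g : ℝ) / 2) : ℝ) : ℂ) * sqrtDet (-(Complex.I • Y)))⁻¹ =
      (genJ D Ω)⁻¹ := by
    rw [← hconst]
    have := genConst_ne_zero k D
    field_simp
  rw [← hexp, ← hfin, smul_eq_mul]
  ring

/-- The automorphy factor of a metaplectic operator, read off from its action on Gaussians. -/
def jFac (A : Mp g k) (Ω : SiegelUpper g) : ℂ := (A.1 (gaussUp k Ω) 0)⁻¹

lemma jFac_eq {A : Mp g k} {Ω Ω' : SiegelUpper g} {c : ℂ}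
    (h : A.1 (gaussUp k Ω) = c⁻¹ • gaussUp k Ω') : jFac A Ω = c := by
  rw [jFac, h]
  change (c⁻¹ • gaussUp k Ω' 0)⁻¹ = c
  rw [gaussUp_zero]
  simp

/-- Proportionality of Gaussians, nonvanishing and the formula for the square are carried through
the induction together, because the inverse step needs a nonzero factor. -/
lemma exists_jFac (A : Mp g k) (Ω : SiegelUpper g) : ∃ c : ℂ,
    A.1 (gaussUp k Ω) = c⁻¹ • gaussUp k (covHom g k A • Ω) ∧ c ≠ 0 ∧
      c ^ 2 = (upDen (covHom g k A) Ω.1).det := by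
  revert Ω
  refine mp_induction (p := fun A => ∀ Ω, ∃ c : ℂ,
    A.1 (gaussUp k Ω) = c⁻¹ • gaussUp k (covHom g k A • Ω) ∧ c ≠ 0 ∧
      c ^ 2 = (upDen (covHom g k A) Ω.1).det) (fun D Ω => ?_) (fun Ω => ?_) ?_ ?_ A
  · rw [covHom_gen]
    exact ⟨genJ D Ω, genS_gaussUp D Ω, genJ_ne_zero D Ω, genJ_sq D Ω⟩
  · refine ⟨1, ?_, one_ne_zero, ?_⟩
    · rw [map_one, one_smul, inv_one, one_smul]
      rfl
    · rw [map_one, upDen_one, Matrix.det_one, one_pow]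
  · intro A B hA hB Ω
    obtain ⟨b, hb, hb0, hb2⟩ := hB Ω
    obtain ⟨a, ha, ha0, ha2⟩ := hA (covHom g k B • Ω)
    refine ⟨a * b, ?_, mul_ne_zero ha0 hb0, ?_⟩
    · change A.1 (B.1 _) = _
      rw [hb, map_smul, ha, map_mul, mul_smul (covHom g k A), smul_smul, mul_inv, mul_comm]
    · rw [mul_pow, ha2, hb2, map_mul, upDen_mul, Matrix.det_mul]
  · intro A hA Ω
    obtain ⟨a, ha, ha0, ha2⟩ := hA ((covHom g k A)⁻¹ • Ω)
    rw [smul_inv_smul] at ha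
    refine ⟨a⁻¹, ?_, inv_ne_zero ha0, ?_⟩
    · change A.1.symm (gaussUp k Ω) = _
      rw [map_inv, inv_inv, A.1.symm_apply_eq, map_smul, ha, smul_smul, mul_inv_cancel₀ ha0, one_smul]
    · have h := upDen_mul (covHom g k A) (covHom g k A)⁻¹ Ω
      rw [mul_inv_cancel, upDen_one] at h
      have h2 := congrArg Matrix.det h
      rw [Matrix.det_mul, Matrix.det_one, ← ha2] at h2
      rw [map_inv, inv_pow]
      exact (eq_inv_of_mul_eq_one_right h2.symm).symm

lemma mp_gaussUp (A : Mp g k) (Ω : SiegelUpper g) :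
    A.1 (gaussUp k Ω) = (jFac A Ω)⁻¹ • gaussUp k (covHom g k A • Ω) := by
  obtain ⟨c, hc, -⟩ := exists_jFac A Ω
  rw [jFac_eq hc, hc]

lemma jFac_ne_zero (A : Mp g k) (Ω : SiegelUpper g) : jFac A Ω ≠ 0 := by
  obtain ⟨c, hc, h0, -⟩ := exists_jFac A Ω
  rwa [jFac_eq hc]

lemma jFac_sq (A : Mp g k) (Ω : SiegelUpper g) :
    jFac A Ω ^ 2 = (upDen (covHom g k A) Ω.1).det := by
  obtain ⟨c, hc, -, h2⟩ := exists_jFac A Ω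
  rwa [jFac_eq hc]

lemma jFac_gen (D : GenData g) (Ω : SiegelUpper g) : jFac (mpGen k D) Ω = genJ D Ω :=
  jFac_eq (genS_gaussUp D Ω)

/-- The cocycle law is composition of operators: the factors are scalars of genuine operators, so no
ambiguity of sign arises. -/
lemma jFac_mul (A B : Mp g k) (Ω : SiegelUpper g) :
    jFac (A * B) Ω = jFac A (covHom g k B • Ω) * jFac B Ω := by
  refine jFac_eq (Ω' := covHom g k A • covHom g k B • Ω) ?_
  change A.1 (B.1 _) = _
  rw [mp_gaussUp, map_smul, mp_gaussUp, smul_smul, mul_inv, mul_comm]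

end Gaussians

/-! ### The kernel has order two -/

section CoveringTheorem

variable {g k : ℕ} [NeZero k]

/-- The operator is a scalar, and the squared automorphy factor over the identity matrix is `det 1 =
1`. -/
lemma eq_or_neg_of_cov_eq_one (A : Mp g k) (hA : covHom g k A = 1) :
    (∀ f, A.1 f = f) ∨ ∀ f, A.1 f = -f := by
  obtain ⟨c, hc⟩ := exists_scalar_of_cov_eq_one A hA
  have h1 : jFac A (upI g) = c⁻¹ := jFac_eq (Ω' := upI g) (by rw [inv_inv, hc])
  have h2 := jFac_sq A (upI g)
  rw [h1, hA, upDen_one, Matrix.det_one, inv_pow, inv_eq_one] at h2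
  rcases eq_or_eq_neg_of_sq_eq_sq c 1 (by rw [h2, one_pow]) with rfl | rfl
  · exact Or.inl fun f => by rw [hc, one_smul]
  · exact Or.inr fun f => by rw [hc, neg_one_smul]

/-- The generator with `P = Q = 0`, `L = 1`, `m = 2`. -/
def twistData (g : ℕ) : GenData g := { scalarData g 0 with
  m := 2
  sq_m := by simp [scalarData] }

lemma genMat_twistData : genMat (twistData g) = genMat (scalarData g 0) := rfl

/-- The element `-1` of the metaplectic group. -/
def negMp (g k : ℕ) [NeZero k] : Mp g k := mpGen k (twistData g) * (mpGen k (scalarData g 0))⁻¹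

/-- The two generators differ only in `m`, by `2`, hence by the scalar `i² = -1`. -/
lemma negMp_apply (f : 𝓢(Euc g, ℂ)) : (negMp g k).1 f = -f := by
  have h : ∀ f, genS k (twistData g) f = -genS k (scalarData g 0) f := fun f => by
    ext u
    change _ = -(genS k (scalarData g 0) f u)
    rw [genS_apply_fourier, genS_apply_fourier]
    have hc : genConst k (twistData g) = -genConst k (scalarData g 0) := by
      have h2 : iPow (-(g : ℝ) / 2 + (2 : ℤ)) = -iPow (-(g : ℝ) / 2 + (0 : ℤ)) := by
        rw [iPow_add, iPow_add, iPow_intCast, iPow_intCast]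
        simp
      simp only [genConst, twistData]
      rw [h2]
      simp [scalarData]
    rw [hc, neg_mul]
    rfl
  change genS k (twistData g) ((genS k (scalarData g 0)).symm f) = -f
  rw [h, (genS k (scalarData g 0)).apply_symm_apply]

lemma covHom_negMp : covHom g k (negMp g k) = 1 := by
  rw [negMp, map_mul, map_inv, covHom_gen, covHom_gen, genMat_twistData, mul_inv_cancel]

lemma mp_ext {A B : Mp g k} (h : ∀ f, A.1 f = B.1 f) : A = B :=
  Subtype.ext (ContinuousLinearEquiv.ext (funext h))

lemma negMp_ne_one : negMp g k ≠ 1 := by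
  intro h
  have h1 := negMp_apply (k := k) (gaussUp k (upI g))
  rw [h] at h1
  have h2 := congrArg (fun f : 𝓢(Euc g, ℂ) => f 0) h1
  change gaussUp k (upI g) 0 = -(gaussUp k (upI g) 0) at h2
  rw [gaussUp_zero] at h2
  norm_num at h2

lemma eq_one_or_eq_negMp {A : Mp g k} (hA : covHom g k A = 1) : A = 1 ∨ A = negMp g k := by
  rcases eq_or_neg_of_cov_eq_one A hA with h | h
  · exact Or.inl (mp_ext h)
  · exact Or.inr (mp_ext fun f => by rw [h, negMp_apply])

lemma card_ker_covHom : Nat.card (covHom g k).ker = 2 := by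
  rw [Nat.card_eq_two_iff]
  refine ⟨1, ⟨negMp g k, covHom_negMp⟩, fun h => negMp_ne_one (congrArg Subtype.val h).symm, ?_⟩
  refine Set.eq_univ_of_forall fun ⟨A, hA⟩ => ?_
  rcases eq_one_or_eq_negMp hA with rfl | rfl
  · exact Or.inl rfl
  · exact Or.inr rfl

lemma isMetaplecticCovering_covHom : IsMetaplecticCovering (covHom g k) where
  map_gen D := congrArg Subtype.val (covHom_gen D)
  surjective := covHom_surjective
  card_ker := card_ker_covHom

lemma eq_covHom {cov : Mp g k →* Sp g} (h : IsMetaplecticCovering cov) : cov = covHom g k :=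
  mp_hom_ext fun D => Subtype.ext ((h.map_gen D).trans
    (isMetaplecticCovering_covHom.map_gen D).symm)

theorem existsUnique_metaplecticCovering : ∃! cov : Mp g k →* Sp g, IsMetaplecticCovering cov :=
  ⟨covHom g k, isMetaplecticCovering_covHom, fun _ h => eq_covHom h⟩

end CoveringTheorem

/-! ### The Cayley transform and the open disc -/

section CayleyTransform

variable {g : ℕ}

lemma cay_mul_frame (Ω : SiegelUpper g) :
    cay g * frame Ω.1 = frame (cayley Ω).1 * (Complex.I • 1 + Ω.1) := by
  have h : (cayley Ω).1 * (Complex.I • 1 + Ω.1) = Complex.I • 1 - Ω.1 := by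
    change (Complex.I • 1 - Ω.1) * (Complex.I • 1 + Ω.1)⁻¹ * _ = _
    rw [Matrix.mul_assoc, Matrix.nonsing_inv_mul _ (upper_isUnit Ω), Matrix.mul_one]
  rw [frame, frame, cay, Matrix.fromBlocks_mul_fromRows, Matrix.fromRows_mul, h]
  congr 1
  · simp only [Matrix.neg_mul, Matrix.one_mul, Matrix.mul_one]
    abel
  · simp only [Matrix.one_mul, Matrix.mul_one]
    abel

/-- Applying the Cayley matrix and `M` to the frame of `Ω` in either order gives equivariance from
one block and a relation between the denominators from the other. The factor `2` comes from the
normalization of `discMat`. -/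
lemma cayley_smul_and_den (M : Sp g) (Ω : SiegelUpper g) :
    (M • cayley Ω).1 = (cayley (M • Ω)).1 ∧
      discDen M (cayley Ω).1 * (Complex.I • 1 + Ω.1) =
        (2 : ℂ) • ((Complex.I • 1 + (M • Ω).1) * upDen M Ω.1) := by
  refine frame_mul_inj ?_ ?_
  · rw [Matrix.det_mul]
    exact (discDen_isUnit M _).mul (upper_isUnit Ω)
  · rw [← Matrix.mul_assoc, ← frame_smul, Matrix.mul_assoc, ← cay_mul_frame, Matrix.mul_smul,
      ← Matrix.mul_assoc (frame _), ← cay_mul_frame, Matrix.mul_assoc (cay g) (frame _),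
      ← toC_mul_frame_upper, discMat]
    calc cay g * toC M.1 * cayInv g * (cay g * frame Ω.1)
        = cay g * toC M.1 * (cayInv g * cay g) * frame Ω.1 := by simp only [Matrix.mul_assoc]
      _ = _ := by
        rw [cayInv_mul_cay, Matrix.mul_smul, Matrix.mul_one, Matrix.smul_mul, Matrix.mul_assoc]

lemma cayley_smul (M : Sp g) (Ω : SiegelUpper g) : cayley (M • Ω) = M • cayley Ω :=
  Subtype.ext (cayley_smul_and_den M Ω).1.symm

lemma det_discDen_cayley (M : Sp g) (Ω : SiegelUpper g) :
    (discDen M (cayley Ω).1).det * (Complex.I • 1 + Ω.1).det =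
      2 ^ g * (Complex.I • 1 + (M • Ω).1).det * (upDen M Ω.1).det := by
  have h := congrArg Matrix.det (cayley_smul_and_den M Ω).2
  rw [Matrix.det_mul, Matrix.det_smul, Matrix.det_mul, Fintype.card_fin] at h
  rw [h, mul_assoc]

lemma one_add_cayley (Ω : SiegelUpper g) :
    1 + (cayley Ω).1 = (2 * Complex.I) • (Complex.I • 1 + Ω.1)⁻¹ := by
  have h := Matrix.mul_nonsing_inv _ (upper_isUnit Ω)
  change 1 + (Complex.I • 1 - Ω.1) * (Complex.I • 1 + Ω.1)⁻¹ = _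
  nth_rewrite 1 [← h]
  rw [← Matrix.add_mul]
  have : (Complex.I • 1 + Ω.1) + (Complex.I • 1 - Ω.1) =
      (2 * Complex.I) • (1 : Matrix (Fin g) (Fin g) ℂ) := by
    module
  rw [this, Matrix.smul_mul, Matrix.one_mul]

lemma det_one_add_cayley (Ω : SiegelUpper g) :
    (1 + (cayley Ω).1).det * (Complex.I • 1 + Ω.1).det = (2 * Complex.I) ^ g := by
  rw [one_add_cayley, Matrix.det_smul, Fintype.card_fin, mul_assoc, ← Matrix.det_mul,
    Matrix.nonsing_inv_mul _ (upper_isUnit Ω), Matrix.det_one, mul_one]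

lemma add_conjTranspose_eq {Z : Matrix (Fin g) (Fin g) ℂ} (hZ : Z.IsSymm) :
    Z + Zᴴ = (2 : ℂ) • toC (Z.map Complex.re) := by
  ext i j
  simp only [Matrix.add_apply, Matrix.conjTranspose_apply, hZ.apply i j, Matrix.smul_apply,
    Matrix.map_apply, smul_eq_mul, Complex.star_def, Complex.add_conj]
  push_cast
  ring

/-- With `V = i + Ω`, the real part of `1 + τ` is congruent through `V⁻¹` to `2 (1 + Im Ω)`. So the
Gaussian branch of `√det (1 + τ)` is defined on the whole open disc. -/
lemma one_add_cayley_mem (Ω : SiegelUpper g) : 1 + (cayley Ω).1 ∈ reHalfSpace g := by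
  have hs : (1 + (cayley Ω).1).IsSymm := Matrix.isSymm_one.add (cayley Ω).2.1
  refine ⟨hs, posDef_of_toC ?_⟩
  have hV := upper_isUnit Ω
  have hVh : IsUnit (Complex.I • 1 + Ω.1)ᴴ.det := by rw [Matrix.det_conjTranspose]; exact hV.star
  set V := Complex.I • 1 + Ω.1 with hVdef
  have e1 : V - Vᴴ = (2 * Complex.I) • (1 + toC (Ω.1.map Complex.im)) := by
    rw [smul_add, ← sub_conjTranspose_eq, hVdef, Matrix.conjTranspose_add,
      Matrix.conjTranspose_smul, Matrix.conjTranspose_one, Complex.star_def, Complex.conj_I]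
    module
  have e2 : (1 + (cayley Ω).1) + (1 + (cayley Ω).1)ᴴ =
      (V⁻¹)ᴴ * ((4 : ℂ) • (1 + toC (Ω.1.map Complex.im))) * V⁻¹ := by
    have e3 : (4 : ℂ) • (1 + toC (Ω.1.map Complex.im)) = (-2 * Complex.I) • (V - Vᴴ) := by
      rw [e1, smul_smul]
      congr 1
      linear_combination (4 : ℂ) * Complex.I_mul_I
    rw [e3, one_add_cayley, ← hVdef, Matrix.conjTranspose_smul, Matrix.mul_smul, Matrix.smul_mul,
      Matrix.mul_sub, Matrix.sub_mul, Matrix.mul_assoc, Matrix.mul_nonsing_inv _ hV, Matrix.mul_one,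
      Matrix.conjTranspose_nonsing_inv, Matrix.nonsing_inv_mul _ hVh, Matrix.one_mul]
    simp only [star_mul', Complex.star_def, Complex.conj_I, map_ofNat]
    module
  rw [add_conjTranspose_eq hs] at e2
  have e4 : toC ((1 + (cayley Ω).1).map Complex.re) =
      (V⁻¹)ᴴ * ((2 : ℂ) • (1 + toC (Ω.1.map Complex.im))) * V⁻¹ := by
    refine smul_right_injective _ (two_ne_zero : (2 : ℂ) ≠ 0) ?_
    change (2 : ℂ) • _ = (2 : ℂ) • _
    rw [e2, ← Matrix.smul_mul, ← Matrix.mul_smul, smul_smul]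
    norm_num
  rw [e4]
  refine ((Matrix.PosDef.one.add (toC_posDef Ω.2.2)).smul
    (by norm_num : (0 : ℂ) < 2)).conjTranspose_mul_mul_same ?_
  refine Matrix.mulVec_injective_iff_isUnit.mpr ?_
  rw [Matrix.isUnit_iff_isUnit_det]
  exact Matrix.isUnit_nonsing_inv_det _ hV

/-- The preimage is `i (1 - τ) (1 + τ)⁻¹`. Strict positivity excludes the eigenvalue `-1` of `τ` and
makes the imaginary part positive definite. -/
lemma exists_cayley_eq (τ : SiegelDisc g) (h : (1 - τ.1ᴴ * τ.1).PosDef) : ∃ Ω, cayley Ω = τ := by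
  have hU : IsUnit (1 + τ.1).det := by
    rw [isUnit_iff_ne_zero]
    intro h0
    obtain ⟨v, hv, hv0⟩ := Matrix.exists_mulVec_eq_zero_iff.mpr h0
    have h1 : τ.1 *ᵥ v = -v := by
      rw [Matrix.add_mulVec, Matrix.one_mulVec] at hv0
      exact (neg_eq_of_add_eq_zero_right hv0).symm
    have h2 := h.dotProduct_mulVec_pos hv
    rw [Matrix.sub_mulVec, dotProduct_sub, ← Matrix.mulVec_mulVec, Matrix.dotProduct_mulVec _ τ.1ᴴ,
      ← Matrix.star_mulVec, h1, Matrix.one_mulVec, star_neg, neg_dotProduct, dotProduct_neg,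
      neg_neg, sub_self] at h2
    exact lt_irrefl _ h2
  have hUh : IsUnit (1 + τ.1)ᴴ.det := by rw [Matrix.det_conjTranspose]; exact hU.star
  set V := 1 + τ.1 with hV
  have hVs : Vᵀ = V := by rw [hV, Matrix.transpose_add, Matrix.transpose_one, τ.2.1.eq]
  have hτs : (1 - τ.1)ᵀ = 1 - τ.1 := by rw [Matrix.transpose_sub, Matrix.transpose_one, τ.2.1.eq]
  have hc : (1 - τ.1) * V = V * (1 - τ.1) := by
    rw [hV]
    noncomm_ring
  set Z := Complex.I • ((1 - τ.1) * V⁻¹) with hZ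
  have hs : Z.IsSymm := by
    rw [hZ, Matrix.IsSymm, Matrix.transpose_smul, Matrix.transpose_mul,
      Matrix.transpose_nonsing_inv, hVs, hτs]
    congr 1
    calc V⁻¹ * (1 - τ.1) = V⁻¹ * ((1 - τ.1) * V) * V⁻¹ := by
          rw [Matrix.mul_assoc, Matrix.mul_assoc, Matrix.mul_nonsing_inv _ hU, Matrix.mul_one]
      _ = _ := by rw [hc, ← Matrix.mul_assoc, Matrix.nonsing_inv_mul _ hU, Matrix.one_mul]
  have him : (Z.map Complex.im).PosDef := by
    refine posDef_of_toC ?_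
    have e1 : Z - Zᴴ = (2 * Complex.I) • toC (Z.map Complex.im) := by
      ext i j
      simp only [Matrix.smul_apply, Matrix.sub_apply, Matrix.conjTranspose_apply, hs.apply i j,
        Matrix.map_apply, smul_eq_mul, Complex.star_def, Complex.sub_conj]
      push_cast
      ring
    have e2 : Z - Zᴴ = (2 * Complex.I) • ((V⁻¹)ᴴ * (1 - τ.1ᴴ * τ.1) * V⁻¹) := by
      have e3 : Vᴴ * (1 - τ.1) + (1 - τ.1)ᴴ * V = (2 : ℂ) • (1 - τ.1ᴴ * τ.1) := by
        rw [hV, Matrix.conjTranspose_add, Matrix.conjTranspose_sub, Matrix.conjTranspose_one,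
          two_smul]
        noncomm_ring
      have e4 : (1 - τ.1) * V⁻¹ = (V⁻¹)ᴴ * (Vᴴ * (1 - τ.1)) * V⁻¹ := by
        rw [← Matrix.mul_assoc, Matrix.conjTranspose_nonsing_inv, Matrix.nonsing_inv_mul _ hUh,
          Matrix.one_mul]
      have e5 : (V⁻¹)ᴴ * (1 - τ.1)ᴴ = (V⁻¹)ᴴ * ((1 - τ.1)ᴴ * V) * V⁻¹ := by
        rw [Matrix.mul_assoc, Matrix.mul_assoc, Matrix.mul_nonsing_inv _ hU, Matrix.mul_one]
      have e7 : (2 : ℂ) • ((V⁻¹)ᴴ * (1 - τ.1ᴴ * τ.1) * V⁻¹) =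
          (1 - τ.1) * V⁻¹ + (V⁻¹)ᴴ * (1 - τ.1)ᴴ := by
        rw [e4, e5, ← Matrix.add_mul, ← Matrix.mul_add, e3, Matrix.mul_smul, Matrix.smul_mul]
      rw [mul_comm (2 : ℂ), ← smul_smul, e7, hZ, Matrix.conjTranspose_smul,
        Matrix.conjTranspose_mul, Complex.star_def, Complex.conj_I]
      module
    rw [e2] at e1
    have e6 := smul_right_injective _ (by simp : (2 * Complex.I : ℂ) ≠ 0) e1
    rw [← e6]
    refine h.conjTranspose_mul_mul_same ?_
    refine Matrix.mulVec_injective_iff_isUnit.mpr ?_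
    rw [Matrix.isUnit_iff_isUnit_det]
    exact Matrix.isUnit_nonsing_inv_det _ hU
  refine ⟨⟨Z, hs, him⟩, Subtype.ext ?_⟩
  have h1 : Complex.I • (1 : Matrix (Fin g) (Fin g) ℂ) = Complex.I • (V * V⁻¹) := by
    rw [Matrix.mul_nonsing_inv _ hU]
  have h2 : Complex.I • 1 + Z = (2 * Complex.I) • V⁻¹ := by
    have e : V + (1 - τ.1) = (2 : ℂ) • 1 := by rw [hV]; module
    rw [hZ, h1, ← smul_add, ← Matrix.add_mul, e, Matrix.smul_mul, Matrix.one_mul, smul_smul,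
      mul_comm]
  have h3 : Complex.I • 1 - Z = τ.1 * ((2 * Complex.I) • V⁻¹) := by
    have e : V - (1 - τ.1) = (2 : ℂ) • τ.1 := by rw [hV]; module
    rw [hZ, h1, ← smul_sub, ← Matrix.sub_mul, e, Matrix.smul_mul, smul_smul, Matrix.mul_smul,
      mul_comm]
  change (Complex.I • 1 - Z) * (Complex.I • 1 + Z)⁻¹ = τ.1
  have hu : IsUnit (Complex.I • 1 + Z).det := upper_isUnit (⟨Z, hs, him⟩ : SiegelUpper g)
  rw [h3, ← h2, Matrix.mul_assoc, Matrix.mul_nonsing_inv _ hu, Matrix.mul_one]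

lemma one_sub_scale_eq (t : unitInterval) (τ : Matrix (Fin g) (Fin g) ℂ) :
    1 - (((t : ℝ) : ℂ) • τ)ᴴ * (((t : ℝ) : ℂ) • τ) =
      (((1 - t ^ 2 : ℝ)) : ℂ) • (1 : Matrix (Fin g) (Fin g) ℂ) +
        ((t ^ 2 : ℝ) : ℂ) • (1 - τᴴ * τ) := by
  rw [Matrix.conjTranspose_smul, Matrix.smul_mul, Matrix.mul_smul, smul_smul, Complex.star_def,
    Complex.conj_ofReal]
  push_cast
  module

/-- The dilation of the closed disc by a factor `t ∈ [0, 1]`. -/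
def scaleDisc (t : unitInterval) (τ : SiegelDisc g) : SiegelDisc g :=
  ⟨((t : ℝ) : ℂ) • τ.1, by
    refine ⟨by rw [Matrix.IsSymm, Matrix.transpose_smul, τ.2.1.eq], ?_⟩
    have ht := t.2
    rw [one_sub_scale_eq]
    refine (Matrix.PosSemidef.one.smul ?_).add (τ.2.2.smul ?_)
    · exact Complex.zero_le_real.mpr (by nlinarith [ht.1, ht.2])
    · exact Complex.zero_le_real.mpr (sq_nonneg _)⟩

lemma scaleDisc_posDef {t : unitInterval} (ht : (t : ℝ) < 1) (τ : SiegelDisc g) :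
    (1 - (scaleDisc t τ).1ᴴ * (scaleDisc t τ).1).PosDef := by
  change (1 - (((t : ℝ) : ℂ) • τ.1)ᴴ * (((t : ℝ) : ℂ) • τ.1)).PosDef
  rw [one_sub_scale_eq]
  refine (Matrix.PosDef.one.smul ?_).add_posSemidef (τ.2.2.smul ?_)
  · exact Complex.zero_lt_real.mpr (by nlinarith [t.2.1])
  · exact Complex.zero_le_real.mpr (sq_nonneg _)

lemma continuous_scaleDisc :
    Continuous fun p : unitInterval × SiegelDisc g => scaleDisc p.1 p.2 := by
  refine Continuous.subtype_mk ?_ _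
  exact (Complex.continuous_ofReal.comp (continuous_subtype_val.comp continuous_fst)).smul
    (continuous_subtype_val.comp continuous_snd)

lemma scaleDisc_one (τ : SiegelDisc g) : scaleDisc 1 τ = τ := by
  refine Subtype.ext ?_
  simp [scaleDisc]

lemma scaleDisc_zero (τ : SiegelDisc g) : (scaleDisc 0 τ).1 = 0 := by
  simp [scaleDisc]

/-- For `t < 1` the point `t τ` satisfies the strict inequality, hence lies in the image, and it
tends to `τ` as `t → 1`. -/
lemma denseRange_cayley : DenseRange (cayley (g := g)) := by
  intro τ
  have h1 : Filter.Tendsto (fun t : unitInterval => scaleDisc t τ) (nhdsWithin 1 (Set.Iio 1))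
      (nhds τ) := by
    have hc : Continuous fun t : unitInterval => scaleDisc t τ :=
      continuous_scaleDisc.comp (continuous_id.prodMk continuous_const)
    have := hc.tendsto 1
    rw [scaleDisc_one] at this
    exact this.mono_left nhdsWithin_le_nhds
  have : (nhdsWithin (1 : unitInterval) (Set.Iio 1)).NeBot :=
    nhdsLT_neBot_of_exists_lt ⟨0, zero_lt_one⟩
  refine mem_closure_of_tendsto h1 ?_
  filter_upwards [self_mem_nhdsWithin] with t ht
  exact exists_cayley_eq _ (scaleDisc_posDef ht τ)

end CayleyTransform

/-! ### Pull-back of the canonical forms -/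

section CanonicalForms

variable {g : ℕ}

lemma canForm_apply (τ : SiegelDisc g) (v : Fin g → Fin g ⊕ Fin g → ℂ) :
    canForm τ v = (Matrix.of v *
      (Matrix.fromCols (1 + τ.1) (-(Complex.I • (1 - τ.1))))ᵀ).det := by
  change Matrix.det _ = _
  congr 1
  ext i j
  simp [Matrix.mul_apply, Matrix.mulVec, dotProduct, mul_comm]

/-- The matrix `[1, i; 1, -i]`. -/
def formMat (g : ℕ) : Matrix (Fin g ⊕ Fin g) (Fin g ⊕ Fin g) ℂ :=
  Matrix.fromBlocks 1 (Complex.I • 1) 1 (-(Complex.I • 1))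

lemma frame_transpose_mul_formMat (τ : SiegelDisc g) :
    (frame τ.1)ᵀ * formMat g = Matrix.fromCols (1 + τ.1) (-(Complex.I • (1 - τ.1))) := by
  rw [frame, formMat, Matrix.transpose_fromRows, Matrix.fromCols_mul_fromBlocks, τ.2.1.eq,
    Matrix.transpose_one]
  congr 1
  · simp only [Matrix.mul_one]
    abel
  · simp only [Matrix.mul_one, Matrix.mul_smul, Matrix.one_mul]
    module

lemma discMat_transpose_mul_formMat (M : Sp g) :
    (discMat M)ᵀ * formMat g = (2 : ℂ) • (formMat g * toC (M⁻¹ : Sp g).1) := by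
  have h1 : (cay g)ᵀ * formMat g = (2 * Complex.I) • Matrix.J (Fin g) ℂ := by
    rw [cay, formMat, Matrix.fromBlocks_transpose, Matrix.J, Matrix.fromBlocks_multiply,
      Matrix.fromBlocks_smul]
    congr 1 <;> simp <;> module
  have h2 : Complex.I • ((cayInv g)ᵀ * Matrix.J (Fin g) ℂ) = formMat g := by
    rw [cayInv, formMat, Matrix.fromBlocks_transpose, Matrix.J, Matrix.fromBlocks_multiply,
      Matrix.fromBlocks_smul]
    congr 1 <;> simp [smul_smul]
  have h3 : toC M.1 * toC (M⁻¹ : Sp g).1 = 1 := by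
    have h : toC (M * M⁻¹).1 = toC M.1 * toC (M⁻¹ : Sp g).1 :=
      (Matrix.map_mul (f := Complex.ofRealHom))
    rw [← h, mul_inv_cancel]
    exact Matrix.map_one Complex.ofReal (by simp) (by simp)
  have h4 : (toC M.1)ᵀ * Matrix.J (Fin g) ℂ = Matrix.J (Fin g) ℂ * toC (M⁻¹ : Sp g).1 := by
    have h := congrArg (· * toC (M⁻¹ : Sp g).1) (toC_transpose_J M)
    simp only [Matrix.mul_assoc, h3, Matrix.mul_one] at h
    exact h
  rw [discMat, Matrix.transpose_mul, Matrix.transpose_mul, Matrix.mul_assoc, Matrix.mul_assoc, h1,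
    Matrix.mul_smul, Matrix.mul_smul, h4, ← h2, Matrix.smul_mul, smul_smul, Matrix.mul_assoc]

/-- The coefficient rows of the `g` one-forms are the transposed frame times `formMat`. Pull-back by
`M⁻¹` multiplies them by half the transposed denominator, so the wedge product acquires the
determinant and `2^(-g)`. -/
lemma pushForm_canForm (M : Sp g) (τ : SiegelDisc g) :
    pushForm M (canForm τ) = ((2 ^ g)⁻¹ * (discDen M τ.1).det) • canForm (M • τ) := by
  have h : Matrix.fromCols (1 + τ.1) (-(Complex.I • (1 - τ.1))) * toC (M⁻¹ : Sp g).1 =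
      ((2 : ℂ)⁻¹ • (discDen M τ.1)ᵀ) *
        Matrix.fromCols (1 + (M • τ).1) (-(Complex.I • (1 - (M • τ).1))) := by
    rw [← frame_transpose_mul_formMat, ← frame_transpose_mul_formMat, Matrix.smul_mul,
      ← Matrix.mul_assoc, ← Matrix.transpose_mul, ← frame_smul, Matrix.transpose_mul,
      Matrix.mul_assoc, Matrix.mul_assoc, discMat_transpose_mul_formMat, Matrix.mul_smul, smul_smul,
      inv_mul_cancel₀ two_ne_zero, one_smul]
  ext v
  have h1 : pushForm M (canForm τ) v = canForm τ fun i => toC (M⁻¹ : Sp g).1 *ᵥ v i := rfl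
  have h2 : (Matrix.of fun i => toC (M⁻¹ : Sp g).1 *ᵥ v i) =
      Matrix.of v * (toC (M⁻¹ : Sp g).1)ᵀ := by
    ext i j
    simp [Matrix.mul_apply, Matrix.mulVec, dotProduct, mul_comm]
  rw [h1, canForm_apply, h2, Matrix.mul_assoc, ← Matrix.transpose_mul, h, Matrix.transpose_mul,
    ← Matrix.mul_assoc, Matrix.det_mul, ← canForm_apply, Matrix.det_transpose, Matrix.det_smul,
    Matrix.det_transpose, Fintype.card_fin, AlternatingMap.smul_apply, smul_eq_mul, inv_pow]
  ring

end CanonicalForms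

/-! ### Continuity, square roots over the disc, connectedness -/

section Topology

variable {g : ℕ}

lemma continuousAt_matrix_inv_comp {X : Type*} [TopologicalSpace X]
    {F : X → Matrix (Fin g) (Fin g) ℂ} {x : X} (hF : ContinuousAt F x) (h : IsUnit (F x).det) :
    ContinuousAt (fun y => (F y)⁻¹) x := by
  have h1 : ContinuousAt Ring.inverse (F x).det := by
    rw [Ring.inverse_eq_inv']
    exact continuousAt_inv₀ h.ne_zero
  exact ContinuousAt.comp (f := F) (continuousAt_matrix_inv (F x) h1) hF

lemma continuous_smul_upper (M : Sp g) : Continuous fun Ω : SiegelUpper g => M • Ω := by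
  refine Continuous.subtype_mk (f := fun Ω : SiegelUpper g => upNum M Ω.1 * (upDen M Ω.1)⁻¹) ?_ _
  have h1 : Continuous fun Ω : SiegelUpper g => upNum M Ω.1 :=
    (continuous_const.matrix_mul continuous_subtype_val).add continuous_const
  have h2 : Continuous fun Ω : SiegelUpper g => upDen M Ω.1 :=
    (continuous_const.matrix_mul continuous_subtype_val).add continuous_const
  exact h1.matrix_mul (continuous_iff_continuousAt.mpr fun Ω =>
    continuousAt_matrix_inv_comp h2.continuousAt (upDen_isUnit M Ω))

lemma continuous_discDen (M : Sp g) : Continuous fun τ : SiegelDisc g => discDen M τ.1 :=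
  continuous_const.sub (continuous_const.matrix_mul continuous_subtype_val)

lemma continuous_smul_disc (M : Sp g) : Continuous fun τ : SiegelDisc g => M • τ := by
  refine Continuous.subtype_mk (f := fun τ : SiegelDisc g => discNum M τ.1 * (discDen M τ.1)⁻¹) ?_ _
  have h1 : Continuous fun τ : SiegelDisc g => discNum M τ.1 :=
    (continuous_const.matrix_mul continuous_subtype_val).sub continuous_const
  exact h1.matrix_mul (continuous_iff_continuousAt.mpr fun τ =>
    continuousAt_matrix_inv_comp (continuous_discDen M).continuousAt (discDen_isUnit M τ))

lemma continuous_cayley : Continuous (cayley (g := g)) := by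
  refine Continuous.subtype_mk
    (f := fun Ω : SiegelUpper g => (Complex.I • 1 - Ω.1) * (Complex.I • 1 + Ω.1)⁻¹) ?_ _
  have h : Continuous fun Ω : SiegelUpper g => Complex.I • 1 + Ω.1 :=
    continuous_const.add continuous_subtype_val
  exact (continuous_const.sub continuous_subtype_val).matrix_mul
    (continuous_iff_continuousAt.mpr fun Ω =>
      continuousAt_matrix_inv_comp h.continuousAt (upper_isUnit Ω))

lemma continuous_sqrtDet_comp {X : Type*} [TopologicalSpace X] {F : X → Matrix (Fin g) (Fin g) ℂ}
    (hF : Continuous F) (h : ∀ x, F x ∈ reHalfSpace g) : Continuous fun x => sqrtDet (F x) :=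
  continuous_iff_continuousAt.mpr fun x =>
    ContinuousAt.comp (f := F) (continuousAt_sqrtDet (h x)) hF.continuousAt

lemma continuous_genJ (D : GenData g) : Continuous (genJ D) := by
  refine continuous_const.mul (continuous_const.mul (continuous_sqrtDet_comp ?_ fun Ω =>
    neg_I_smul_mem Ω D.symm_Q))
  have h : Continuous fun Ω : SiegelUpper g => Ω.1 + toC D.Q :=
    continuous_subtype_val.add continuous_const
  exact (h.const_smul Complex.I).neg

lemma continuous_jFac {k : ℕ} [NeZero k] (A : Mp g k) : Continuous (jFac A) := by
  refine mp_induction (p := fun A => Continuous (jFac A)) (fun D => ?_) ?_ ?_ ?_ A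
  · exact (continuous_genJ D).congr fun Ω => (jFac_gen D Ω).symm
  · refine (continuous_const (y := (1 : ℂ))).congr fun Ω => (jFac_eq (Ω' := Ω) ?_).symm
    rw [inv_one, one_smul]
    rfl
  · intro A B hA hB
    exact ((hA.comp (continuous_smul_upper _)).mul hB).congr fun Ω => (jFac_mul A B Ω).symm
  · intro A hA
    refine ((hA.comp (continuous_smul_upper (covHom g k A⁻¹))).inv₀
      fun Ω => jFac_ne_zero A _).congr fun Ω => ?_
    have h := jFac_mul A A⁻¹ Ω
    have h1 : jFac (1 : Mp g k) Ω = 1 := jFac_eq (Ω' := Ω) (by rw [inv_one, one_smul]; rfl)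
    rw [mul_inv_cancel, h1] at h
    exact (eq_inv_of_mul_eq_one_right h.symm).symm

/-- A nowhere vanishing function that is homotopic to a constant has a continuous square root. -/
lemma exists_continuous_sqrt {X : Type*} [TopologicalSpace X] (F : unitInterval × X → ℂ)
    (hF : Continuous F) (h0 : ∀ p, F p ≠ 0) (z : ℂ) (hz : ∀ x, F (0, x) = z) :
    ∃ c : X → ℂ, Continuous c ∧ ∀ x, c x ^ 2 = F (1, x) := by
  rcases isEmpty_or_nonempty X with hX | ⟨⟨x₀⟩⟩
  · exact ⟨fun _ => 0, continuous_const, fun x => (hX.false x).elim⟩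
  have hz0 : z ≠ 0 := hz x₀ ▸ h0 _
  obtain ⟨w, hw⟩ : ∃ w : ℂ, w ^ 2 = z := ⟨z ^ ((2 : ℕ)⁻¹ : ℂ), Complex.cpow_nat_inv_pow _ two_ne_zero⟩
  have hw0 : w ≠ 0 := by
    rintro rfl
    exact hz0 (by rw [← hw]; simp)
  -- Squaring is a covering of the punctured plane, so the homotopy lifts from the constant root at
  -- time `0`.
  have cov := isCoveringMap_npow (𝕜 := ℂ) 2 (by norm_num)
  let H : C(unitInterval × X, {z : ℂ // z ≠ 0}) := ⟨fun p => ⟨F p, h0 p⟩, hF.subtype_mk _⟩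
  let f : C(X, {z : ℂ // z ≠ 0}) := ContinuousMap.const _ ⟨w, hw0⟩
  have H0 : ∀ x, H (0, x) = ⟨(f x : ℂ) ^ 2, pow_ne_zero 2 (f x).2⟩ := fun x =>
    Subtype.ext ((hz x).trans hw.symm)
  refine ⟨fun x => (cov.liftHomotopy H f H0 (1, x)).1, ?_, fun x => ?_⟩
  · exact continuous_subtype_val.comp
      ((cov.liftHomotopy H f H0).continuous.comp (continuous_const.prodMk continuous_id))
  · exact congrArg Subtype.val (congrFun (cov.liftHomotopy_lifts H f H0) (1, x))

instance : PreconnectedSpace (SiegelUpper g) := by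
  refine Subtype.preconnectedSpace (Convex.isPreconnected ?_)
  rintro X ⟨hX1, hX2⟩ Y ⟨hY1, hY2⟩ a b ha hb hab
  refine ⟨?_, ?_⟩
  · rw [Matrix.IsSymm, Matrix.transpose_add, Matrix.transpose_smul, Matrix.transpose_smul, hX1.eq,
      hY1.eq]
  · have h : (a • X + b • Y).map Complex.im = a • X.map Complex.im + b • Y.map Complex.im := by
      ext i j
      simp
    rw [h]
    rcases ha.eq_or_lt with rfl | ha'
    · rw [zero_add] at hab
      rw [hab, zero_smul, one_smul, zero_add]
      exact hY2
    · exact (hX2.smul ha').add_posSemidef (hY2.posSemidef.smul hb)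

end Topology

/-! ### Extension of the half-form factor to the closed disc -/

section HalfFormFactor

variable {g k : ℕ} [NeZero k]

/-- The action of a metaplectic operator on half-forms over the open disc. -/
def openFac (A : Mp g k) (Ω : SiegelUpper g) : ℂ :=
  jFac A Ω * sqrtDet (1 + (cayley Ω).1) / sqrtDet (1 + (cayley (covHom g k A • Ω)).1)

lemma sqrtDet_cayley_ne_zero (Ω : SiegelUpper g) : sqrtDet (1 + (cayley Ω).1) ≠ 0 :=
  sqrtDet_ne_zero (one_add_cayley_mem Ω)

/-- All square roots disappear, and the determinant identities of the Cayley transform leave an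
expression that makes sense and does not vanish on the closed disc. -/
lemma openFac_sq (A : Mp g k) (Ω : SiegelUpper g) :
    openFac A Ω ^ 2 = (2 ^ g)⁻¹ * (discDen (covHom g k A) (cayley Ω).1).det := by
  set M := covHom g k A with hM
  have h1 := det_discDen_cayley M Ω
  have h2 := det_one_add_cayley Ω
  have h3 := det_one_add_cayley (M • Ω)
  have h4 := sqrtDet_sq (one_add_cayley_mem Ω)
  have h5 := sqrtDet_sq (one_add_cayley_mem (M • Ω))
  have h6 := (upper_isUnit Ω).ne_zero
  have h7 := (upper_isUnit (M • Ω)).ne_zero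
  have h8 : (1 + (cayley (M • Ω)).1).det ≠ 0 := by
    rw [← h5]
    exact pow_ne_zero _ (sqrtDet_cayley_ne_zero _)
  rw [openFac, div_pow, mul_pow, jFac_sq, ← hM, h4, h5, div_eq_iff h8]
  refine mul_right_cancel₀ (mul_ne_zero h6 h7) ?_
  have h9 : (2 ^ g : ℂ)⁻¹ * 2 ^ g = 1 := inv_mul_cancel₀ (pow_ne_zero _ two_ne_zero)
  rw [← h3] at h2
  linear_combination ((upDen M Ω.1).det * (Complex.I • 1 + (M • Ω).1).det) * h2 -
    ((2 ^ g : ℂ)⁻¹ * (1 + (cayley (M • Ω)).1).det * (Complex.I • 1 + (M • Ω).1).det) * h1 -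
    ((upDen M Ω.1).det * (Complex.I • 1 + (M • Ω).1).det * (1 + (cayley (M • Ω)).1).det *
      (Complex.I • 1 + (M • Ω).1).det) * h9

lemma continuous_sqrtDet_cayley :
    Continuous fun Ω : SiegelUpper g => sqrtDet (1 + (cayley Ω).1) := by
  have h : Continuous fun Ω : SiegelUpper g => 1 + (cayley Ω).1 :=
    continuous_const.add (continuous_subtype_val.comp continuous_cayley)
  exact continuous_sqrtDet_comp h one_add_cayley_mem

lemma continuous_openFac (A : Mp g k) : Continuous (openFac A) :=
  ((continuous_jFac A).mul continuous_sqrtDet_cayley).div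
    (continuous_sqrtDet_cayley.comp (continuous_smul_upper _)) fun _ => sqrtDet_cayley_ne_zero _

/-- Contracting the closed disc radially to `0` gives a continuous root of the squared factor. Over
the connected upper half-space it agrees with `openFac` up to one global sign. -/
lemma exists_halfFac (A : Mp g k) :
    ∃ c : SiegelDisc g → ℂ, Continuous c ∧ ∀ Ω, c (cayley Ω) = openFac A Ω := by
  set M := covHom g k A with hM
  have hcd : Continuous fun τ : SiegelDisc g => (2 ^ g : ℂ)⁻¹ * (discDen M τ.1).det :=
    continuous_const.mul (continuous_discDen M).matrix_det
  have hne : ∀ τ : SiegelDisc g, (2 ^ g : ℂ)⁻¹ * (discDen M τ.1).det ≠ 0 := fun τ =>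
    mul_ne_zero (inv_ne_zero (pow_ne_zero _ two_ne_zero)) (discDen_isUnit M τ).ne_zero
  obtain ⟨f, hf, hf2⟩ := exists_continuous_sqrt
    (fun p : unitInterval × SiegelDisc g => (2 ^ g : ℂ)⁻¹ * (discDen M (scaleDisc p.1 p.2).1).det)
    (hcd.comp continuous_scaleDisc) (fun p => hne _) ((2 ^ g : ℂ)⁻¹ * (discDen M 0).det)
    (fun τ => by rw [scaleDisc_zero])
  simp only [scaleDisc_one] at hf2
  have hf0 : ∀ τ, f τ ≠ 0 := fun τ h0 => hne τ (by rw [← hf2, h0]; simp)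
  -- The sign is constant, so it can be absorbed into the root on the whole closed disc.
  rcases isPreconnected_univ.eq_or_eq_neg_of_sq_eq (continuous_openFac A).continuousOn
    (hf.comp continuous_cayley).continuousOn (fun Ω _ => (openFac_sq A Ω).trans (hf2 _).symm)
    (fun {Ω} _ => hf0 _) with h | h
  · exact ⟨f, hf, fun Ω => (h (Set.mem_univ Ω)).symm⟩
  · exact ⟨fun τ => -f τ, hf.neg, fun Ω => (h (Set.mem_univ Ω)).symm⟩

/-- The factor by which a metaplectic operator acts on half-forms over the closed disc. -/
def halfFac (A : Mp g k) : SiegelDisc g → ℂ := (exists_halfFac A).choose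

lemma continuous_halfFac (A : Mp g k) : Continuous (halfFac A) := (exists_halfFac A).choose_spec.1

lemma halfFac_cayley (A : Mp g k) (Ω : SiegelUpper g) : halfFac A (cayley Ω) = openFac A Ω :=
  (exists_halfFac A).choose_spec.2 Ω

lemma halfFac_sq (A : Mp g k) (τ : SiegelDisc g) :
    halfFac A τ ^ 2 = (2 ^ g)⁻¹ * (discDen (covHom g k A) τ.1).det := by
  refine congrFun (denseRange_cayley.equalizer ((continuous_halfFac A).pow 2)
    (continuous_const.mul (continuous_discDen (covHom g k A)).matrix_det) ?_) τ
  funext Ω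
  exact (congrArg (· ^ 2) (halfFac_cayley A Ω)).trans (openFac_sq A Ω)

lemma halfFac_ne_zero (A : Mp g k) (τ : SiegelDisc g) : halfFac A τ ≠ 0 := by
  intro h
  have h1 := halfFac_sq A τ
  rw [h, zero_pow two_ne_zero, eq_comm] at h1
  exact mul_ne_zero (inv_ne_zero (pow_ne_zero _ two_ne_zero)) (discDen_isUnit _ τ).ne_zero h1

/-- Both sides are continuous, and over the dense open disc the identity is the cocycle law of
`jFac`, the trivialization factors cancelling. -/
lemma halfFac_mul (A B : Mp g k) (τ : SiegelDisc g) :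
    halfFac (A * B) τ = halfFac A (covHom g k B • τ) * halfFac B τ := by
  refine congrFun (denseRange_cayley.equalizer (continuous_halfFac (A * B))
    (((continuous_halfFac A).comp (continuous_smul_disc (covHom g k B))).mul
      (continuous_halfFac B)) ?_) τ
  funext Ω
  change halfFac (A * B) (cayley Ω) =
    halfFac A (covHom g k B • cayley Ω) * halfFac B (cayley Ω)
  rw [← cayley_smul, halfFac_cayley, halfFac_cayley, halfFac_cayley]
  have h := sqrtDet_cayley_ne_zero (covHom g k B • Ω)
  rw [openFac, openFac, openFac, jFac_mul, map_mul, mul_smul]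
  field_simp

lemma jFac_of_apply_eq {A : Mp g k} {c : ℂ} (h : ∀ f, A.1 f = c⁻¹ • f) (Ω : SiegelUpper g) :
    jFac A Ω = c := jFac_eq (h _)

/-- A scalar operator fixes every point of the disc and rescales every Gaussian equally; the
trivialization factors cancel over the open disc, and density does the rest. -/
lemma halfFac_of_apply_eq {A : Mp g k} {c : ℂ} (h : ∀ f, A.1 f = c⁻¹ • f)
    (hA : covHom g k A = 1) (τ : SiegelDisc g) : halfFac A τ = c := by
  refine congrFun (denseRange_cayley.equalizer (continuous_halfFac A)
    (continuous_const (y := c)) ?_) τ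
  funext Ω
  simp only [Function.comp_apply, halfFac_cayley]
  rw [openFac, hA, one_smul, jFac_of_apply_eq h, mul_div_cancel_right₀ _ (sqrtDet_cayley_ne_zero _)]

lemma halfFac_one (τ : SiegelDisc g) : halfFac (1 : Mp g k) τ = 1 :=
  halfFac_of_apply_eq (fun f => by rw [inv_one, one_smul]; rfl) (map_one _) τ

lemma halfFac_negMp (τ : SiegelDisc g) : halfFac (negMp g k) τ = -1 :=
  halfFac_of_apply_eq (fun f => by rw [negMp_apply, inv_neg, inv_one, neg_one_smul]) covHom_negMp τ

end HalfFormFactor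

/-! ### Existence and uniqueness of the half-form action -/

section HalfFormAction

variable {g k : ℕ} [NeZero k]

/-- The action of the metaplectic group on the half-form bundle. -/
def halfAct (g k : ℕ) [NeZero k] : Mp g k →* Equiv.Perm (HalfForm g) :=
  MonoidHom.toHomPerm
    { toFun := fun A ν => (covHom g k A • ν.1, halfFac A ν.1 * ν.2)
      map_one' := by
        funext ν
        simp only [map_one, one_smul, halfFac_one, one_mul]
        rfl
      map_mul' := fun A B => by
        funext ν
        simp only [map_mul, mul_smul, halfFac_mul, mul_assoc]
        rfl }

lemma halfAct_apply (A : Mp g k) (ν : HalfForm g) :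
    halfAct g k A ν = (covHom g k A • ν.1, halfFac A ν.1 * ν.2) := rfl

lemma isHalfFormAction_halfAct : IsHalfFormAction (covHom g k) (halfAct g k) where
  linear A τ := ⟨halfFac A τ, fun _ => rfl⟩
  continuous A := ((continuous_smul_disc _).comp continuous_fst).prodMk
    (((continuous_halfFac A).comp continuous_fst).mul continuous_snd)
  square A ν := by
    have h : pushForm (covHom g k A) (halfFormSq ν) =
        ν.2 ^ 2 • pushForm (covHom g k A) (canForm ν.1) := rfl
    rw [h, pushForm_canForm, ← halfFac_sq, smul_smul, halfAct_apply, halfFormSq, mul_pow, mul_comm]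
  gen D Ω Ω' h := by
    have h1 : Ω' = covHom g k (mpGen k D) • Ω := Subtype.ext h
    have h2 := sqrtDet_cayley_ne_zero Ω
    subst h1
    rw [halfAct_apply]
    refine Prod.ext (cayley_smul _ _).symm ?_
    change halfFac _ (cayley Ω) * (sqrtDet (1 + (cayley Ω).1))⁻¹ =
      genJ D Ω * (sqrtDet (1 + (cayley (covHom g k (mpGen k D) • Ω)).1))⁻¹
    rw [halfFac_cayley, openFac, jFac_gen]
    field_simp

/-- An action is determined by the generators. There the fibre factor is prescribed over the dense
open disc and is continuous, since it is the second component of the image of the section `(τ, 1)`.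
-/
lemma eq_halfAct {h : Mp g k →* Equiv.Perm (HalfForm g)}
    (hh : IsHalfFormAction (covHom g k) h) : h = halfAct g k := by
  refine mp_hom_ext fun D => Equiv.ext fun ⟨τ, a⟩ => ?_
  choose c hc using hh.linear (mpGen k D)
  have hcc : Continuous c := by
    have h1 : Continuous fun τ => (h (mpGen k D) (τ, 1)).2 :=
      continuous_snd.comp ((hh.continuous _).comp (continuous_id.prodMk continuous_const))
    simpa only [hc, mul_one] using h1
  have hceq : c = halfFac (mpGen k D) := by
    refine denseRange_cayley.equalizer hcc (continuous_halfFac _) ?_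
    funext Ω
    have h1 := hh.gen D Ω (covHom g k (mpGen k D) • Ω) rfl
    rw [← isHalfFormAction_halfAct.gen D Ω (covHom g k (mpGen k D) • Ω) rfl, halfAct_apply] at h1
    have h2 := congrArg Prod.snd h1
    rw [sqrtDz, hc] at h2
    exact mul_right_cancel₀ (inv_ne_zero (sqrtDet_cayley_ne_zero Ω)) h2
  rw [hc, hceq, halfAct_apply]

theorem existsUnique_halfFormAction {cov : Mp g k →* Sp g} (hcov : IsMetaplecticCovering cov) :
    ∃! h : Mp g k →* Equiv.Perm (HalfForm g), IsHalfFormAction cov h := by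
  rw [eq_covHom hcov]
  exact ⟨halfAct g k, isHalfFormAction_halfAct, fun _ h => eq_halfAct h⟩

end HalfFormAction

lemma tensor_one {g k : ℕ} (τ : SiegelDisc g) (σ : DistSection g k) : tensor σ (τ, 1) = (τ, σ) := by
  rw [tensor, one_smul]

/-- Finite sets are bounded, so scalar multiplication is jointly continuous for the weak topology;
this is needed for continuity on the total space, where the scalar varies with `τ`. -/
instance {g k : ℕ} : ContinuousSMul ℂ (DistSection g k) :=
  UniformConvergenceCLM.continuousSMul _ _ _ fun _ hS => Set.Finite.isVonNBounded hS

/-! ### Descent of the product action to the symplectic group -/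

section ProductAction

variable {g k : ℕ} [NeZero k]

lemma mpTempered_mul (A B : Mp g k) (σ : 𝓢'(Euc g, ℂ)) :
    mpTempered (A * B) σ = mpTempered A (mpTempered B σ) := by
  ext f
  change σ (conjS (B.1.symm (A.1.symm (conjS f)))) =
    σ (conjS (B.1.symm (conjS (conjS (A.1.symm (conjS f))))))
  have h : ∀ w : 𝓢(Euc g, ℂ), conjS (conjS w) = w := fun w => by ext u; simp
  rw [h]

/-- The transpose involves complex conjugation, which does not affect a real scalar; the cases
needed are `1` and `-1`. -/
lemma mpTempered_of_apply_eq {A : Mp g k} {c : ℝ} (hc : c ≠ 0) (h : ∀ f, A.1 f = (c : ℂ) • f)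
    (σ : 𝓢'(Euc g, ℂ)) : mpTempered A σ = ((c : ℂ))⁻¹ • σ := by
  ext f
  have h1 : A.1.symm (conjS f) = (c : ℂ)⁻¹ • conjS f := by
    rw [A.1.symm_apply_eq, h, smul_smul, mul_inv_cancel₀ (Complex.ofReal_ne_zero.mpr hc), one_smul]
  have h2 : transposeCLM A.1 f = (c : ℂ)⁻¹ • f := by
    change conjS (A.1.symm (conjS f)) = _
    rw [h1]
    ext u
    simp
  change σ (transposeCLM A.1 f) = (c : ℂ)⁻¹ • σ f
  rw [h2, map_smul]

variable (W : DistSection g k ≃L[ℂ] (Idx g k → 𝓢'(Euc g, ℂ)))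

/-- The operator of a metaplectic element on distributional sections, as a continuous linear
map. -/
def mpDistCLM (A : Mp g k) : DistSection g k →L[ℂ] DistSection g k :=
  (W.symm : (Idx g k → 𝓢'(Euc g, ℂ)) →L[ℂ] DistSection g k).comp
    ((ContinuousLinearMap.pi fun l => (mpTempered A).comp (ContinuousLinearMap.proj l)).comp
      (W : DistSection g k →L[ℂ] (Idx g k → 𝓢'(Euc g, ℂ))))

lemma mpDist_mul (A B : Mp g k) (σ : DistSection g k) :
    mpDist W (A * B) σ = mpDist W A (mpDist W B σ) := by
  simp only [mpDist, W.apply_symm_apply, mpTempered_mul]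

lemma mpDist_smul (A : Mp g k) (c : ℂ) (σ : DistSection g k) :
    mpDist W A (c • σ) = c • mpDist W A σ := map_smul (mpDistCLM W A) c σ

lemma mpDist_one (σ : DistSection g k) : mpDist W 1 σ = σ := by
  have h : ∀ σ : 𝓢'(Euc g, ℂ), mpTempered (1 : Mp g k) σ = σ := fun σ => by
    rw [mpTempered_of_apply_eq one_ne_zero (fun f => by rw [Complex.ofReal_one, one_smul]; rfl)]
    simp
  simp only [mpDist, h]
  exact W.symm_apply_apply σ

lemma mpDist_negMp (σ : DistSection g k) : mpDist W (negMp g k) σ = -σ := by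
  have h : ∀ σ : 𝓢'(Euc g, ℂ), mpTempered (negMp g k) σ = -σ := fun σ => by
    rw [mpTempered_of_apply_eq (c := -1) (by norm_num)
      (fun f => by rw [negMp_apply, Complex.ofReal_neg, Complex.ofReal_one, neg_one_smul])]
    rw [Complex.ofReal_neg, Complex.ofReal_one, inv_neg, inv_one]
    exact neg_one_smul ℂ σ
  simp only [mpDist, h]
  rw [W.symm_apply_eq, map_neg]
  rfl

/-- The operator of a metaplectic element on the fibres of the product bundle. -/
def prodOp (A : Mp g k) (τ : SiegelDisc g) (σ : DistSection g k) : DistSection g k :=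
  halfFac A τ • mpDist W A σ

lemma prodOp_mul (A B : Mp g k) (τ : SiegelDisc g) (σ : DistSection g k) :
    prodOp W (A * B) τ σ = prodOp W A (covHom g k B • τ) (prodOp W B τ σ) := by
  rw [prodOp, prodOp, prodOp, halfFac_mul, mpDist_mul, mpDist_smul, smul_smul]

lemma prodOp_one (τ : SiegelDisc g) (σ : DistSection g k) : prodOp W 1 τ σ = σ := by
  rw [prodOp, halfFac_one, mpDist_one, one_smul]

/-- Two lifts of one matrix are equal or differ by `negMp`, whose signs on half-forms and on
distributional sections cancel. This is the reason for the descent. -/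
lemma prodOp_congr {A B : Mp g k} (h : covHom g k A = covHom g k B) (τ : SiegelDisc g)
    (σ : DistSection g k) : prodOp W A τ σ = prodOp W B τ σ := by
  have h1 : covHom g k (A * B⁻¹) = 1 := by rw [map_mul, map_inv, h, mul_inv_cancel]
  rcases eq_one_or_eq_negMp h1 with h2 | h2
  · rw [mul_inv_eq_one.mp h2]
  · rw [mul_inv_eq_iff_eq_mul.mp h2, prodOp_mul, prodOp, halfFac_negMp, mpDist_negMp]
    module

/-- A metaplectic lift of a symplectic matrix. -/
def mpLift (k : ℕ) [NeZero k] (M : Sp g) : Mp g k := (covHom_surjective M).choose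

lemma covHom_mpLift (M : Sp g) : covHom g k (mpLift k M) = M := (covHom_surjective M).choose_spec

/-- The action of the symplectic group on half-form corrected distributional sections. -/
def spAct : Sp g →* Equiv.Perm (CorrectedSection g k) :=
  MonoidHom.toHomPerm
    { toFun := fun M p => (M • p.1, prodOp W (mpLift k M) p.1 p.2)
      map_one' := by
        funext p
        have h : covHom g k (mpLift k 1) = covHom g k 1 := by rw [covHom_mpLift, map_one]
        simp only [one_smul, prodOp_congr W h, prodOp_one]
        rfl
      map_mul' := fun M N => by
        funext p
        have h : covHom g k (mpLift k (M * N)) = covHom g k (mpLift k M * mpLift k N) := by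
          rw [covHom_mpLift, map_mul, covHom_mpLift, covHom_mpLift]
        simp only [mul_smul, prodOp_congr W h, prodOp_mul, covHom_mpLift]
        rfl }

lemma spAct_apply (M : Sp g) (p : CorrectedSection g k) :
    spAct W M p = (M • p.1, prodOp W (mpLift k M) p.1 p.2) := rfl

lemma spAct_covHom (A : Mp g k) (p : CorrectedSection g k) :
    spAct W (covHom g k A) p = (covHom g k A • p.1, prodOp W A p.1 p.2) := by
  rw [spAct_apply, prodOp_congr W (covHom_mpLift _)]

lemma spAct_tensor (A : Mp g k) (σ : DistSection g k) (ν : HalfForm g) :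
    spAct W (covHom g k A) (tensor σ ν) = tensor (mpDist W A σ) (halfAct g k A ν) := by
  rw [spAct_covHom, halfAct_apply, tensor, tensor, prodOp, mpDist_smul, smul_smul]

/-- The inverse on the fibre combines the operator of `A⁻¹` with the reciprocal of the nonvanishing
half-form factor. -/
lemma exists_spAct_equiv (M : Sp g) (τ : SiegelDisc g) :
    ∃ T : DistSection g k ≃L[ℂ] DistSection g k, ∀ σ, spAct W M (τ, σ) = (M • τ, T σ) := by
  set A := mpLift k M with hA
  have h1 : ∀ σ, mpDist W A⁻¹ (mpDist W A σ) = σ := fun σ => by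
    rw [← mpDist_mul, inv_mul_cancel, mpDist_one]
  have h2 : ∀ σ, mpDist W A (mpDist W A⁻¹ σ) = σ := fun σ => by
    rw [← mpDist_mul, mul_inv_cancel, mpDist_one]
  have hc := halfFac_ne_zero A τ
  refine ⟨ContinuousLinearEquiv.equivOfInverse (halfFac A τ • mpDistCLM W A)
    ((halfFac A τ)⁻¹ • mpDistCLM W A⁻¹) (fun σ => ?_) (fun σ => ?_), fun σ => rfl⟩
  · change (halfFac A τ)⁻¹ • mpDist W A⁻¹ (halfFac A τ • mpDist W A σ) = σ
    rw [mpDist_smul, smul_smul, inv_mul_cancel₀ hc, one_smul, h1]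
  · change halfFac A τ • mpDist W A ((halfFac A τ)⁻¹ • mpDist W A⁻¹ σ) = σ
    rw [mpDist_smul, smul_smul, mul_inv_cancel₀ hc, one_smul, h2]

lemma continuous_spAct (M : Sp g) : Continuous (spAct W M) :=
  ((continuous_smul_disc M).comp continuous_fst).prodMk
    (((continuous_halfFac (mpLift k M)).comp continuous_fst).smul
      ((mpDistCLM W (mpLift k M)).continuous.comp continuous_snd))

theorem existsUnique_spAct {cov : Mp g k →* Sp g} (hcov : IsMetaplecticCovering cov)
    {h : Mp g k →* Equiv.Perm (HalfForm g)} (hh : IsHalfFormAction cov h) :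
    ∃! ρ : Sp g →* Equiv.Perm (CorrectedSection g k),
      (∀ (A : Mp g k) (σ : DistSection g k) (ν : HalfForm g),
        ρ (cov A) (tensor σ ν) = tensor (mpDist W A σ) (h A ν)) ∧
      (∀ (M : Sp g) (τ : SiegelDisc g), ∃ T : DistSection g k ≃L[ℂ] DistSection g k,
        ∀ σ : DistSection g k, ρ M (τ, σ) = (M • τ, T σ)) ∧
      (∀ M : Sp g, Continuous (ρ M)) := by
  obtain rfl := eq_covHom hcov
  obtain rfl := eq_halfAct hh
  refine ⟨spAct W, ⟨spAct_tensor W, exists_spAct_equiv W, continuous_spAct W⟩, ?_⟩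
  rintro ρ ⟨hρ, -, -⟩
  refine MonoidHom.ext fun M => Equiv.ext fun ⟨τ, σ⟩ => ?_
  -- Every matrix lifts and every point is a tensor with the half-form of coordinate `1`, so the
  -- intertwining property alone determines the action.
  obtain ⟨A, rfl⟩ := covHom_surjective (k := k) M
  rw [← tensor_one, hρ, spAct_tensor]

end ProductAction

end

end WeilTorus

theorem mainTheorem6 (g k : ℕ) [NeZero k] :
    (∃! W : DistSection g k ≃L[ℂ] (Idx g k → 𝓢'(Euc g, ℂ)), IsWeilBrezin W) ∧
    (∃! cov : Mp g k →* Sp g, IsMetaplecticCovering cov) ∧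
    ∀ (W : DistSection g k ≃L[ℂ] (Idx g k → 𝓢'(Euc g, ℂ))) (cov : Mp g k →* Sp g),
      IsWeilBrezin W → IsMetaplecticCovering cov →
      (∃! h : Mp g k →* Equiv.Perm (HalfForm g), IsHalfFormAction cov h) ∧
      ∀ h : Mp g k →* Equiv.Perm (HalfForm g), IsHalfFormAction cov h →
        ∃! ρ : Sp g →* Equiv.Perm (CorrectedSection g k),
          (∀ (A : Mp g k) (σ : DistSection g k) (ν : HalfForm g),
            ρ (cov A) (tensor σ ν) = tensor (mpDist W A σ) (h A ν)) ∧
          (∀ (M : Sp g) (τ : SiegelDisc g), ∃ T : DistSection g k ≃L[ℂ] DistSection g k,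
            ∀ σ : DistSection g k, ρ M (τ, σ) = (M • τ, T σ)) ∧
          (∀ M : Sp g, Continuous (ρ M)) := by
  refine ⟨existsUnique_weilBrezin, existsUnique_metaplecticCovering, fun W cov _ hcov =>
    ⟨existsUnique_halfFormAction hcov, fun _ hh => existsUnique_spAct W hcov hh⟩⟩
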